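/- Let $\mathcal G\rightrightarrows M$ be a (finite-dimensional, smooth, not necessarily Hausdorff) Lie groupoid with source $s$, target $t$, units $x\mapsto 1_x$, inversion $i$ and division map $\bar m(p,q)=pq^{-1}$ (defined when $s(p)=s(q)$). Let $A$, with $A_x=\ker(ds)_{1_x}$, be its Lie algebroid, $\rho=dt:A\to TM$ its anchor, and let $r_g$, $l_g$ denote the differentials of right and left translation by $g$. *Deformation cohomology.* $C^0_{\rm def}(\mathcal G)=\Gamma(A)$; for $k\ge 1$, $C^k_{\rm def}(\mathcal G)$ consists of the smooth maps $c$ on the manifold $\mathcal G^{(k)}$ of $k$ composable arrows with $c(g_1,\dots,g_k)\in T_{g_1}\mathcal G$ such that $ds\,c(g_1,\dots,g_k)$ does not depend on $g_1$ (for $k=1$: $c$ is an $s$-projectable vector field). The differential is $\delta\alpha=\overrightarrow{\alpha}+\overleftarrow{\alpha}$ in degree $0$, where $\overrightarrow\alpha(g)=r_g\alpha_{t(g)}$ and $\overleftarrow\alpha(g)=l_g\,di(\alpha_{s(g)})$, and for $k\ge1$ $$\delta c(g_1,\dots,g_{k+1})=-d\bar m\big(c(g_1g_2,\dots,g_{k+1}),c(g_2,\dots,g_{k+1})\big)+\sum_{i=2}^k(-1)^ic(\dots,g_ig_{i+1},\dots)+(-1)^{k+1}c(g_1,\dots,g_k).$$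 Its cohomology is $H^*_{\rm def}(\mathcal G)$. *Isotropy.* Let $\mathfrak i_x=\ker(\rho:A_x\to T_xM)$, let $ad_g:\mathfrak i_{s(g)}\to\mathfrak i_{t(g)}$ be the differential at the unit of conjugation by $g$, $\Gamma(\mathfrak i)=\ker(\rho:\Gamma(A)\to\mathfrak X(M))$, and $\Gamma(\mathfrak i)^{\rm inv}=\{\alpha\in\Gamma(\mathfrak i): ad_g\alpha_{s(g)}=\alpha_{t(g)}\ \forall g\}$. $H^*(\mathcal G,\mathfrak i)$ is the cohomology of the complex with $C^0(\mathcal G,\mathfrak i)=\Gamma(\mathfrak i)$ and with $C^k(\mathcal G,\mathfrak i)$ the maps $u$ on $\mathcal G^{(k)}$ with $u(g_1,\dots,g_k)\in\mathfrak i_{t(g_1)}$ that are smooth as $A$-valued maps, with differential $(\delta\alpha)(g)=ad_g\alpha_{s(g)}-\alpha_{t(g)}$ in degree $0$ and $\delta u(g_1,\dots,g_{k+1})=ad_{g_1}u(g_2,\dots,g_{k+1})+\sum_{i=1}^k(-1)^iu(\dots,g_ig_{i+1},\dots)+(-1)^{k+1}u(g_1,\dots,g_k)$ for $k\ge1$.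 *Normal sections.* Let $\Gamma(\nu)=\mathfrak X(M)/\rho(\Gamma(A))$. An $(s,t)$-lift of $V\in\mathfrak X(M)$ is an $X\in\mathfrak X(\mathcal G)$ that is both $s$- and $t$-projectable to $V$; $\Gamma(\nu)^{\rm inv}\subset\Gamma(\nu)$ is the subspace of the classes $[V]$ such that $V$ admits an $(s,t)$-lift. Then, in the degrees involved, coboundaries are cocycles, $\rho(\Gamma(A))\subset\mathfrak X(M)$, and there are well-defined linear maps forming an exact sequence $$0\to H^1(\mathcal G,\mathfrak i)\xrightarrow{\ r\ }H^1_{\rm def}(\mathcal G)\xrightarrow{\ \pi\ }\Gamma(\nu)^{\rm inv}\xrightarrow{\ K\ }H^2(\mathcal G,\mathfrak i)\xrightarrow{\ r\ }H^2_{\rm def}(\mathcal G),$$ where $r[u]=[c_u]$ with $c_u(g_1,\dots,g_k)=r_{g_1}u(g_1,\dots,g_k)$; every $1$-cocycle $X$ is an $(s,t)$-lift of a vector field $V$ on $M$ and $\pi[X]=[V]$; and $K$ is the cohomological curvature: for any $(s,t)$-lift $X$ of $V$ one has $\delta X=c_u$ for a cocycle $u\in C^2(\mathcal G,\mathfrak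 i)$, and $K[V]=[u]$. Moreover $H^0_{\rm def}(\mathcal G)=H^0(\mathcal G,\mathfrak i)=\Gamma(\mathfrak i)^{\rm inv}$, and $X\mapsto X$ induces an isomorphism from $H^1_{\rm def}(\mathcal G)$ onto the quotient of the space of multiplicative vector fields on $\mathcal G$ (vector fields that are groupoid morphisms $\mathcal G\to T\mathcal G$ over some $V\in\mathfrak X(M)$) by its subspace of inner ones, $\overrightarrow\alpha+\overleftarrow\alpha$ with $\alpha\in\Gamma(A)$. -/

import Mathlib

open scoped Manifold ContDiff

/-! ## Lie groupoids

All manifolds are real, smooth, without boundary and modelled on finite-dimensional vector spaces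
`E` (for arrows) and `E'` (for objects).  Neither the Hausdorff property nor second countability is
needed, so none is imposed. -/

/-- A map `f`, only meaningful on a subset `S` of a manifold `P`, is smooth on `S` when it extends,
locally around each point of `S`, to a smooth map on an open subset of `P`.  For an embedded
submanifold `S` this is smoothness for its manifold structure. -/
def SmoothOnSubset {EP : Type*} [NormedAddCommGroup EP] [NormedSpace ℝ EP]
    {HP : Type*} [TopologicalSpace HP] (IP : ModelWithCorners ℝ EP HP)
    {P : Type*} [TopologicalSpace P] [ChartedSpace HP P]
    {EN : Type*} [NormedAddCommGroup EN] [NormedSpace ℝ EN]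
    {HN : Type*} [TopologicalSpace HN] (IN : ModelWithCorners ℝ EN HN)
    {N : Type*} [TopologicalSpace N] [ChartedSpace HN N]
    (f : P → N) (S : Set P) : Prop :=
  ∀ p ∈ S, ∃ U : Set P, IsOpen U ∧ p ∈ U ∧
    ∃ F : P → N, ContMDiffOn IP IN ∞ F U ∧ ∀ q ∈ U, q ∈ S → F q = f q

/-- A Lie groupoid `G ⇉ M`.  An arrow `g` goes from `src g` to `tgt g`, and the product `mul g h` is
meaningful when `src g = tgt h`; its value on other pairs is arbitrary and never used. -/
structure LieGroupoid (E E' G M : Type*)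
    [NormedAddCommGroup E] [NormedSpace ℝ E] [NormedAddCommGroup E'] [NormedSpace ℝ E']
    [TopologicalSpace G] [ChartedSpace E G] [IsManifold 𝓘(ℝ, E) ∞ G]
    [TopologicalSpace M] [ChartedSpace E' M] [IsManifold 𝓘(ℝ, E') ∞ M] where
  src : G → M
  tgt : G → M
  one : M → G
  inv : G → G
  mul : G → G → G
  src_one : ∀ x, src (one x) = x
  tgt_one : ∀ x, tgt (one x) = x
  src_inv : ∀ g, src (inv g) = tgt g
  tgt_inv : ∀ g, tgt (inv g) = src g
  src_mul : ∀ g h, src g = tgt h → src (mul g h) = src h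
  tgt_mul : ∀ g h, src g = tgt h → tgt (mul g h) = tgt g
  mul_assoc : ∀ g h k, src g = tgt h → src h = tgt k → mul (mul g h) k = mul g (mul h k)
  one_mul : ∀ g, mul (one (tgt g)) g = g
  mul_one : ∀ g, mul g (one (src g)) = g
  mul_inv : ∀ g, mul g (inv g) = one (tgt g)
  inv_mul : ∀ g, mul (inv g) g = one (src g)
  submersion_src : Manifold.IsSubmersion 𝓘(ℝ, E) 𝓘(ℝ, E') ∞ src
  submersion_tgt : Manifold.IsSubmersion 𝓘(ℝ, E) 𝓘(ℝ, E') ∞ tgt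
  smooth_one : ContMDiff 𝓘(ℝ, E') 𝓘(ℝ, E) ∞ one
  smooth_inv : ContMDiff 𝓘(ℝ, E) 𝓘(ℝ, E) ∞ inv
  smooth_mul : SmoothOnSubset (𝓘(ℝ, E).prod 𝓘(ℝ, E)) 𝓘(ℝ, E) (fun p : G × G => mul p.1 p.2)
    {p : G × G | src p.1 = tgt p.2}

/-! ## Tangent vectors and smooth vector fields along maps -/

noncomputable section Along

variable {E : Type*} [NormedAddCommGroup E] [NormedSpace ℝ E]
  {N : Type*} [TopologicalSpace N] [ChartedSpace E N]

/-- The identification of the tangent spaces at two equal points. -/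
def tangentCast {x y : N} (h : x = y) :
    TangentSpace 𝓘(ℝ, E) x →L[ℝ] TangentSpace 𝓘(ℝ, E) y :=
  h ▸ ContinuousLinearMap.id ℝ (TangentSpace 𝓘(ℝ, E) x)

variable [IsManifold 𝓘(ℝ, E) ∞ N]
  {EP : Type*} [NormedAddCommGroup EP] [NormedSpace ℝ EP]
  {HP : Type*} [TopologicalSpace HP] {IP : ModelWithCorners ℝ EP HP}
  {P : Type*} [TopologicalSpace P] [ChartedSpace HP P]

theorem contMDiffOn_along_zero {b : P → N} {U : Set P} (hb : ContMDiffOn IP 𝓘(ℝ, E) ∞ b U) :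
    ContMDiffOn IP 𝓘(ℝ, E).tangent ∞
      (fun p => (⟨b p, 0⟩ : TangentBundle 𝓘(ℝ, E) N)) U :=
  (Bundle.contMDiff_zeroSection (n := ∞) ℝ (TangentSpace 𝓘(ℝ, E) : N → Type _)).comp_contMDiffOn hb

theorem contMDiffOn_along_add {b : P → N} {U : Set P} {c d : ∀ p, TangentSpace 𝓘(ℝ, E) (b p)}
    (hc : ContMDiffOn IP 𝓘(ℝ, E).tangent ∞ (fun p => (⟨b p, c p⟩ : TangentBundle 𝓘(ℝ, E) N)) U)
    (hd : ContMDiffOn IP 𝓘(ℝ, E).tangent ∞ (fun p => (⟨b p, d p⟩ : TangentBundle 𝓘(ℝ, E) N)) U) :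
    ContMDiffOn IP 𝓘(ℝ, E).tangent ∞
      (fun p => (⟨b p, c p + d p⟩ : TangentBundle 𝓘(ℝ, E) N)) U := by
  intro p hp
  have h1 := Bundle.contMDiffWithinAt_totalSpace.1 (hc p hp)
  have h2 := Bundle.contMDiffWithinAt_totalSpace.1 (hd p hp)
  refine Bundle.contMDiffWithinAt_totalSpace.2 ⟨h1.1, ?_⟩
  set e := trivializationAt E (TangentSpace 𝓘(ℝ, E) : N → Type _) (b p)
  refine (h1.2.add h2.2).congr_of_eventuallyEq ?_ ?_
  · have : ∀ᶠ q in nhdsWithin p U, b q ∈ e.baseSet :=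
      h1.1.continuousWithinAt (e.open_baseSet.mem_nhds (FiberBundle.mem_baseSet_trivializationAt' _))
    filter_upwards [this] with q hq
    exact (e.linear ℝ hq).map_add _ _
  · exact (e.linear ℝ (FiberBundle.mem_baseSet_trivializationAt' _)).map_add _ _

theorem contMDiffOn_along_smul {b : P → N} {U : Set P} {c : ∀ p, TangentSpace 𝓘(ℝ, E) (b p)} (a : ℝ)
    (hc : ContMDiffOn IP 𝓘(ℝ, E).tangent ∞ (fun p => (⟨b p, c p⟩ : TangentBundle 𝓘(ℝ, E) N)) U) :
    ContMDiffOn IP 𝓘(ℝ, E).tangent ∞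
      (fun p => (⟨b p, a • c p⟩ : TangentBundle 𝓘(ℝ, E) N)) U := by
  intro p hp
  have h1 := Bundle.contMDiffWithinAt_totalSpace.1 (hc p hp)
  refine Bundle.contMDiffWithinAt_totalSpace.2 ⟨h1.1, ?_⟩
  set e := trivializationAt E (TangentSpace 𝓘(ℝ, E) : N → Type _) (b p)
  have h2 : ContMDiffWithinAt IP 𝓘(ℝ, E) ∞ (fun q => a • (e ⟨b q, c q⟩).2) U p :=
    (contMDiffWithinAt_const (c := a) (I' := 𝓘(ℝ, ℝ))).smul h1.2
  refine h2.congr_of_eventuallyEq ?_ ?_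
  · have : ∀ᶠ q in nhdsWithin p U, b q ∈ e.baseSet :=
      h1.1.continuousWithinAt (e.open_baseSet.mem_nhds (FiberBundle.mem_baseSet_trivializationAt' _))
    filter_upwards [this] with q hq
    exact (e.linear ℝ hq).map_smul _ _
  · exact (e.linear ℝ (FiberBundle.mem_baseSet_trivializationAt' _)).map_smul _ _

variable (IP) in
/-- The vector fields along the restriction of `b : P → N` to a subset `S` of `P` that are smooth,
i.e. that extend, locally around each point of `S`, to smooth vector fields along `b` on an open
subset of `P`. -/
def smoothAlong {b : P → N} (hb : ContMDiff IP 𝓘(ℝ, E) ∞ b) (S : Set P) :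
    Submodule ℝ (∀ p : S, TangentSpace 𝓘(ℝ, E) (b p)) where
  carrier := {c | ∀ p ∈ S, ∃ U : Set P, IsOpen U ∧ p ∈ U ∧
    ∃ F : ∀ q, TangentSpace 𝓘(ℝ, E) (b q),
      ContMDiffOn IP 𝓘(ℝ, E).tangent ∞ (fun q => (⟨b q, F q⟩ : TangentBundle 𝓘(ℝ, E) N)) U ∧
      ∀ q : S, (q : P) ∈ U → F q = c q}
  zero_mem' := fun p _ => ⟨Set.univ, isOpen_univ, trivial, fun _ => 0,
    contMDiffOn_along_zero hb.contMDiffOn, fun _ _ => rfl⟩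
  add_mem' := by
    intro c d hc hd p hp
    obtain ⟨U, hU, hpU, F, hF, hFc⟩ := hc p hp
    obtain ⟨V, hV, hpV, F', hF', hFd⟩ := hd p hp
    refine ⟨U ∩ V, hU.inter hV, ⟨hpU, hpV⟩, fun q => F q + F' q,
      contMDiffOn_along_add (hF.mono Set.inter_subset_left) (hF'.mono Set.inter_subset_right), ?_⟩
    intro q hq
    simp [hFc q hq.1, hFd q hq.2]
  smul_mem' := by
    intro a c hc p hp
    obtain ⟨U, hU, hpU, F, hF, hFc⟩ := hc p hp
    refine ⟨U, hU, hpU, fun q => a • F q, contMDiffOn_along_smul a hF, ?_⟩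
    intro q hq
    simp [hFc q hq]

variable (IP) in
/-- The smooth vector fields along a smooth map `b : P → N`. -/
def smoothFields {b : P → N} (hb : ContMDiff IP 𝓘(ℝ, E) ∞ b) :
    Submodule ℝ (∀ p, TangentSpace 𝓘(ℝ, E) (b p)) where
  carrier := {c | ContMDiff IP 𝓘(ℝ, E).tangent ∞
    (fun q => (⟨b q, c q⟩ : TangentBundle 𝓘(ℝ, E) N))}
  zero_mem' := contMDiffOn_univ.1 (contMDiffOn_along_zero hb.contMDiffOn)
  add_mem' := fun hc hd => contMDiffOn_univ.1
    (contMDiffOn_along_add (contMDiffOn_univ.2 hc) (contMDiffOn_univ.2 hd))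
  smul_mem' := fun a _ hc => contMDiffOn_univ.1 (contMDiffOn_along_smul a (contMDiffOn_univ.2 hc))

variable (E N) in
/-- `𝔛(N)`, the smooth vector fields on `N`. -/
def vectorFields : Submodule ℝ (∀ x : N, TangentSpace 𝓘(ℝ, E) x) :=
  smoothFields 𝓘(ℝ, E) (b := id) contMDiff_id

end Along

namespace LieGroupoid

noncomputable section

variable {E E' G M : Type*}
  [NormedAddCommGroup E] [NormedSpace ℝ E] [NormedAddCommGroup E'] [NormedSpace ℝ E']
  [TopologicalSpace G] [ChartedSpace E G] [IsManifold 𝓘(ℝ, E) ∞ G]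
  [TopologicalSpace M] [ChartedSpace E' M] [IsManifold 𝓘(ℝ, E') ∞ M]
  (𝒢 : LieGroupoid E E' G M)

/-! ### Differentials of the structure maps

The maps `mul`, `div` and the translations live on embedded submanifolds (fibred products, fibres of
`src` and `tgt`), so their differentials are taken within these subsets; they are only ever applied
to vectors tangent to the subset, on which the derivative within the subset is determined. -/

/-- Pairs of composable arrows, as a subset of `G × G`. -/
def composable : Set (G × G) := {p | 𝒢.src p.1 = 𝒢.tgt p.2}

/-- Triples of composable arrows, as a subset of `G × G × G`. -/
def composable₃ : Set (G × G × G) :=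
  {p | 𝒢.src p.1 = 𝒢.tgt p.2.1 ∧ 𝒢.src p.2.1 = 𝒢.tgt p.2.2}

/-- `ds` at the arrow `g`. -/
def dsrc (g : G) : TangentSpace 𝓘(ℝ, E) g →L[ℝ] TangentSpace 𝓘(ℝ, E') (𝒢.src g) :=
  mfderiv 𝓘(ℝ, E) 𝓘(ℝ, E') 𝒢.src g

/-- `dt` at the arrow `g`. -/
def dtgt (g : G) : TangentSpace 𝓘(ℝ, E) g →L[ℝ] TangentSpace 𝓘(ℝ, E') (𝒢.tgt g) :=
  mfderiv 𝓘(ℝ, E) 𝓘(ℝ, E') 𝒢.tgt g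

/-- The division map `(p, q) ↦ p q⁻¹`, meaningful when `src p = src q`. -/
def div (p q : G) : G := 𝒢.mul p (𝒢.inv q)

/-- The differential of the division map `G ×ₛ G → G` at `(p, q)`. -/
def ddiv (p q : G) : TangentSpace 𝓘(ℝ, E) p × TangentSpace 𝓘(ℝ, E) q →L[ℝ]
    TangentSpace 𝓘(ℝ, E) (𝒢.div p q) :=
  mfderivWithin (𝓘(ℝ, E).prod 𝓘(ℝ, E)) 𝓘(ℝ, E) (fun z : G × G => 𝒢.div z.1 z.2)
    {z : G × G | 𝒢.src z.1 = 𝒢.src z.2} (p, q)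

/-- The differential of the multiplication at the composable pair `(g, h)`. -/
def dmul (g h : G) : TangentSpace 𝓘(ℝ, E) g × TangentSpace 𝓘(ℝ, E) h →L[ℝ]
    TangentSpace 𝓘(ℝ, E) (𝒢.mul g h) :=
  mfderivWithin (𝓘(ℝ, E).prod 𝓘(ℝ, E)) 𝓘(ℝ, E) (fun z : G × G => 𝒢.mul z.1 z.2)
    𝒢.composable (g, h)

/-- The differential at `b` of the right translation `b ↦ b g`, defined on the `src`-fibre over
`tgt g`. -/
def rightTr (g b : G) : TangentSpace 𝓘(ℝ, E) b →L[ℝ] TangentSpace 𝓘(ℝ, E) (𝒢.mul b g) :=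
  mfderivWithin 𝓘(ℝ, E) 𝓘(ℝ, E) (fun z => 𝒢.mul z g) {z | 𝒢.src z = 𝒢.tgt g} b

/-- The differential at `a` of the left translation `a ↦ g a`, defined on the `tgt`-fibre over
`src g`. -/
def leftTr (g a : G) : TangentSpace 𝓘(ℝ, E) a →L[ℝ] TangentSpace 𝓘(ℝ, E) (𝒢.mul g a) :=
  mfderivWithin 𝓘(ℝ, E) 𝓘(ℝ, E) (fun z => 𝒢.mul g z) {z | 𝒢.tgt z = 𝒢.src g} a

/-- `r_g`, from the tangent space at the unit of `tgt g` to the tangent space at `g`. -/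
def transportRight (g : G) :
    TangentSpace 𝓘(ℝ, E) (𝒢.one (𝒢.tgt g)) →L[ℝ] TangentSpace 𝓘(ℝ, E) g :=
  (tangentCast (𝒢.one_mul g)).comp (𝒢.rightTr g (𝒢.one (𝒢.tgt g)))

/-! ### The Lie algebroid, its anchor, and the isotropy -/

/-- The fibre `A_x = Ker (ds)` at the unit of `x`. -/
def algebroidFibre (x : M) : Submodule ℝ (TangentSpace 𝓘(ℝ, E) (𝒢.one x)) :=
  LinearMap.ker (𝒢.dsrc (𝒢.one x)).toLinearMap

/-- The fibre `𝔦_x` of the isotropy bundle, the kernel of the anchor `dt` on `A_x`. -/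
def isotropyFibre (x : M) : Submodule ℝ (TangentSpace 𝓘(ℝ, E) (𝒢.one x)) :=
  𝒢.algebroidFibre x ⊓ LinearMap.ker (𝒢.dtgt (𝒢.one x)).toLinearMap

/-- `Γ(A)`. -/
def sectionsA : Submodule ℝ (∀ x : M, TangentSpace 𝓘(ℝ, E) (𝒢.one x)) :=
  smoothFields 𝓘(ℝ, E') 𝒢.smooth_one ⊓ Submodule.pi Set.univ 𝒢.algebroidFibre

/-- The anchor `ρ`, on sections. -/
def anchor : (∀ x : M, TangentSpace 𝓘(ℝ, E) (𝒢.one x)) →ₗ[ℝ] (∀ x : M, TangentSpace 𝓘(ℝ, E') x) where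
  toFun α x := tangentCast (𝒢.tgt_one x) (𝒢.dtgt (𝒢.one x) (α x))
  map_add' α β := by ext x; simp
  map_smul' a α := by ext x; simp

/-- `Γ(𝔦) = Ker (ρ : Γ(A) → 𝔛(M))`. -/
def sectionsIso : Submodule ℝ (∀ x : M, TangentSpace 𝓘(ℝ, E) (𝒢.one x)) :=
  𝒢.sectionsA ⊓ LinearMap.ker 𝒢.anchor

/-- `ad_g`, the differential at the unit of the conjugation `a ↦ g a g⁻¹`, that is, the differential
of `L_g` followed by that of `R_{g⁻¹}`; it is applied to vectors in `𝔦_{src g}`. -/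
def ad (g : G) :
    TangentSpace 𝓘(ℝ, E) (𝒢.one (𝒢.src g)) →L[ℝ] TangentSpace 𝓘(ℝ, E) (𝒢.one (𝒢.tgt g)) :=
  (tangentCast (show 𝒢.mul (𝒢.mul g (𝒢.one (𝒢.src g))) (𝒢.inv g) = 𝒢.one (𝒢.tgt g) by
    rw [𝒢.mul_one, 𝒢.mul_inv])).comp
  ((𝒢.rightTr (𝒢.inv g) (𝒢.mul g (𝒢.one (𝒢.src g)))).comp (𝒢.leftTr g (𝒢.one (𝒢.src g))))

/-- `Γ(𝔦)^inv`. -/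
def invariantSectionsIso : Submodule ℝ (∀ x : M, TangentSpace 𝓘(ℝ, E) (𝒢.one x)) where
  carrier := {α | α ∈ 𝒢.sectionsIso ∧ ∀ g, 𝒢.ad g (α (𝒢.src g)) = α (𝒢.tgt g)}
  zero_mem' := ⟨Submodule.zero_mem _, fun g => by simp⟩
  add_mem' := fun ha hb => ⟨Submodule.add_mem _ ha.1 hb.1, fun g => by simp [ha.2 g, hb.2 g]⟩
  smul_mem' := fun a _ hb => ⟨Submodule.smul_mem _ a hb.1, fun g => by simp [hb.2 g]⟩

/-! ### The deformation complex in degrees `0, 1, 2`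

The differentials are given by their formulas on all (not necessarily smooth) cochains. -/

/-- The right invariant field `g ↦ r_g (α_{tgt g})`. -/
def rightInvariant (α : ∀ x : M, TangentSpace 𝓘(ℝ, E) (𝒢.one x)) (g : G) :
    TangentSpace 𝓘(ℝ, E) g :=
  𝒢.transportRight g (α (𝒢.tgt g))

/-- The left invariant field `g ↦ l_g (di (α_{src g}))`. -/
def leftInvariant (α : ∀ x : M, TangentSpace 𝓘(ℝ, E) (𝒢.one x)) (g : G) :
    TangentSpace 𝓘(ℝ, E) g :=
  tangentCast (show 𝒢.mul g (𝒢.inv (𝒢.one (𝒢.src g))) = g by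
    have h : 𝒢.inv (𝒢.one (𝒢.src g)) = 𝒢.one (𝒢.src g) := by
      have h1 := 𝒢.one_mul (𝒢.inv (𝒢.one (𝒢.src g)))
      have h2 := 𝒢.mul_inv (𝒢.one (𝒢.src g))
      rw [𝒢.tgt_inv, 𝒢.src_one] at h1
      rw [h1, 𝒢.tgt_one] at h2
      exact h2
    rw [h, 𝒢.mul_one])
  (𝒢.leftTr g (𝒢.inv (𝒢.one (𝒢.src g)))
    (mfderiv 𝓘(ℝ, E) 𝓘(ℝ, E) 𝒢.inv (𝒢.one (𝒢.src g)) (α (𝒢.src g))))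

/-- `δ α`, the sum of the right and the left invariant field of `α`. -/
def defD₀ : (∀ x : M, TangentSpace 𝓘(ℝ, E) (𝒢.one x)) →ₗ[ℝ] (∀ g : G, TangentSpace 𝓘(ℝ, E) g) where
  toFun α g := 𝒢.rightInvariant α g + 𝒢.leftInvariant α g
  map_add' α β := by ext g; simp [rightInvariant, leftInvariant]; abel
  map_smul' a α := by ext g; simp [rightInvariant, leftInvariant]

theorem div_mul_cancel {g h : G} (H : 𝒢.src g = 𝒢.tgt h) : 𝒢.div (𝒢.mul g h) h = g := by
  rw [div, 𝒢.mul_assoc g h _ H (𝒢.tgt_inv h).symm, 𝒢.mul_inv, ← H, 𝒢.mul_one]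

/-- `(δ c)(g, h) = - dm̄ (c (gh), c h) + c g`. -/
def defD₁ : (∀ g : G, TangentSpace 𝓘(ℝ, E) g) →ₗ[ℝ]
    (∀ p : 𝒢.composable, TangentSpace 𝓘(ℝ, E) p.1.1) where
  toFun c p := - tangentCast (𝒢.div_mul_cancel p.2)
      (𝒢.ddiv (𝒢.mul p.1.1 p.1.2) p.1.2 (c (𝒢.mul p.1.1 p.1.2), c p.1.2)) + c p.1.1
  map_add' c d := by
    ext p
    simp only [Pi.add_apply, ← Prod.mk_add_mk, map_add]
    abel
  map_smul' a c := by
    ext p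
    simp only [Pi.smul_apply, ← Prod.smul_mk, map_smul, RingHom.id_apply, smul_add, smul_neg]

/-- The value `c (g, h)` of a `2`-cochain. -/
def defVal (c : ∀ p : 𝒢.composable, TangentSpace 𝓘(ℝ, E) p.1.1) {g h : G}
    (H : 𝒢.src g = 𝒢.tgt h) : TangentSpace 𝓘(ℝ, E) g :=
  c ⟨(g, h), H⟩

theorem defVal_add (c d : ∀ p : 𝒢.composable, TangentSpace 𝓘(ℝ, E) p.1.1) {g h : G}
    (H : 𝒢.src g = 𝒢.tgt h) : 𝒢.defVal (c + d) H = 𝒢.defVal c H + 𝒢.defVal d H := rfl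

theorem defVal_smul (a : ℝ) (c : ∀ p : 𝒢.composable, TangentSpace 𝓘(ℝ, E) p.1.1) {g h : G}
    (H : 𝒢.src g = 𝒢.tgt h) : 𝒢.defVal (a • c) H = a • 𝒢.defVal c H := rfl

theorem mul_composable {g h k : G} (H : 𝒢.src g = 𝒢.tgt h) (H' : 𝒢.src h = 𝒢.tgt k) :
    𝒢.src (𝒢.mul g h) = 𝒢.tgt k := (𝒢.src_mul g h H).trans H'

theorem composable_mul {g h k : G} (H : 𝒢.src g = 𝒢.tgt h) (H' : 𝒢.src h = 𝒢.tgt k) :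
    𝒢.src g = 𝒢.tgt (𝒢.mul h k) := H.trans (𝒢.tgt_mul h k H').symm

/-- `(δ c)(g₁, g₂, g₃) = - dm̄ (c (g₁ g₂, g₃), c (g₂, g₃)) + c (g₁, g₂ g₃) - c (g₁, g₂)`. -/
def defD₂ : (∀ p : 𝒢.composable, TangentSpace 𝓘(ℝ, E) p.1.1) →ₗ[ℝ]
    (∀ p : 𝒢.composable₃, TangentSpace 𝓘(ℝ, E) p.1.1) where
  toFun c p := - tangentCast (𝒢.div_mul_cancel p.2.1)
      (𝒢.ddiv (𝒢.mul p.1.1 p.1.2.1) p.1.2.1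
        (𝒢.defVal c (𝒢.mul_composable p.2.1 p.2.2), 𝒢.defVal c p.2.2))
      + 𝒢.defVal c (𝒢.composable_mul p.2.1 p.2.2) - 𝒢.defVal c p.2.1
  map_add' c d := by
    ext p
    simp only [Pi.add_apply, defVal_add, ← Prod.mk_add_mk, map_add]
    abel
  map_smul' a c := by
    ext p
    simp only [Pi.smul_apply, defVal_smul, ← Prod.smul_mk, map_smul, RingHom.id_apply, smul_add,
      smul_neg, smul_sub]

/-- `X` is `s`-projectable to `V`. -/
def SrcProjects (X : ∀ g : G, TangentSpace 𝓘(ℝ, E) g) (V : ∀ x : M, TangentSpace 𝓘(ℝ, E') x) :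
    Prop :=
  ∀ g, 𝒢.dsrc g (X g) = V (𝒢.src g)

/-- `X` is `t`-projectable to `V`. -/
def TgtProjects (X : ∀ g : G, TangentSpace 𝓘(ℝ, E) g) (V : ∀ x : M, TangentSpace 𝓘(ℝ, E') x) :
    Prop :=
  ∀ g, 𝒢.dtgt g (X g) = V (𝒢.tgt g)

/-- `C¹_def`: the smooth vector fields on `G` that are `s`-projectable. -/
def defC₁ : Submodule ℝ (∀ g : G, TangentSpace 𝓘(ℝ, E) g) where
  carrier := {c | c ∈ vectorFields E G ∧ ∃ V, 𝒢.SrcProjects c V}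
  zero_mem' := ⟨Submodule.zero_mem _, 0, fun g => by simp⟩
  add_mem' := by
    rintro c d ⟨hc, V, hV⟩ ⟨hd, W, hW⟩
    exact ⟨Submodule.add_mem _ hc hd, V + W, fun g => by simp [hV g, hW g]⟩
  smul_mem' := by
    rintro a c ⟨hc, V, hV⟩
    exact ⟨Submodule.smul_mem _ a hc, a • V, fun g => by simp [hV g]⟩

/-- `C²_def`: the smooth maps `(g, h) ↦ c (g, h) ∈ T_g G` for which `ds (c (g, h))` does not depend
on `g`. -/
def defC₂ : Submodule ℝ (∀ p : 𝒢.composable, TangentSpace 𝓘(ℝ, E) p.1.1) where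
  carrier := {c | c ∈ smoothAlong (𝓘(ℝ, E).prod 𝓘(ℝ, E)) (b := Prod.fst) contMDiff_fst 𝒢.composable ∧
    ∃ sc : ∀ h : G, TangentSpace 𝓘(ℝ, E') (𝒢.tgt h),
      ∀ p : 𝒢.composable, tangentCast p.2 (𝒢.dsrc p.1.1 (c p)) = sc p.1.2}
  zero_mem' := ⟨Submodule.zero_mem _, 0, fun p => by simp⟩
  add_mem' := by
    rintro c d ⟨hc, V, hV⟩ ⟨hd, W, hW⟩
    exact ⟨Submodule.add_mem _ hc hd, V + W, fun g => by simp [hV g, hW g]⟩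
  smul_mem' := by
    rintro a c ⟨hc, V, hV⟩
    exact ⟨Submodule.smul_mem _ a hc, a • V, fun g => by simp [hV g]⟩

/-- The `0`-cocycles; as there are no coboundaries in degree `0`, this is `H⁰_def`. -/
def defZ₀ : Submodule ℝ (∀ x : M, TangentSpace 𝓘(ℝ, E) (𝒢.one x)) :=
  𝒢.sectionsA ⊓ LinearMap.ker 𝒢.defD₀

/-- The `1`-cocycles of the deformation complex. -/
def defZ₁ : Submodule ℝ (∀ g : G, TangentSpace 𝓘(ℝ, E) g) := 𝒢.defC₁ ⊓ LinearMap.ker 𝒢.defD₁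

/-- The `1`-coboundaries of the deformation complex. -/
def defB₁ : Submodule ℝ (∀ g : G, TangentSpace 𝓘(ℝ, E) g) := 𝒢.sectionsA.map 𝒢.defD₀

/-- The `2`-cocycles of the deformation complex. -/
def defZ₂ : Submodule ℝ (∀ p : 𝒢.composable, TangentSpace 𝓘(ℝ, E) p.1.1) :=
  𝒢.defC₂ ⊓ LinearMap.ker 𝒢.defD₂

/-- The `2`-coboundaries of the deformation complex. -/
def defB₂ : Submodule ℝ (∀ p : 𝒢.composable, TangentSpace 𝓘(ℝ, E) p.1.1) := 𝒢.defC₁.map 𝒢.defD₁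

/-- `H¹_def(𝒢)`. -/
abbrev DefH₁ : Type _ := 𝒢.defZ₁ ⧸ 𝒢.defB₁.submoduleOf 𝒢.defZ₁

/-- `H²_def(𝒢)`. -/
abbrev DefH₂ : Type _ := 𝒢.defZ₂ ⧸ 𝒢.defB₂.submoduleOf 𝒢.defZ₂

/-- The class in `H¹_def`. -/
abbrev defClass₁ (X : 𝒢.defZ₁) : 𝒢.DefH₁ := Submodule.Quotient.mk X

/-- The class in `H²_def`. -/
abbrev defClass₂ (c : 𝒢.defZ₂) : 𝒢.DefH₂ := Submodule.Quotient.mk c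

/-! ### Differentiable cohomology with values in the isotropy, in degrees `0, 1, 2`

A `k`-cochain assigns to `(g₁, …, g_k)` a vector in `𝔦_{tgt g₁}`, smoothly as a map to `A`; a
`0`-cochain is an element of `Γ(𝔦)`. -/

theorem smooth_one_tgt : ContMDiff 𝓘(ℝ, E) 𝓘(ℝ, E) ∞ (fun g => 𝒢.one (𝒢.tgt g)) :=
  𝒢.smooth_one.comp 𝒢.submersion_tgt.contMDiff

/-- `C¹(𝒢, 𝔦)`. -/
def isoC₁ : Submodule ℝ (∀ g : G, TangentSpace 𝓘(ℝ, E) (𝒢.one (𝒢.tgt g))) :=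
  smoothFields 𝓘(ℝ, E) 𝒢.smooth_one_tgt ⊓
    Submodule.pi Set.univ (fun g => 𝒢.isotropyFibre (𝒢.tgt g))

/-- `C²(𝒢, 𝔦)`. -/
def isoC₂ : Submodule ℝ (∀ p : 𝒢.composable, TangentSpace 𝓘(ℝ, E) (𝒢.one (𝒢.tgt p.1.1))) :=
  smoothAlong (𝓘(ℝ, E).prod 𝓘(ℝ, E)) (b := fun p : G × G => 𝒢.one (𝒢.tgt p.1))
      (𝒢.smooth_one_tgt.comp contMDiff_fst) 𝒢.composable ⊓
    Submodule.pi Set.univ (fun p => 𝒢.isotropyFibre (𝒢.tgt p.1.1))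

/-- `(δ α)(g) = ad_g (α (src g)) - α (tgt g)`. -/
def isoD₀ : (∀ x : M, TangentSpace 𝓘(ℝ, E) (𝒢.one x)) →ₗ[ℝ]
    (∀ g : G, TangentSpace 𝓘(ℝ, E) (𝒢.one (𝒢.tgt g))) where
  toFun α g := 𝒢.ad g (α (𝒢.src g)) - α (𝒢.tgt g)
  map_add' α β := by ext g; simp only [Pi.add_apply, map_add]; abel
  map_smul' a α := by ext g; simp [smul_sub]

/-- `ad_g`, with the source of `g` written as the target of an arrow composable with `g`. -/
def adAt {g h : G} (H : 𝒢.src g = 𝒢.tgt h) :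
    TangentSpace 𝓘(ℝ, E) (𝒢.one (𝒢.tgt h)) →L[ℝ] TangentSpace 𝓘(ℝ, E) (𝒢.one (𝒢.tgt g)) :=
  (𝒢.ad g).comp (tangentCast (congrArg 𝒢.one H.symm))

/-- `(δ u)(g, h) = ad_g (u h) - u (gh) + u g`. -/
def isoD₁ : (∀ g : G, TangentSpace 𝓘(ℝ, E) (𝒢.one (𝒢.tgt g))) →ₗ[ℝ]
    (∀ p : 𝒢.composable, TangentSpace 𝓘(ℝ, E) (𝒢.one (𝒢.tgt p.1.1))) where
  toFun u p := 𝒢.adAt p.2 (u p.1.2)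
    - tangentCast (congrArg 𝒢.one (𝒢.tgt_mul _ _ p.2)) (u (𝒢.mul p.1.1 p.1.2)) + u p.1.1
  map_add' c d := by ext p; simp only [Pi.add_apply, map_add]; abel
  map_smul' a c := by ext p; simp [smul_sub]

/-- The value `u (g, h)` of a `2`-cochain with values in the isotropy. -/
def isoVal (u : ∀ p : 𝒢.composable, TangentSpace 𝓘(ℝ, E) (𝒢.one (𝒢.tgt p.1.1))) {g h : G}
    (H : 𝒢.src g = 𝒢.tgt h) : TangentSpace 𝓘(ℝ, E) (𝒢.one (𝒢.tgt g)) :=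
  u ⟨(g, h), H⟩

theorem isoVal_add (u v : ∀ p : 𝒢.composable, TangentSpace 𝓘(ℝ, E) (𝒢.one (𝒢.tgt p.1.1)))
    {g h : G} (H : 𝒢.src g = 𝒢.tgt h) : 𝒢.isoVal (u + v) H = 𝒢.isoVal u H + 𝒢.isoVal v H := rfl

theorem isoVal_smul (a : ℝ) (u : ∀ p : 𝒢.composable, TangentSpace 𝓘(ℝ, E) (𝒢.one (𝒢.tgt p.1.1)))
    {g h : G} (H : 𝒢.src g = 𝒢.tgt h) : 𝒢.isoVal (a • u) H = a • 𝒢.isoVal u H := rfl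

/-- `(δ u)(g₁, g₂, g₃) = ad_{g₁} (u (g₂, g₃)) - u (g₁ g₂, g₃) + u (g₁, g₂ g₃) - u (g₁, g₂)`. -/
def isoD₂ : (∀ p : 𝒢.composable, TangentSpace 𝓘(ℝ, E) (𝒢.one (𝒢.tgt p.1.1))) →ₗ[ℝ]
    (∀ p : 𝒢.composable₃, TangentSpace 𝓘(ℝ, E) (𝒢.one (𝒢.tgt p.1.1))) where
  toFun u p := 𝒢.adAt p.2.1 (𝒢.isoVal u p.2.2)
    - tangentCast (congrArg 𝒢.one (𝒢.tgt_mul _ _ p.2.1))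
        (𝒢.isoVal u (𝒢.mul_composable p.2.1 p.2.2))
    + 𝒢.isoVal u (𝒢.composable_mul p.2.1 p.2.2) - 𝒢.isoVal u p.2.1
  map_add' c d := by ext p; simp only [Pi.add_apply, isoVal_add, map_add]; abel
  map_smul' a c := by
    ext p
    simp only [Pi.smul_apply, isoVal_smul, map_smul, RingHom.id_apply, smul_add, smul_sub]

/-- The `0`-cocycles; as there are no coboundaries in degree `0`, this is `H⁰(𝒢, 𝔦)`. -/
def isoZ₀ : Submodule ℝ (∀ x : M, TangentSpace 𝓘(ℝ, E) (𝒢.one x)) :=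
  𝒢.sectionsIso ⊓ LinearMap.ker 𝒢.isoD₀

/-- The `1`-cocycles of `C*(𝒢, 𝔦)`. -/
def isoZ₁ : Submodule ℝ (∀ g : G, TangentSpace 𝓘(ℝ, E) (𝒢.one (𝒢.tgt g))) :=
  𝒢.isoC₁ ⊓ LinearMap.ker 𝒢.isoD₁

/-- The `1`-coboundaries of `C*(𝒢, 𝔦)`. -/
def isoB₁ : Submodule ℝ (∀ g : G, TangentSpace 𝓘(ℝ, E) (𝒢.one (𝒢.tgt g))) :=
  𝒢.sectionsIso.map 𝒢.isoD₀

/-- The `2`-cocycles of `C*(𝒢, 𝔦)`. -/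
def isoZ₂ : Submodule ℝ (∀ p : 𝒢.composable, TangentSpace 𝓘(ℝ, E) (𝒢.one (𝒢.tgt p.1.1))) :=
  𝒢.isoC₂ ⊓ LinearMap.ker 𝒢.isoD₂

/-- The `2`-coboundaries of `C*(𝒢, 𝔦)`. -/
def isoB₂ : Submodule ℝ (∀ p : 𝒢.composable, TangentSpace 𝓘(ℝ, E) (𝒢.one (𝒢.tgt p.1.1))) :=
  𝒢.isoC₁.map 𝒢.isoD₁

/-- `H¹(𝒢, 𝔦)`. -/
abbrev IsoH₁ : Type _ := 𝒢.isoZ₁ ⧸ 𝒢.isoB₁.submoduleOf 𝒢.isoZ₁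

/-- `H²(𝒢, 𝔦)`. -/
abbrev IsoH₂ : Type _ := 𝒢.isoZ₂ ⧸ 𝒢.isoB₂.submoduleOf 𝒢.isoZ₂

/-- The class in `H¹(𝒢, 𝔦)`. -/
abbrev isoClass₁ (u : 𝒢.isoZ₁) : 𝒢.IsoH₁ := Submodule.Quotient.mk u

/-- The class in `H²(𝒢, 𝔦)`. -/
abbrev isoClass₂ (u : 𝒢.isoZ₂) : 𝒢.IsoH₂ := Submodule.Quotient.mk u

/-- The inclusion `r` in degree `1`: `g ↦ r_g (u g)`. -/
def incl₁ : (∀ g : G, TangentSpace 𝓘(ℝ, E) (𝒢.one (𝒢.tgt g))) →ₗ[ℝ]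
    (∀ g : G, TangentSpace 𝓘(ℝ, E) g) where
  toFun u g := 𝒢.transportRight g (u g)
  map_add' c d := by ext p; simp
  map_smul' a c := by ext p; simp

/-- The inclusion `r` in degree `2`: `(g, h) ↦ r_g (u (g, h))`. -/
def incl₂ : (∀ p : 𝒢.composable, TangentSpace 𝓘(ℝ, E) (𝒢.one (𝒢.tgt p.1.1))) →ₗ[ℝ]
    (∀ p : 𝒢.composable, TangentSpace 𝓘(ℝ, E) p.1.1) where
  toFun u p := 𝒢.transportRight p.1.1 (u p)
  map_add' c d := by ext p; simp
  map_smul' a c := by ext p; simp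

/-! ### Multiplicative vector fields and the normal representation -/

/-- The multiplicative vector fields: the smooth `X` that, as maps `G → TG`, are morphisms of
groupoids over some `V ∈ 𝔛(M)`. -/
def multiplicative : Submodule ℝ (∀ g : G, TangentSpace 𝓘(ℝ, E) g) where
  carrier := {X | X ∈ vectorFields E G ∧ ∃ V ∈ vectorFields E' M,
    𝒢.SrcProjects X V ∧ 𝒢.TgtProjects X V ∧
    (∀ x, mfderiv 𝓘(ℝ, E') 𝓘(ℝ, E) 𝒢.one x (V x) = X (𝒢.one x)) ∧
    ∀ g h, 𝒢.src g = 𝒢.tgt h → X (𝒢.mul g h) = 𝒢.dmul g h (X g, X h)}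
  zero_mem' := ⟨Submodule.zero_mem _, 0, Submodule.zero_mem _, fun g => by simp, fun g => by simp,
    fun x => by simp, fun g h _ => by
      simp only [Pi.zero_apply]; exact (map_zero (𝒢.dmul g h)).symm⟩
  add_mem' := by
    rintro X Y ⟨hX, V, hV, h1, h2, h3, h4⟩ ⟨hY, W, hW, k1, k2, k3, k4⟩
    refine ⟨Submodule.add_mem _ hX hY, V + W, Submodule.add_mem _ hV hW, fun g => ?_, fun g => ?_,
      fun x => ?_, fun g h H => ?_⟩
    · simp [h1 g, k1 g]
    · simp [h2 g, k2 g]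
    · simp [h3 x, k3 x]
    · simp only [Pi.add_apply, h4 g h H, k4 g h H, ← Prod.mk_add_mk, map_add]
  smul_mem' := by
    rintro a X ⟨hX, V, hV, h1, h2, h3, h4⟩
    refine ⟨Submodule.smul_mem _ a hX, a • V, Submodule.smul_mem _ a hV, fun g => ?_, fun g => ?_,
      fun x => ?_, fun g h H => ?_⟩
    · simp [h1 g]
    · simp [h2 g]
    · simp [h3 x]
    · simp only [Pi.smul_apply, h4 g h H, ← Prod.smul_mk, map_smul]

/-- The inner multiplicative vector fields: the sums of the right and the left invariant field of
some `α ∈ Γ(A)`. -/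
def innerMultiplicative : Submodule ℝ (∀ g : G, TangentSpace 𝓘(ℝ, E) g) where
  carrier := {X | ∃ α ∈ 𝒢.sectionsA, X = 𝒢.rightInvariant α + 𝒢.leftInvariant α}
  zero_mem' := ⟨0, Submodule.zero_mem _, (map_zero 𝒢.defD₀).symm⟩
  add_mem' := by
    rintro _ _ ⟨α, hα, rfl⟩ ⟨β, hβ, rfl⟩
    exact ⟨α + β, Submodule.add_mem _ hα hβ, (map_add 𝒢.defD₀ α β).symm⟩
  smul_mem' := by
    rintro a _ ⟨α, hα, rfl⟩
    exact ⟨a • α, Submodule.smul_mem _ a hα, (map_smul 𝒢.defD₀ a α).symm⟩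

/-- The image of `ρ : Γ(A) → 𝔛(M)`. -/
def imAnchor : Submodule ℝ (∀ x : M, TangentSpace 𝓘(ℝ, E') x) := 𝒢.sectionsA.map 𝒢.anchor

/-- `Γ(ν) = 𝔛(M) / Im ρ`. -/
abbrev SectionsNormal : Type _ :=
  vectorFields E' M ⧸ 𝒢.imAnchor.submoduleOf (vectorFields E' M)

/-- The class in `Γ(ν)`. -/
abbrev normalClass (V : vectorFields E' M) : 𝒢.SectionsNormal := Submodule.Quotient.mk V

/-- `X ∈ 𝔛(G)` is an `(s, t)`-lift of `V`. -/
def IsLift (X : ∀ g : G, TangentSpace 𝓘(ℝ, E) g) (V : ∀ x : M, TangentSpace 𝓘(ℝ, E') x) : Prop :=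
  X ∈ vectorFields E G ∧ 𝒢.SrcProjects X V ∧ 𝒢.TgtProjects X V

/-- The vector fields on `M` that admit an `(s, t)`-lift. -/
def liftable : Submodule ℝ (vectorFields E' M) where
  carrier := {V | ∃ X, 𝒢.IsLift X V}
  zero_mem' := ⟨0, Submodule.zero_mem _, fun g => by simp, fun g => by simp⟩
  add_mem' := by
    rintro V W ⟨X, hX, h1, h2⟩ ⟨Y, hY, k1, k2⟩
    exact ⟨X + Y, Submodule.add_mem _ hX hY, fun g => by simp [h1 g, k1 g],
      fun g => by simp [h2 g, k2 g]⟩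
  smul_mem' := by
    rintro a V ⟨X, hX, h1, h2⟩
    exact ⟨a • X, Submodule.smul_mem _ a hX, fun g => by simp [h1 g], fun g => by simp [h2 g]⟩

/-- `Γ(ν)^inv`: the classes `[V]` such that `V` admits an `(s, t)`-lift. -/
def invariantNormal : Submodule ℝ 𝒢.SectionsNormal :=
  𝒢.liftable.map (Submodule.mkQ _)

/-- The class in `Γ(ν)^inv` of a vector field that admits an `(s, t)`-lift. -/
def invariantClass (V : 𝒢.liftable) : 𝒢.invariantNormal :=
  ⟨𝒢.normalClass V, Submodule.mem_map_of_mem V.2⟩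

end

end LieGroupoid

/-! The whole argument takes place in the tangent groupoid `TG ⇉ TM`, whose operations are the
tangent maps of those of `G`. Source and target are submersions, so two composable tangent vectors
are velocities of two composable curves (`exists_composable_curves`). Multiplying the curves
pointwise and differentiating carries every groupoid identity of `G` over to `TG`. In this language
`dm̄(ξ, ζ)` is `ξ ζ⁻¹`, the translations are products with zero vectors, and `ad_g ξ = 0_g ξ
0_{g⁻¹}`. Since `dm` is linear, `(ξ + ξ')(ζ + ζ') = ξζ + ξ'ζ'`. By the Eckmann-Hilton argument,
products of isotropy vectors at a unit are therefore sums, and inverses are opposites.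

For an `s`-projectable `X` over `V` one has `δX(g, h) = X(g) - X(gh) X(h)⁻¹`. Three facts about this
expression carry the proof. Its `ds` is `V(t h) - dt X(h)`, so it vanishes for all pairs exactly
when `X` is also `t`-projectable to `V`; its `dt` then vanishes too, and right translation to the
units turns `δX` into an isotropy cochain. The equation `δX = 0` says `X(gh) = X(g) X(h)`, so the
1-cocycles are the multiplicative fields. Finally `δδX = 0`, by cancelling `X(k)` in `(X(ghk)
X(k)⁻¹)(X(hk) X(k)⁻¹)⁻¹`.

Right translation identifies isotropy cochains with the fields killed by both `ds` and `dt`, and it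
commutes with the differentials, up to a sign in degree zero. A lift whose base field is `ρ(α)` is
`δα + r(w)` with `w` an isotropy 1-cochain, because `δα` lifts `ρ(α)`. This one decomposition makes
`K` well defined and gives exactness at `H¹_def`. Exactness at the normal sections is obtained by
correcting a lift by an isotropy cochain; exactness at `H²(𝒢, 𝔦)` holds because a primitive of an
isotropy cocycle is automatically a lift. -/

open scoped Topology
open Filter

/-! ## Velocities of curves -/

section Velocity

variable {EN HN N EP HP P : Type*}
  [NormedAddCommGroup EN] [NormedSpace ℝ EN] [TopologicalSpace HN] {IN : ModelWithCorners ℝ EN HN}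
  [TopologicalSpace N] [ChartedSpace HN N]
  [NormedAddCommGroup EP] [NormedSpace ℝ EP] [TopologicalSpace HP] {IP : ModelWithCorners ℝ EP HP}
  [TopologicalSpace P] [ChartedSpace HP P]

variable (IN) in
/-- The curve `γ` is differentiable at time `0`, with velocity the tangent vector `ξ`. -/
def HasVelocity (γ : ℝ → N) (ξ : TangentBundle IN N) : Prop :=
  MDifferentiableAt 𝓘(ℝ, ℝ) IN γ 0 ∧
    tangentMap 𝓘(ℝ, ℝ) IN γ (⟨0, (1 : ℝ)⟩ : TangentBundle 𝓘(ℝ, ℝ) ℝ) = ξ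

namespace HasVelocity

variable {γ γ' : ℝ → N} {ξ ξ' : TangentBundle IN N}

theorem apply_zero (h : HasVelocity IN γ ξ) : γ 0 = ξ.1 := by
  rw [← h.2]
  rfl

theorem continuousAt (h : HasVelocity IN γ ξ) : ContinuousAt γ 0 := h.1.continuousAt

theorem congr (h : HasVelocity IN γ ξ) (e : γ' =ᶠ[𝓝 0] γ) : HasVelocity IN γ' ξ := by
  refine ⟨h.1.congr_of_eventuallyEq e, ?_⟩
  rw [← h.2, tangentMap, tangentMap, e.eq_of_nhds, e.mfderiv_eq]

/-- The device for proving identities between tangent maps: exhibit both sides as velocities of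
curves that agree near time `0`. -/
theorem unique (h : HasVelocity IN γ ξ) (h' : HasVelocity IN γ' ξ') (e : γ =ᶠ[𝓝 0] γ') :
    ξ = ξ' := by
  rw [← (h'.congr e).2, ← h.2]

theorem comp {f : N → P} (h : HasVelocity IN γ ξ) (hf : MDifferentiableAt IN IP f ξ.1) :
    HasVelocity IP (fun t => f (γ t)) (tangentMap IN IP f ξ) := by
  rw [← h.apply_zero] at hf
  refine ⟨hf.comp 0 h.1, ?_⟩
  rw [← h.2]
  exact tangentMap_comp_at _ hf h.1

/-- The times at which `γ` lies in `S` form a neighbourhood of `0`, so the chain rule within that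
set is a genuine chain rule. No uniqueness of derivatives within `S` is needed: whichever derivative
`mfderivWithin` selects, its value on the velocity of a curve in `S` is forced. -/
theorem comp_within {f : N → P} {S : Set N} (h : HasVelocity IN γ ξ) (hS : ∀ᶠ t in 𝓝 0, γ t ∈ S)
    (hf : MDifferentiableWithinAt IN IP f S ξ.1) :
    HasVelocity IP (fun t => f (γ t)) (tangentMapWithin IN IP f S ξ) := by
  obtain ⟨hd, rfl⟩ := h
  have h1 : HasMFDerivWithinAt 𝓘(ℝ, ℝ) IN γ (γ ⁻¹' S) 0 (mfderiv 𝓘(ℝ, ℝ) IN γ 0) :=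
    hd.hasMFDerivAt.hasMFDerivWithinAt
  have h2 := (hf.hasMFDerivWithinAt.comp (0 : ℝ) h1 subset_rfl).hasMFDerivAt hS
  refine ⟨h2.mdifferentiableAt, ?_⟩
  show (⟨_, _⟩ : TangentBundle IP P) = ⟨_, _⟩
  have h3 : mfderiv 𝓘(ℝ, ℝ) IP (fun t => f (γ t)) 0 = _ := h2.mfderiv
  rw [h3]
  rfl

theorem prodMk {η : ℝ → P} {ζ : TangentBundle IP P} (h : HasVelocity IN γ ξ)
    (k : HasVelocity IP η ζ) :
    HasVelocity (IN.prod IP) (fun t => (γ t, η t)) ((equivTangentBundleProd IN N IP P).symm (ξ, ζ)) := by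
  obtain ⟨hd, rfl⟩ := h
  obtain ⟨kd, rfl⟩ := k
  refine ⟨hd.prodMk kd, ?_⟩
  have := mfderiv_prodMk hd kd
  show (⟨_, _⟩ : TangentBundle _ (N × P)) = ⟨_, _⟩
  rw [this]
  rfl

end HasVelocity

theorem hasVelocity_const (x : N) : HasVelocity IN (fun _ => x) (⟨x, 0⟩ : TangentBundle IN N) := by
  refine ⟨mdifferentiableAt_const, ?_⟩
  show (⟨_, _⟩ : TangentBundle IN N) = ⟨_, _⟩
  rw [mfderiv_const]
  rfl

theorem hasVelocity_iff_hasDerivAt {γ : ℝ → EN} {ξ : TangentBundle 𝓘(ℝ, EN) EN} :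
    HasVelocity 𝓘(ℝ, EN) γ ξ ↔ γ 0 = ξ.1 ∧ HasDerivAt γ ξ.2 0 := by
  constructor
  · intro h
    refine ⟨h.apply_zero, ?_⟩
    obtain ⟨h, rfl⟩ := h
    have h' := h
    rw [mdifferentiableAt_iff_differentiableAt] at h'
    have := h'.hasDerivAt
    simp only [tangentMap, mfderiv_eq_fderiv]
    exact this
  · rintro ⟨h0, h⟩
    have hd := h.differentiableAt
    refine ⟨hd.mdifferentiableAt, ?_⟩
    obtain ⟨x, v⟩ := ξ
    subst h0
    show (⟨_, _⟩ : TangentBundle 𝓘(ℝ, EN) EN) = ⟨_, _⟩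
    rw [mfderiv_eq_fderiv]
    congr 1
    exact h.deriv

end Velocity

/-! ### Submersions in charts and the lifting of curves -/

section Lift

variable {E F N M : Type*}
  [NormedAddCommGroup E] [NormedSpace ℝ E] [NormedAddCommGroup F] [NormedSpace ℝ F]
  [TopologicalSpace N] [ChartedSpace E N]
  [TopologicalSpace M] [ChartedSpace F M]

theorem Manifold.IsSubmersion.exists_charts {f : N → M}
    (hf : Manifold.IsSubmersion 𝓘(ℝ, E) 𝓘(ℝ, F) ∞ f) (x : N) :
    ∃ (φ : OpenPartialHomeomorph N E) (ψ : OpenPartialHomeomorph M F)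
      (e : E ≃L[ℝ] F × hf.complement), x ∈ φ.source ∧ f x ∈ ψ.source ∧
      φ ∈ IsManifold.maximalAtlas 𝓘(ℝ, E) ∞ N ∧ ψ ∈ IsManifold.maximalAtlas 𝓘(ℝ, F) ∞ M ∧
      (∀ z ∈ φ.source, f z ∈ ψ.source) ∧ ∀ z ∈ φ.target, ψ (f (φ.symm z)) = (e z).1 := by
  have h := hf.isSubmersionOfComplement_complement x
  refine ⟨h.domChart, h.codChart, h.equiv, h.mem_domChart_source, h.mem_codChart_source,
    h.domChart_mem_maximalAtlas, h.codChart_mem_maximalAtlas,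
    fun z hz => h.source_subset_preimage_source hz, fun z hz => ?_⟩
  have h1 := h.writtenInCharts
  rw [OpenPartialHomeomorph.extend_target] at h1
  have h2 := h1 (x := z) (by simpa using hz)
  simpa using h2

/-- A curve in the base of a submersion lifts to a curve with a prescribed velocity. -/
theorem Manifold.IsSubmersion.exists_lift {f : N → M}
    (hf : Manifold.IsSubmersion 𝓘(ℝ, E) 𝓘(ℝ, F) ∞ f) (ξ : TangentBundle 𝓘(ℝ, E) N) {η : ℝ → M}
    (hη : HasVelocity 𝓘(ℝ, F) η (tangentMap 𝓘(ℝ, E) 𝓘(ℝ, F) f ξ)) :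
    ∃ γ : ℝ → N, HasVelocity 𝓘(ℝ, E) γ ξ ∧ ∀ᶠ t in 𝓝 0, f (γ t) = η t := by
  obtain ⟨φ, ψ, e, hφx, hψx, hφa, hψa, hmaps, hw⟩ := hf.exists_charts ξ.1
  have hφd : MDifferentiableAt 𝓘(ℝ, E) 𝓘(ℝ, E) φ ξ.1 :=
    ((contMDiffOn_of_mem_maximalAtlas hφa).contMDiffAt
      (φ.open_source.mem_nhds hφx)).mdifferentiableAt (by simp)
  have hψd : MDifferentiableAt 𝓘(ℝ, F) 𝓘(ℝ, F) ψ (f ξ.1) :=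
    ((contMDiffOn_of_mem_maximalAtlas hψa).contMDiffAt
      (ψ.open_source.mem_nhds hψx)).mdifferentiableAt (by simp)
  have hφt : φ ξ.1 ∈ φ.target := φ.map_source hφx
  have hsd : MDifferentiableAt 𝓘(ℝ, E) 𝓘(ℝ, E) φ.symm (φ ξ.1) :=
    ((contMDiffOn_symm_of_mem_maximalAtlas hφa).contMDiffAt
      (φ.open_target.mem_nhds hφt)).mdifferentiableAt (by simp)
  have hfd : MDifferentiableAt 𝓘(ℝ, E) 𝓘(ℝ, F) f ξ.1 :=
    hf.contMDiff.mdifferentiableAt (by simp)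
  obtain ⟨A, hA⟩ : ∃ A : E, tangentMap 𝓘(ℝ, E) 𝓘(ℝ, E) φ ξ = ⟨φ ξ.1, A⟩ := ⟨_, rfl⟩
  obtain ⟨B, hB⟩ : ∃ B : F, tangentMap 𝓘(ℝ, F) 𝓘(ℝ, F) ψ (tangentMap 𝓘(ℝ, E) 𝓘(ℝ, F) f ξ) =
    ⟨ψ (f ξ.1), B⟩ := ⟨_, rfl⟩
  have hfst : MDifferentiableAt 𝓘(ℝ, E) 𝓘(ℝ, F) (fun z => (e z).1) (φ ξ.1) :=
    (show DifferentiableAt ℝ (fun z => (e z).1) (φ ξ.1) by fun_prop).mdifferentiableAt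
  -- Compatibility of the prescribed velocity with that of `η`, read in the charts, where `f` is the
  -- first projection.
  have hBA : B = (e A).1 := by
    have h1 : tangentMap 𝓘(ℝ, E) 𝓘(ℝ, F) (ψ ∘ f) ξ =
        tangentMap 𝓘(ℝ, E) 𝓘(ℝ, F) ((fun z => (e z).1) ∘ φ) ξ := by
      have he : (ψ ∘ f) =ᶠ[𝓝 ξ.1] ((fun z => (e z).1) ∘ φ) := by
        filter_upwards [φ.open_source.mem_nhds hφx] with z hz
        have := hw (φ z) (φ.map_source hz)
        rw [φ.left_inv hz] at this
        exact this
      rw [tangentMap, tangentMap, he.eq_of_nhds, he.mfderiv_eq]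
    rw [tangentMap_comp_at _ hψd hfd, tangentMap_comp_at _ hfst hφd, hB, hA] at h1
    rw [tangentMap, mfderiv_eq_fderiv] at h1
    have h2 : fderiv ℝ (fun z => (e z).1) (φ ξ.1) =
        (ContinuousLinearMap.fst ℝ F hf.complement).comp (e : E →L[ℝ] F × hf.complement) :=
      ((ContinuousLinearMap.fst ℝ F hf.complement).comp
        (e : E →L[ℝ] F × hf.complement)).hasFDerivAt.fderiv
    simp only [h2] at h1
    have h3 := congrArg (fun x : TangentBundle 𝓘(ℝ, F) F => (x.2 : F)) h1
    exact h3
  have hψη := hη.comp (IP := 𝓘(ℝ, F)) (f := ψ) hψd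
  rw [hB, hasVelocity_iff_hasDerivAt] at hψη
  obtain ⟨hη0, hηd⟩ := hψη
  have hfx : ψ (f ξ.1) = (e (φ ξ.1)).1 := by
    have := hw (φ ξ.1) hφt
    rwa [φ.left_inv hφx] at this
  -- In the charts the first component of the lift is forced to be `η`; the complementary component
  -- moves on a straight line in the direction of `A`.
  let c : ℝ → E := fun t => e.symm (ψ (η t), (e (φ ξ.1 + t • A)).2)
  have hc0 : c 0 = φ ξ.1 := by
    apply e.injective
    simp only [c, zero_smul, add_zero, e.apply_symm_apply]
    exact Prod.ext (hη0.trans hfx) rfl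
  have hcd : HasDerivAt c A 0 := by
    have h1 : HasDerivAt (fun t : ℝ => φ ξ.1 + t • A) A 0 := by
      simpa using ((hasDerivAt_id (0 : ℝ)).smul_const A).const_add (φ ξ.1)
    have h2 : HasDerivAt (fun t : ℝ => (e (φ ξ.1 + t • A)).2) (e A).2 0 :=
      ((ContinuousLinearMap.snd ℝ F hf.complement).comp
        (e : E →L[ℝ] F × hf.complement)).hasFDerivAt.comp_hasDerivAt 0 h1
    have h3 : HasDerivAt (fun t : ℝ => (ψ (η t), (e (φ ξ.1 + t • A)).2)) (B, (e A).2) 0 :=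
      HasDerivAt.prodMk hηd h2
    have h4 : HasDerivAt c (e.symm (B, (e A).2)) 0 :=
      (e.symm : F × hf.complement →L[ℝ] E).hasFDerivAt.comp_hasDerivAt 0 h3
    rwa [hBA, Prod.mk.eta, e.symm_apply_apply] at h4
  have hcv : HasVelocity 𝓘(ℝ, E) c (tangentMap 𝓘(ℝ, E) 𝓘(ℝ, E) φ ξ) := by
    rw [hA, hasVelocity_iff_hasDerivAt]
    exact ⟨hc0, hcd⟩
  have hct : ∀ᶠ t in 𝓝 0, c t ∈ φ.target :=
    hcd.continuousAt.eventually_mem (φ.open_target.mem_nhds (hc0 ▸ hφt))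
  have hηt : ∀ᶠ t in 𝓝 0, η t ∈ ψ.source :=
    hη.continuousAt.eventually_mem (ψ.open_source.mem_nhds (by rw [hη.apply_zero]; exact hψx))
  refine ⟨fun t => φ.symm (c t), ?_, ?_⟩
  · have h1 := hcv.comp (IP := 𝓘(ℝ, E)) (f := φ.symm) hsd
    rw [← tangentMap_comp_at _ (by exact hsd) hφd] at h1
    have he : (φ.symm ∘ φ) =ᶠ[𝓝 ξ.1] id := by
      filter_upwards [φ.open_source.mem_nhds hφx] with z hz using φ.left_inv hz
    rw [tangentMap, he.mfderiv_eq, he.eq_of_nhds, mfderiv_id] at h1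
    exact h1
  · filter_upwards [hct, hηt] with t h1 h2
    refine ψ.injOn (hmaps _ (φ.map_target h1)) h2 ?_
    rw [hw _ h1]
    simp [c]

/-- Every tangent vector is the velocity of a curve. -/
theorem exists_hasVelocity [IsManifold 𝓘(ℝ, E) ∞ N] (ξ : TangentBundle 𝓘(ℝ, E) N) :
    ∃ γ : ℝ → N, HasVelocity 𝓘(ℝ, E) γ ξ := by
  set φ := chartAt E ξ.1
  have hφx : ξ.1 ∈ φ.source := mem_chart_source E ξ.1
  have hφa : φ ∈ IsManifold.maximalAtlas 𝓘(ℝ, E) ∞ N := IsManifold.chart_mem_maximalAtlas ξ.1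
  have hφd : MDifferentiableAt 𝓘(ℝ, E) 𝓘(ℝ, E) φ ξ.1 :=
    ((contMDiffOn_of_mem_maximalAtlas hφa).contMDiffAt
      (φ.open_source.mem_nhds hφx)).mdifferentiableAt (by simp)
  have hsd : MDifferentiableAt 𝓘(ℝ, E) 𝓘(ℝ, E) φ.symm (φ ξ.1) :=
    ((contMDiffOn_symm_of_mem_maximalAtlas hφa).contMDiffAt
      (φ.open_target.mem_nhds (φ.map_source hφx))).mdifferentiableAt (by simp)
  obtain ⟨A, hA⟩ : ∃ A : E, tangentMap 𝓘(ℝ, E) 𝓘(ℝ, E) φ ξ = ⟨φ ξ.1, A⟩ := ⟨_, rfl⟩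
  have h1 : HasVelocity 𝓘(ℝ, E) (fun t : ℝ => φ ξ.1 + t • A) (tangentMap 𝓘(ℝ, E) 𝓘(ℝ, E) φ ξ) := by
    rw [hA, hasVelocity_iff_hasDerivAt]
    exact ⟨by simp, by simpa using ((hasDerivAt_id (0 : ℝ)).smul_const A).const_add (φ ξ.1)⟩
  have h2 := h1.comp (IP := 𝓘(ℝ, E)) (f := φ.symm) hsd
  rw [← tangentMap_comp_at _ (by exact hsd) hφd] at h2
  have he : (φ.symm ∘ φ) =ᶠ[𝓝 ξ.1] id := by
    filter_upwards [φ.open_source.mem_nhds hφx] with z hz using φ.left_inv hz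
  rw [tangentMap, he.mfderiv_eq, he.eq_of_nhds, mfderiv_id] at h2
  exact ⟨_, h2⟩

end Lift

/-! ## Fibrewise operations on a tangent bundle -/

section Fibrewise

variable {E N : Type*} [NormedAddCommGroup E] [NormedSpace ℝ E]
  [TopologicalSpace N] [ChartedSpace E N]

/-- Casts between tangent spaces at equal points disappear in the total space; identities are
therefore proved for elements of `TangentBundle` and brought back to the fibres by `mk_inj`. -/
theorem mk_tangentCast {x y : N} (h : x = y) (v : TangentSpace 𝓘(ℝ, E) x) :
    (⟨y, tangentCast h v⟩ : TangentBundle 𝓘(ℝ, E) N) = ⟨x, v⟩ := by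
  subst h
  rfl

/-- The sum of two tangent vectors at the same point (with the base point of the first one). -/
noncomputable def fibreAdd (ξ ζ : TangentBundle 𝓘(ℝ, E) N) : TangentBundle 𝓘(ℝ, E) N :=
  -- All tangent spaces are definitionally the model space, so no proof of equal base points is
  -- required here; the sum is meaningful only when they agree.
  ⟨ξ.1, (ξ.2 + (show TangentSpace 𝓘(ℝ, E) ξ.1 from (show E from ζ.2)))⟩

/-- The opposite of a tangent vector. -/
noncomputable def fibreNeg (ξ : TangentBundle 𝓘(ℝ, E) N) : TangentBundle 𝓘(ℝ, E) N := ⟨ξ.1, -ξ.2⟩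

/-- The zero vector at a point. -/
noncomputable def fibreZero (x : N) : TangentBundle 𝓘(ℝ, E) N := ⟨x, 0⟩

theorem mk_add {x : N} (v w : TangentSpace 𝓘(ℝ, E) x) :
    (⟨x, v + w⟩ : TangentBundle 𝓘(ℝ, E) N) = fibreAdd ⟨x, v⟩ ⟨x, w⟩ := rfl

theorem mk_neg {x : N} (v : TangentSpace 𝓘(ℝ, E) x) :
    (⟨x, -v⟩ : TangentBundle 𝓘(ℝ, E) N) = fibreNeg ⟨x, v⟩ := rfl

theorem mk_sub {x : N} (v w : TangentSpace 𝓘(ℝ, E) x) :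
    (⟨x, v - w⟩ : TangentBundle 𝓘(ℝ, E) N) = fibreAdd ⟨x, v⟩ (fibreNeg ⟨x, w⟩) := by
  rw [← mk_neg, ← mk_add, sub_eq_add_neg]

theorem mk_zero (x : N) : (⟨x, 0⟩ : TangentBundle 𝓘(ℝ, E) N) = fibreZero x := rfl

theorem mk_inj {x : N} {v w : TangentSpace 𝓘(ℝ, E) x} :
    (⟨x, v⟩ : TangentBundle 𝓘(ℝ, E) N) = ⟨x, w⟩ ↔ v = w :=
  Bundle.TotalSpace.mk_inj

@[simp] theorem fibreAdd_proj (ξ ζ : TangentBundle 𝓘(ℝ, E) N) : (fibreAdd ξ ζ).1 = ξ.1 := rfl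
@[simp] theorem fibreNeg_proj (ξ : TangentBundle 𝓘(ℝ, E) N) : (fibreNeg ξ).1 = ξ.1 := rfl
@[simp] theorem fibreZero_proj (x : N) : (fibreZero x : TangentBundle 𝓘(ℝ, E) N).1 = x := rfl

theorem fibreAdd_zero {ξ : TangentBundle 𝓘(ℝ, E) N} (x : N) :
    fibreAdd ξ (fibreZero x) = ξ := by
  obtain ⟨y, v⟩ := ξ
  exact mk_inj.2 (add_zero v)

theorem zero_fibreAdd {x : N} {ξ : TangentBundle 𝓘(ℝ, E) N} (h : ξ.1 = x) :
    fibreAdd (fibreZero x) ξ = ξ := by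
  obtain ⟨y, v⟩ := ξ
  subst h
  exact mk_inj.2 (zero_add v)

theorem fibreAdd_neg (ξ : TangentBundle 𝓘(ℝ, E) N) :
    fibreAdd ξ (fibreNeg ξ) = fibreZero ξ.1 := by
  obtain ⟨y, v⟩ := ξ
  exact mk_inj.2 (add_neg_cancel v)

theorem fibreNeg_zero (x : N) :
    fibreNeg (fibreZero x) = (fibreZero x : TangentBundle 𝓘(ℝ, E) N) :=
  mk_inj.2 neg_zero

variable {F M : Type*} [NormedAddCommGroup F] [NormedSpace ℝ F]
  [TopologicalSpace M] [ChartedSpace F M] (f : N → M)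

theorem tangentMap_fibreAdd {ξ ζ : TangentBundle 𝓘(ℝ, E) N} (h : ξ.1 = ζ.1) :
    tangentMap 𝓘(ℝ, E) 𝓘(ℝ, F) f (fibreAdd ξ ζ) =
      fibreAdd (tangentMap 𝓘(ℝ, E) 𝓘(ℝ, F) f ξ) (tangentMap 𝓘(ℝ, E) 𝓘(ℝ, F) f ζ) := by
  obtain ⟨x, v⟩ := ξ
  obtain ⟨y, w⟩ := ζ
  subst h
  exact mk_inj.2 (map_add (mfderiv 𝓘(ℝ, E) 𝓘(ℝ, F) f x) v w)

theorem tangentMap_fibreNeg (ξ : TangentBundle 𝓘(ℝ, E) N) :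
    tangentMap 𝓘(ℝ, E) 𝓘(ℝ, F) f (fibreNeg ξ) =
      fibreNeg (tangentMap 𝓘(ℝ, E) 𝓘(ℝ, F) f ξ) :=
  mk_inj.2 (map_neg (mfderiv 𝓘(ℝ, E) 𝓘(ℝ, F) f ξ.1) ξ.2)

theorem tangentMap_fibreZero (x : N) :
    tangentMap 𝓘(ℝ, E) 𝓘(ℝ, F) f (fibreZero x) = fibreZero (f x) :=
  mk_inj.2 (map_zero (mfderiv 𝓘(ℝ, E) 𝓘(ℝ, F) f x))

end Fibrewise

theorem SmoothOnSubset.mdifferentiableWithinAt {EP : Type*} [NormedAddCommGroup EP]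
    [NormedSpace ℝ EP] {HP : Type*} [TopologicalSpace HP] {IP : ModelWithCorners ℝ EP HP}
    {P : Type*} [TopologicalSpace P] [ChartedSpace HP P]
    {EN : Type*} [NormedAddCommGroup EN] [NormedSpace ℝ EN]
    {HN : Type*} [TopologicalSpace HN] {IN : ModelWithCorners ℝ EN HN}
    {N : Type*} [TopologicalSpace N] [ChartedSpace HN N]
    {f : P → N} {S : Set P} (h : SmoothOnSubset IP IN f S) {p : P} (hp : p ∈ S) :
    MDifferentiableWithinAt IP IN f S p := by
  obtain ⟨U, hU, hpU, F, hF, hFf⟩ := h p hp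
  have h1 : MDifferentiableWithinAt IP IN F S p :=
    (((hF p hpU).contMDiffAt (hU.mem_nhds hpU)).mdifferentiableAt (by simp)).mdifferentiableWithinAt
  refine h1.congr_of_eventuallyEq ?_ (hFf p hpU hp).symm
  filter_upwards [mem_nhdsWithin_of_mem_nhds (hU.mem_nhds hpU), self_mem_nhdsWithin] with q h2 h3
  exact (hFf q h2 h3).symm

namespace LieGroupoid

noncomputable section

variable {E E' G M : Type*}
  [NormedAddCommGroup E] [NormedSpace ℝ E] [NormedAddCommGroup E'] [NormedSpace ℝ E']
  [TopologicalSpace G] [ChartedSpace E G] [IsManifold 𝓘(ℝ, E) ∞ G]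
  [TopologicalSpace M] [ChartedSpace E' M] [IsManifold 𝓘(ℝ, E') ∞ M]
  (𝒢 : LieGroupoid E E' G M)

/-! ## The groupoid -/

theorem inv_eq_of_mul_eq_one {g h : G} (H : 𝒢.src g = 𝒢.tgt h)
    (e : 𝒢.mul g h = 𝒢.one (𝒢.tgt g)) : 𝒢.inv g = h := by
  have h1 := 𝒢.mul_assoc (𝒢.inv g) g h (𝒢.src_inv g) H
  rw [e, 𝒢.inv_mul, H, 𝒢.one_mul, ← 𝒢.src_inv, 𝒢.mul_one] at h1
  exact h1.symm

theorem inv_one (x : M) : 𝒢.inv (𝒢.one x) = 𝒢.one x := by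
  have h := 𝒢.mul_one (𝒢.one x)
  rw [𝒢.src_one] at h
  refine 𝒢.inv_eq_of_mul_eq_one (by rw [𝒢.src_one, 𝒢.tgt_one]) ?_
  rw [h, 𝒢.tgt_one]

theorem inv_inv (g : G) : 𝒢.inv (𝒢.inv g) = g :=
  𝒢.inv_eq_of_mul_eq_one (𝒢.src_inv g) (by rw [𝒢.inv_mul, 𝒢.tgt_inv])

theorem inv_mul_rev {g h : G} (H : 𝒢.src g = 𝒢.tgt h) :
    𝒢.inv (𝒢.mul g h) = 𝒢.mul (𝒢.inv h) (𝒢.inv g) := by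
  have h1 : 𝒢.src (𝒢.inv h) = 𝒢.tgt (𝒢.inv g) := by rw [𝒢.src_inv, 𝒢.tgt_inv, H]
  refine 𝒢.inv_eq_of_mul_eq_one ?_ ?_
  · rw [𝒢.src_mul _ _ H, 𝒢.tgt_mul _ _ h1, 𝒢.tgt_inv]
  · rw [𝒢.mul_assoc g h _ H (by rw [𝒢.tgt_mul _ _ h1, 𝒢.tgt_inv]),
      ← 𝒢.mul_assoc h _ _ (𝒢.tgt_inv h).symm h1, 𝒢.mul_inv, ← H, ← 𝒢.tgt_inv g, 𝒢.one_mul,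
      𝒢.mul_inv, 𝒢.tgt_mul _ _ H]

/-! ## The tangent groupoid -/

/-- The tangent map of the source. -/
def tsrc : TangentBundle 𝓘(ℝ, E) G → TangentBundle 𝓘(ℝ, E') M :=
  tangentMap 𝓘(ℝ, E) 𝓘(ℝ, E') 𝒢.src

/-- The tangent map of the target. -/
def ttgt : TangentBundle 𝓘(ℝ, E) G → TangentBundle 𝓘(ℝ, E') M :=
  tangentMap 𝓘(ℝ, E) 𝓘(ℝ, E') 𝒢.tgt

/-- The tangent map of the unit. -/
def tone : TangentBundle 𝓘(ℝ, E') M → TangentBundle 𝓘(ℝ, E) G :=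
  tangentMap 𝓘(ℝ, E') 𝓘(ℝ, E) 𝒢.one

/-- The tangent map of the inversion. -/
def tinv : TangentBundle 𝓘(ℝ, E) G → TangentBundle 𝓘(ℝ, E) G :=
  tangentMap 𝓘(ℝ, E) 𝓘(ℝ, E) 𝒢.inv

/-- The tangent map of the multiplication. -/
def tmul (ξ ζ : TangentBundle 𝓘(ℝ, E) G) : TangentBundle 𝓘(ℝ, E) G :=
  ⟨𝒢.mul ξ.1 ζ.1, 𝒢.dmul ξ.1 ζ.1 (ξ.2, ζ.2)⟩

variable {𝒢}

@[simp] theorem tsrc_proj (ξ : TangentBundle 𝓘(ℝ, E) G) : (𝒢.tsrc ξ).1 = 𝒢.src ξ.1 := rfl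
@[simp] theorem ttgt_proj (ξ : TangentBundle 𝓘(ℝ, E) G) : (𝒢.ttgt ξ).1 = 𝒢.tgt ξ.1 := rfl
@[simp] theorem tone_proj (ξ : TangentBundle 𝓘(ℝ, E') M) : (𝒢.tone ξ).1 = 𝒢.one ξ.1 := rfl
@[simp] theorem tinv_proj (ξ : TangentBundle 𝓘(ℝ, E) G) : (𝒢.tinv ξ).1 = 𝒢.inv ξ.1 := rfl
@[simp] theorem tmul_proj (ξ ζ : TangentBundle 𝓘(ℝ, E) G) :
    (𝒢.tmul ξ ζ).1 = 𝒢.mul ξ.1 ζ.1 := rfl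

theorem mdifferentiableAt_src (g : G) : MDifferentiableAt 𝓘(ℝ, E) 𝓘(ℝ, E') 𝒢.src g :=
  𝒢.submersion_src.contMDiff.mdifferentiableAt (by simp)

theorem mdifferentiableAt_tgt (g : G) : MDifferentiableAt 𝓘(ℝ, E) 𝓘(ℝ, E') 𝒢.tgt g :=
  𝒢.submersion_tgt.contMDiff.mdifferentiableAt (by simp)

theorem mdifferentiableAt_one (x : M) : MDifferentiableAt 𝓘(ℝ, E') 𝓘(ℝ, E) 𝒢.one x :=
  𝒢.smooth_one.mdifferentiableAt (by simp)

theorem mdifferentiableAt_inv (g : G) : MDifferentiableAt 𝓘(ℝ, E) 𝓘(ℝ, E) 𝒢.inv g :=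
  𝒢.smooth_inv.mdifferentiableAt (by simp)

end

end LieGroupoid

/-! ### Velocities of curves of arrows -/

namespace HasVelocity

open LieGroupoid

variable {E E' G M : Type*}
  [NormedAddCommGroup E] [NormedSpace ℝ E] [NormedAddCommGroup E'] [NormedSpace ℝ E']
  [TopologicalSpace G] [ChartedSpace E G] [IsManifold 𝓘(ℝ, E) ∞ G]
  [TopologicalSpace M] [ChartedSpace E' M] [IsManifold 𝓘(ℝ, E') ∞ M]
  {𝒢 : LieGroupoid E E' G M} {γ η : ℝ → G} {ξ ζ : TangentBundle 𝓘(ℝ, E) G}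

theorem src (h : HasVelocity 𝓘(ℝ, E) γ ξ) :
    HasVelocity 𝓘(ℝ, E') (fun t => 𝒢.src (γ t)) (𝒢.tsrc ξ) :=
  h.comp (mdifferentiableAt_src _)

theorem tgt (h : HasVelocity 𝓘(ℝ, E) γ ξ) :
    HasVelocity 𝓘(ℝ, E') (fun t => 𝒢.tgt (γ t)) (𝒢.ttgt ξ) :=
  h.comp (mdifferentiableAt_tgt _)

theorem one {γ : ℝ → M} {ξ : TangentBundle 𝓘(ℝ, E') M} (h : HasVelocity 𝓘(ℝ, E') γ ξ) :
    HasVelocity 𝓘(ℝ, E) (fun t => 𝒢.one (γ t)) (𝒢.tone ξ) :=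
  h.comp (mdifferentiableAt_one _)

theorem inv (h : HasVelocity 𝓘(ℝ, E) γ ξ) :
    HasVelocity 𝓘(ℝ, E) (fun t => 𝒢.inv (γ t)) (𝒢.tinv ξ) :=
  h.comp (mdifferentiableAt_inv _)

theorem mul (h : HasVelocity 𝓘(ℝ, E) γ ξ) (k : HasVelocity 𝓘(ℝ, E) η ζ)
    (e : ∀ᶠ t in 𝓝 0, 𝒢.src (γ t) = 𝒢.tgt (η t)) :
    HasVelocity 𝓘(ℝ, E) (fun t => 𝒢.mul (γ t) (η t)) (𝒢.tmul ξ ζ) := by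
  have hc : (ξ.1, ζ.1) ∈ {p : G × G | 𝒢.src p.1 = 𝒢.tgt p.2} := by
    rw [← h.apply_zero, ← k.apply_zero]
    exact e.self_of_nhds
  exact (h.prodMk k).comp_within (f := fun p : G × G => 𝒢.mul p.1 p.2) e
    (𝒢.smooth_mul.mdifferentiableWithinAt hc)

end HasVelocity

/-! ### The groupoid identities for the tangent maps -/

namespace LieGroupoid

variable {E E' G M : Type*}
  [NormedAddCommGroup E] [NormedSpace ℝ E] [NormedAddCommGroup E'] [NormedSpace ℝ E']
  [TopologicalSpace G] [ChartedSpace E G] [IsManifold 𝓘(ℝ, E) ∞ G]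
  [TopologicalSpace M] [ChartedSpace E' M] [IsManifold 𝓘(ℝ, E') ∞ M]
  {𝒢 : LieGroupoid E E' G M} {ξ ζ χ : TangentBundle 𝓘(ℝ, E) G}

theorem exists_lift_src (h : 𝒢.tsrc ξ = 𝒢.ttgt ζ) {η : ℝ → G} (hη : HasVelocity 𝓘(ℝ, E) η ζ) :
    ∃ γ : ℝ → G, HasVelocity 𝓘(ℝ, E) γ ξ ∧ ∀ᶠ t in 𝓝 0, 𝒢.src (γ t) = 𝒢.tgt (η t) :=
  𝒢.submersion_src.exists_lift ξ (by
    have := hη.tgt (𝒢 := 𝒢)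
    rwa [← h] at this)

theorem exists_lift_tgt (h : 𝒢.tsrc ξ = 𝒢.ttgt ζ) {γ : ℝ → G} (hγ : HasVelocity 𝓘(ℝ, E) γ ξ) :
    ∃ η : ℝ → G, HasVelocity 𝓘(ℝ, E) η ζ ∧ ∀ᶠ t in 𝓝 0, 𝒢.src (γ t) = 𝒢.tgt (η t) := by
  obtain ⟨η, h1, h2⟩ := 𝒢.submersion_tgt.exists_lift ζ (η := fun t => 𝒢.src (γ t)) (by
    have := hγ.src (𝒢 := 𝒢)
    rwa [h] at this)
  exact ⟨η, h1, h2.mono fun t ht => ht.symm⟩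

/-- The source is a submersion, so any curve for `ζ` can be followed by one for `ξ`. Each identity
below is the derivative at `0` of the same identity along such curves. -/
theorem exists_composable_curves (h : 𝒢.tsrc ξ = 𝒢.ttgt ζ) :
    ∃ γ η : ℝ → G, HasVelocity 𝓘(ℝ, E) γ ξ ∧ HasVelocity 𝓘(ℝ, E) η ζ ∧
      ∀ᶠ t in 𝓝 0, 𝒢.src (γ t) = 𝒢.tgt (η t) := by
  obtain ⟨η, hη⟩ := exists_hasVelocity ζ
  obtain ⟨γ, hγ, e⟩ := exists_lift_src h hη
  exact ⟨γ, η, hγ, hη, e⟩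

theorem tsrc_tmul (h : 𝒢.tsrc ξ = 𝒢.ttgt ζ) : 𝒢.tsrc (𝒢.tmul ξ ζ) = 𝒢.tsrc ζ := by
  obtain ⟨γ, η, hγ, hη, e⟩ := exists_composable_curves h
  exact (hγ.mul hη e).src.unique hη.src (e.mono fun t ht => 𝒢.src_mul _ _ ht)

theorem ttgt_tmul (h : 𝒢.tsrc ξ = 𝒢.ttgt ζ) : 𝒢.ttgt (𝒢.tmul ξ ζ) = 𝒢.ttgt ξ := by
  obtain ⟨γ, η, hγ, hη, e⟩ := exists_composable_curves h
  exact (hγ.mul hη e).tgt.unique hγ.tgt (e.mono fun t ht => 𝒢.tgt_mul _ _ ht)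

theorem tsrc_tinv (ξ : TangentBundle 𝓘(ℝ, E) G) : 𝒢.tsrc (𝒢.tinv ξ) = 𝒢.ttgt ξ := by
  obtain ⟨γ, hγ⟩ := exists_hasVelocity ξ
  exact hγ.inv.src.unique hγ.tgt (Eventually.of_forall fun t => 𝒢.src_inv _)

theorem ttgt_tinv (ξ : TangentBundle 𝓘(ℝ, E) G) : 𝒢.ttgt (𝒢.tinv ξ) = 𝒢.tsrc ξ := by
  obtain ⟨γ, hγ⟩ := exists_hasVelocity ξ
  exact hγ.inv.tgt.unique hγ.src (Eventually.of_forall fun t => 𝒢.tgt_inv _)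

theorem tmul_assoc (h : 𝒢.tsrc ξ = 𝒢.ttgt ζ) (k : 𝒢.tsrc ζ = 𝒢.ttgt χ) :
    𝒢.tmul (𝒢.tmul ξ ζ) χ = 𝒢.tmul ξ (𝒢.tmul ζ χ) := by
  obtain ⟨γ, η, hγ, hη, e⟩ := exists_composable_curves h
  -- The third curve is adapted to the `η` already chosen, which requires the target to be a
  -- submersion as well.
  obtain ⟨σ, hσ, e'⟩ := exists_lift_tgt k hη
  refine ((hγ.mul hη e).mul hσ ?_).unique (hγ.mul (hη.mul hσ e') ?_) ?_
  · filter_upwards [e, e'] with t h1 h2 using 𝒢.mul_composable h1 h2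
  · filter_upwards [e, e'] with t h1 h2 using 𝒢.composable_mul h1 h2
  · filter_upwards [e, e'] with t h1 h2 using 𝒢.mul_assoc _ _ _ h1 h2

theorem tone_tmul (ξ : TangentBundle 𝓘(ℝ, E) G) : 𝒢.tmul (𝒢.tone (𝒢.ttgt ξ)) ξ = ξ := by
  obtain ⟨γ, hγ⟩ := exists_hasVelocity ξ
  exact (hγ.tgt.one.mul hγ (Eventually.of_forall fun t => 𝒢.src_one _)).unique hγ
    (Eventually.of_forall fun t => 𝒢.one_mul _)

theorem tmul_tone (ξ : TangentBundle 𝓘(ℝ, E) G) : 𝒢.tmul ξ (𝒢.tone (𝒢.tsrc ξ)) = ξ := by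
  obtain ⟨γ, hγ⟩ := exists_hasVelocity ξ
  exact (hγ.mul hγ.src.one (Eventually.of_forall fun t => (𝒢.tgt_one _).symm)).unique hγ
    (Eventually.of_forall fun t => 𝒢.mul_one _)

theorem tmul_tinv (ξ : TangentBundle 𝓘(ℝ, E) G) :
    𝒢.tmul ξ (𝒢.tinv ξ) = 𝒢.tone (𝒢.ttgt ξ) := by
  obtain ⟨γ, hγ⟩ := exists_hasVelocity ξ
  exact (hγ.mul hγ.inv (Eventually.of_forall fun t => (𝒢.tgt_inv _).symm)).unique hγ.tgt.one
    (Eventually.of_forall fun t => 𝒢.mul_inv _)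

theorem tinv_tmul (ξ : TangentBundle 𝓘(ℝ, E) G) :
    𝒢.tmul (𝒢.tinv ξ) ξ = 𝒢.tone (𝒢.tsrc ξ) := by
  obtain ⟨γ, hγ⟩ := exists_hasVelocity ξ
  exact (hγ.inv.mul hγ (Eventually.of_forall fun t => 𝒢.src_inv _)).unique hγ.src.one
    (Eventually.of_forall fun t => 𝒢.inv_mul _)

theorem tinv_tinv (ξ : TangentBundle 𝓘(ℝ, E) G) : 𝒢.tinv (𝒢.tinv ξ) = ξ := by
  obtain ⟨γ, hγ⟩ := exists_hasVelocity ξ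
  exact hγ.inv.inv.unique hγ (Eventually.of_forall fun t => 𝒢.inv_inv _)

theorem tinv_tmul_rev (h : 𝒢.tsrc ξ = 𝒢.ttgt ζ) :
    𝒢.tinv (𝒢.tmul ξ ζ) = 𝒢.tmul (𝒢.tinv ζ) (𝒢.tinv ξ) := by
  obtain ⟨γ, η, hγ, hη, e⟩ := exists_composable_curves h
  refine (hγ.mul hη e).inv.unique (hη.inv.mul hγ.inv ?_) ?_
  · filter_upwards [e] with t ht
    rw [𝒢.src_inv, 𝒢.tgt_inv, ht]
  · filter_upwards [e] with t ht using 𝒢.inv_mul_rev ht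

/-! ### The differentials of the division map and of the translations -/

/-- Differentiation of `p q⁻¹` along curves with a common source. The curve `η` represents the
inverse of the second vector, so its inverse represents the vector itself. -/
theorem mk_ddiv {p q : G} {v : TangentSpace 𝓘(ℝ, E) p} {w : TangentSpace 𝓘(ℝ, E) q}
    (h : 𝒢.tsrc ⟨p, v⟩ = 𝒢.tsrc ⟨q, w⟩) :
    (⟨𝒢.div p q, 𝒢.ddiv p q (v, w)⟩ : TangentBundle 𝓘(ℝ, E) G) =
      𝒢.tmul ⟨p, v⟩ (𝒢.tinv ⟨q, w⟩) := by
  have h' : 𝒢.tsrc ⟨p, v⟩ = 𝒢.ttgt (𝒢.tinv ⟨q, w⟩) := by rw [ttgt_tinv, h]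
  obtain ⟨γ, η, hγ, hη, e⟩ := exists_composable_curves h'
  have hi := hη.inv (𝒢 := 𝒢)
  rw [tinv_tinv] at hi
  have hs : SmoothOnSubset (𝓘(ℝ, E).prod 𝓘(ℝ, E)) 𝓘(ℝ, E) (fun z : G × G => 𝒢.div z.1 z.2)
      {z : G × G | 𝒢.src z.1 = 𝒢.src z.2} := by
    intro z hz
    obtain ⟨U, hU, hzU, F, hF, hFe⟩ := 𝒢.smooth_mul (z.1, 𝒢.inv z.2) (Eq.trans hz (𝒢.tgt_inv _).symm)
    have hsm : ContMDiff (𝓘(ℝ, E).prod 𝓘(ℝ, E)) (𝓘(ℝ, E).prod 𝓘(ℝ, E)) ∞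
        (fun z : G × G => (z.1, 𝒢.inv z.2)) :=
      contMDiff_fst.prodMk (𝒢.smooth_inv.comp contMDiff_snd)
    refine ⟨(fun z : G × G => (z.1, 𝒢.inv z.2)) ⁻¹' U, hU.preimage hsm.continuous, hzU,
      fun z => F (z.1, 𝒢.inv z.2), hF.comp hsm.contMDiffOn subset_rfl, fun q hq hq' => ?_⟩
    exact hFe _ hq (Eq.trans hq' (𝒢.tgt_inv _).symm)
  refine ((hγ.prodMk hi).comp_within (f := fun z : G × G => 𝒢.div z.1 z.2)
    (S := {z : G × G | 𝒢.src z.1 = 𝒢.src z.2}) ?_ (hs.mdifferentiableWithinAt ?_)).unique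
    (hγ.mul hη e) ?_
  · filter_upwards [e] with t ht
    exact ht.trans (𝒢.src_inv _).symm
  · exact congrArg Bundle.TotalSpace.proj h
  · filter_upwards [e] with t ht
    rw [div, 𝒢.inv_inv]

/-- Right translation by `g` is multiplication by the constant curve `g`, whose velocity is the zero
vector. -/
theorem mk_rightTr {b g : G} {v : TangentSpace 𝓘(ℝ, E) b} (h : 𝒢.tsrc ⟨b, v⟩ = fibreZero (𝒢.tgt g)) :
    (⟨𝒢.mul b g, 𝒢.rightTr g b v⟩ : TangentBundle 𝓘(ℝ, E) G) = 𝒢.tmul ⟨b, v⟩ (fibreZero g) := by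
  have hη : HasVelocity 𝓘(ℝ, E) (fun _ : ℝ => g) (fibreZero g) := hasVelocity_const g
  obtain ⟨γ, hγ, e⟩ := exists_lift_src (ζ := fibreZero g)
    (h.trans (tangentMap_fibreZero 𝒢.tgt g).symm) hη
  have hsm : SmoothOnSubset 𝓘(ℝ, E) 𝓘(ℝ, E) (fun z => 𝒢.mul z g) {z | 𝒢.src z = 𝒢.tgt g} := by
    intro z hz
    obtain ⟨U, hU, hzU, F, hF, hFe⟩ := 𝒢.smooth_mul (z, g) hz
    have hs : ContMDiff 𝓘(ℝ, E) (𝓘(ℝ, E).prod 𝓘(ℝ, E)) ∞ (fun z : G => (z, g)) :=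
      contMDiff_id.prodMk contMDiff_const
    exact ⟨(fun z : G => (z, g)) ⁻¹' U, hU.preimage hs.continuous, hzU,
      fun z => F (z, g), hF.comp hs.contMDiffOn subset_rfl, fun q hq hq' => hFe _ hq hq'⟩
  exact (hγ.comp_within (f := fun z => 𝒢.mul z g) e (hsm.mdifferentiableWithinAt
    (congrArg Bundle.TotalSpace.proj h))).unique (hγ.mul hη e) EventuallyEq.rfl

theorem mk_leftTr {g a : G} {v : TangentSpace 𝓘(ℝ, E) a} (h : 𝒢.ttgt ⟨a, v⟩ = fibreZero (𝒢.src g)) :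
    (⟨𝒢.mul g a, 𝒢.leftTr g a v⟩ : TangentBundle 𝓘(ℝ, E) G) = 𝒢.tmul (fibreZero g) ⟨a, v⟩ := by
  have hη : HasVelocity 𝓘(ℝ, E) (fun _ : ℝ => g) (fibreZero g) := hasVelocity_const g
  obtain ⟨γ, hγ, e⟩ := exists_lift_tgt (ξ := fibreZero g)
    ((tangentMap_fibreZero 𝒢.src g).trans h.symm) hη
  have hsm : SmoothOnSubset 𝓘(ℝ, E) 𝓘(ℝ, E) (fun z => 𝒢.mul g z) {z | 𝒢.tgt z = 𝒢.src g} := by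
    intro z hz
    obtain ⟨U, hU, hzU, F, hF, hFe⟩ := 𝒢.smooth_mul (g, z) (Eq.symm hz)
    have hs : ContMDiff 𝓘(ℝ, E) (𝓘(ℝ, E).prod 𝓘(ℝ, E)) ∞ (fun z : G => (g, z)) :=
      contMDiff_const.prodMk contMDiff_id
    exact ⟨(fun z : G => (g, z)) ⁻¹' U, hU.preimage hs.continuous, hzU,
      fun z => F (g, z), hF.comp hs.contMDiffOn subset_rfl,
      fun q hq hq' => hFe _ hq (Eq.symm hq')⟩
  exact (hγ.comp_within (f := fun z => 𝒢.mul g z) (e.mono fun t ht => ht.symm)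
    (hsm.mdifferentiableWithinAt (congrArg Bundle.TotalSpace.proj h))).unique (hη.mul hγ e)
    EventuallyEq.rfl

/-! ### Linearity of the tangent operations -/

/-- The interchange law between groupoid product and fibrewise sum; it is just additivity of `dmul g
a`, and all linear algebra in the tangent groupoid rests on it. -/
theorem tmul_fibreAdd {ξ' ζ' : TangentBundle 𝓘(ℝ, E) G} (h : ξ.1 = ξ'.1) (k : ζ.1 = ζ'.1) :
    𝒢.tmul (fibreAdd ξ ξ') (fibreAdd ζ ζ') = fibreAdd (𝒢.tmul ξ ζ) (𝒢.tmul ξ' ζ') := by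
  obtain ⟨g, v⟩ := ξ
  obtain ⟨g', v'⟩ := ξ'
  obtain ⟨a, w⟩ := ζ
  obtain ⟨a', w'⟩ := ζ'
  subst h k
  exact mk_inj.2 (map_add (𝒢.dmul g a) (v, w) (v', w'))

theorem tmul_fibreNeg (ξ ζ : TangentBundle 𝓘(ℝ, E) G) :
    𝒢.tmul (fibreNeg ξ) (fibreNeg ζ) = fibreNeg (𝒢.tmul ξ ζ) :=
  mk_inj.2 (map_neg (𝒢.dmul ξ.1 ζ.1) (ξ.2, ζ.2))

theorem tmul_fibreZero (g h : G) :
    𝒢.tmul (fibreZero g) (fibreZero h) = fibreZero (𝒢.mul g h) :=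
  mk_inj.2 (map_zero (𝒢.dmul g h))

theorem tsrc_fibreAdd (h : ξ.1 = ζ.1) :
    𝒢.tsrc (fibreAdd ξ ζ) = fibreAdd (𝒢.tsrc ξ) (𝒢.tsrc ζ) := tangentMap_fibreAdd _ h

theorem ttgt_fibreAdd (h : ξ.1 = ζ.1) :
    𝒢.ttgt (fibreAdd ξ ζ) = fibreAdd (𝒢.ttgt ξ) (𝒢.ttgt ζ) := tangentMap_fibreAdd _ h

theorem tinv_fibreAdd (h : ξ.1 = ζ.1) :
    𝒢.tinv (fibreAdd ξ ζ) = fibreAdd (𝒢.tinv ξ) (𝒢.tinv ζ) := tangentMap_fibreAdd _ h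

theorem tsrc_fibreNeg (ξ : TangentBundle 𝓘(ℝ, E) G) :
    𝒢.tsrc (fibreNeg ξ) = fibreNeg (𝒢.tsrc ξ) := tangentMap_fibreNeg _ _

theorem ttgt_fibreNeg (ξ : TangentBundle 𝓘(ℝ, E) G) :
    𝒢.ttgt (fibreNeg ξ) = fibreNeg (𝒢.ttgt ξ) := tangentMap_fibreNeg _ _

theorem tinv_fibreNeg (ξ : TangentBundle 𝓘(ℝ, E) G) :
    𝒢.tinv (fibreNeg ξ) = fibreNeg (𝒢.tinv ξ) := tangentMap_fibreNeg _ _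

@[simp] theorem tsrc_fibreZero (g : G) : 𝒢.tsrc (fibreZero g) = fibreZero (𝒢.src g) :=
  tangentMap_fibreZero _ _

@[simp] theorem ttgt_fibreZero (g : G) : 𝒢.ttgt (fibreZero g) = fibreZero (𝒢.tgt g) :=
  tangentMap_fibreZero _ _

@[simp] theorem tinv_fibreZero (g : G) : 𝒢.tinv (fibreZero g) = fibreZero (𝒢.inv g) :=
  tangentMap_fibreZero _ _

@[simp] theorem tone_fibreZero (x : M) : 𝒢.tone (fibreZero x) = fibreZero (𝒢.one x) :=
  tangentMap_fibreZero _ _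

end LieGroupoid

/-! ## Smoothness on subsets -/

namespace SmoothOnSubset

variable {EP HP P EN HN N EQ HQ Q : Type*}
  [NormedAddCommGroup EP] [NormedSpace ℝ EP] [TopologicalSpace HP] {IP : ModelWithCorners ℝ EP HP}
  [TopologicalSpace P] [ChartedSpace HP P]
  [NormedAddCommGroup EN] [NormedSpace ℝ EN] [TopologicalSpace HN] {IN : ModelWithCorners ℝ EN HN}
  [TopologicalSpace N] [ChartedSpace HN N]
  [NormedAddCommGroup EQ] [NormedSpace ℝ EQ] [TopologicalSpace HQ] {IQ : ModelWithCorners ℝ EQ HQ}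
  [TopologicalSpace Q] [ChartedSpace HQ Q]

theorem comp {f : P → N} {g : N → Q} {S : Set P} {T : Set N} (hg : SmoothOnSubset IN IQ g T)
    (hf : SmoothOnSubset IP IN f S) (hm : ∀ p ∈ S, f p ∈ T) :
    SmoothOnSubset IP IQ (fun p => g (f p)) S := by
  intro p hp
  obtain ⟨U, hU, hpU, F, hF, hFf⟩ := hf p hp
  obtain ⟨V, hV, hpV, F', hF', hFg⟩ := hg (f p) (hm p hp)
  refine ⟨U ∩ F ⁻¹' V, hF.continuousOn.isOpen_inter_preimage hU hV,
    ⟨hpU, by rw [Set.mem_preimage, hFf p hpU hp]; exact hpV⟩, fun q => F' (F q),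
    hF'.comp (hF.mono Set.inter_subset_left) fun q hq => hq.2, fun q hq hqS => ?_⟩
  have h1 := hq.2
  rw [Set.mem_preimage, hFf q hq.1 hqS] at h1
  show F' (F q) = g (f q)
  rw [hFf q hq.1 hqS, hFg _ h1 (hm q hqS)]

theorem prodMk {f : P → N} {g : P → Q} {S : Set P} (hf : SmoothOnSubset IP IN f S)
    (hg : SmoothOnSubset IP IQ g S) :
    SmoothOnSubset IP (IN.prod IQ) (fun p => (f p, g p)) S := by
  intro p hp
  obtain ⟨U, hU, hpU, F, hF, hFf⟩ := hf p hp
  obtain ⟨V, hV, hpV, F', hF', hFg⟩ := hg p hp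
  refine ⟨U ∩ V, hU.inter hV, ⟨hpU, hpV⟩, fun q => (F q, F' q),
    (hF.mono Set.inter_subset_left).prodMk (hF'.mono Set.inter_subset_right), fun q hq hqS => ?_⟩
  exact Prod.ext (hFf q hq.1 hqS) (hFg q hq.2 hqS)

end SmoothOnSubset

section

variable {EP HP P EN HN N : Type*}
  [NormedAddCommGroup EP] [NormedSpace ℝ EP] [TopologicalSpace HP] {IP : ModelWithCorners ℝ EP HP}
  [TopologicalSpace P] [ChartedSpace HP P]
  [NormedAddCommGroup EN] [NormedSpace ℝ EN] [TopologicalSpace HN] {IN : ModelWithCorners ℝ EN HN}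
  [TopologicalSpace N] [ChartedSpace HN N]

theorem ContMDiff.smoothOnSubset {f : P → N} (hf : ContMDiff IP IN ∞ f) (S : Set P) :
    SmoothOnSubset IP IN f S :=
  fun _ _ => ⟨Set.univ, isOpen_univ, trivial, f, hf.contMDiffOn, fun _ _ _ => rfl⟩

theorem smoothOnSubset_univ {f : P → N} : SmoothOnSubset IP IN f Set.univ ↔ ContMDiff IP IN ∞ f := by
  refine ⟨fun h p => ?_, fun h => h.smoothOnSubset _⟩
  obtain ⟨U, hU, hpU, F, hF, hFf⟩ := h p trivial
  refine (hF.contMDiffAt (hU.mem_nhds hpU)).congr_of_eventuallyEq ?_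
  filter_upwards [hU.mem_nhds hpU] with q hq using (hFf q hq trivial).symm

end

/-! ### Fields along a map as maps into the tangent bundle -/

section Along

variable {E : Type*} [NormedAddCommGroup E] [NormedSpace ℝ E]
  {N : Type*} [TopologicalSpace N] [ChartedSpace E N] [IsManifold 𝓘(ℝ, E) ∞ N]
  {EP : Type*} [NormedAddCommGroup EP] [NormedSpace ℝ EP]
  {HP : Type*} [TopologicalSpace HP] {IP : ModelWithCorners ℝ EP HP}
  {P : Type*} [TopologicalSpace P] [ChartedSpace HP P]
  {b : P → N} {hb : ContMDiff IP 𝓘(ℝ, E) ∞ b} {S : Set P}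
  {c : ∀ p : S, TangentSpace 𝓘(ℝ, E) (b p)} {Φ : P → TangentBundle 𝓘(ℝ, E) N}

theorem smoothOnSubset_of_mem_smoothAlong (hc : c ∈ smoothAlong IP hb S)
    (h : ∀ p : S, Φ p = ⟨b p, c p⟩) : SmoothOnSubset IP 𝓘(ℝ, E).tangent Φ S := by
  intro p hp
  obtain ⟨U, hU, hpU, F, hF, hFc⟩ := hc p hp
  exact ⟨U, hU, hpU, fun q => ⟨b q, F q⟩, hF, fun q hq hqS => by
    rw [h ⟨q, hqS⟩, ← hFc ⟨q, hqS⟩ hq]⟩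

/-- A local extension `F` of `Φ` lies over `b` only at points of `S`. Its fibre component in a
trivialization is kept and put back over `b`; shrinking to `W` keeps both base points in the
trivialization. -/
theorem mem_smoothAlong_of_smoothOnSubset (hΦ : SmoothOnSubset IP 𝓘(ℝ, E).tangent Φ S)
    (h : ∀ p : S, Φ p = ⟨b p, c p⟩) : c ∈ smoothAlong IP hb S := by
  intro p hp
  obtain ⟨U, hU, hpU, F, hF, hFΦ⟩ := hΦ p hp
  set e := trivializationAt E (TangentSpace 𝓘(ℝ, E) : N → Type _) (b p) with he
  have hFS : ∀ q ∈ U, ∀ hq : q ∈ S, F q = ⟨b q, c ⟨q, hq⟩⟩ := fun q hqU hq =>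
    (hFΦ q hqU hq).trans (h ⟨q, hq⟩)
  have hπF : ContMDiffOn IP 𝓘(ℝ, E) ∞ (fun q => (F q).1) U :=
    (Bundle.contMDiff_proj (TangentSpace 𝓘(ℝ, E) : N → Type _)).comp_contMDiffOn hF
  set W := U ∩ (fun q => (F q).1) ⁻¹' e.baseSet ∩ b ⁻¹' e.baseSet with hW
  have hWo : IsOpen W := (hπF.continuousOn.isOpen_inter_preimage hU e.open_baseSet).inter
    (e.open_baseSet.preimage hb.continuous)
  have hbp : b p ∈ e.baseSet := FiberBundle.mem_baseSet_trivializationAt' _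
  refine ⟨W, hWo, ⟨⟨hpU, by rw [Set.mem_preimage, hFS p hpU hp]; exact hbp⟩, hbp⟩,
    fun q => e.symm (b q) (e (F q)).2, ?_, ?_⟩
  · have h1 : ContMDiffOn IP 𝓘(ℝ, E) ∞ (fun q => (e (F q)).2) W :=
      ((e.contMDiffOn_iff (IB := 𝓘(ℝ, E)) (n := ∞) fun q hq => e.mem_source.2 hq.1.2).1
        (hF.mono fun q hq => hq.1.1)).2
    refine (e.contMDiffOn_iff (IB := 𝓘(ℝ, E)) (n := ∞) fun q hq => e.mem_source.2 hq.2).2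
      ⟨hb.contMDiffOn, h1.congr fun q hq => ?_⟩
    show (e ⟨b q, e.symm (b q) (e (F q)).2⟩).2 = (e (F q)).2
    rw [e.apply_mk_symm hq.2]
  · rintro ⟨q, hqS⟩ hqW
    show e.symm (b q) (e (F q)).2 = c ⟨q, hqS⟩
    rw [hFS q hqW.1.1 hqS]
    exact e.symm_apply_apply_mk hqW.2 _

end Along

/-! ### Smoothness of the tangent groupoid operations -/

namespace LieGroupoid

variable {E E' G M : Type*}
  [NormedAddCommGroup E] [NormedSpace ℝ E] [NormedAddCommGroup E'] [NormedSpace ℝ E']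
  [TopologicalSpace G] [ChartedSpace E G] [IsManifold 𝓘(ℝ, E) ∞ G]
  [TopologicalSpace M] [ChartedSpace E' M] [IsManifold 𝓘(ℝ, E') ∞ M]
  (𝒢 : LieGroupoid E E' G M)

/-- The tangent map of a local smooth extension `F` of the multiplication is a smooth extension of
`tmul`. -/
theorem smooth_tmul :
    SmoothOnSubset (𝓘(ℝ, E).tangent.prod 𝓘(ℝ, E).tangent) 𝓘(ℝ, E).tangent
      (fun p : TangentBundle 𝓘(ℝ, E) G × TangentBundle 𝓘(ℝ, E) G => 𝒢.tmul p.1 p.2)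
      {p | 𝒢.tsrc p.1 = 𝒢.ttgt p.2} := by
  intro p hp
  obtain ⟨U, hU, hpU, F, hF, hFm⟩ := 𝒢.smooth_mul (p.1.1, p.2.1)
    (congrArg Bundle.TotalSpace.proj hp)
  have := IsManifold.of_le (I := 𝓘(ℝ, E)) (M := G) (m := 1) (n := ∞) (by simp)
  have hsymm : ContMDiff (𝓘(ℝ, E).tangent.prod 𝓘(ℝ, E).tangent)
      (𝓘(ℝ, E).prod 𝓘(ℝ, E)).tangent ∞ (equivTangentBundleProd 𝓘(ℝ, E) G 𝓘(ℝ, E) G).symm :=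
    contMDiff_equivTangentBundleProd_symm
  have hT := hF.contMDiffOn_tangentMapWithin (m := ∞) (by simp) hU.uniqueMDiffOn
  refine ⟨{q | (q.1.1, q.2.1) ∈ U}, ?_, hpU, fun q => tangentMapWithin (𝓘(ℝ, E).prod 𝓘(ℝ, E))
    𝓘(ℝ, E) F U ((equivTangentBundleProd 𝓘(ℝ, E) G 𝓘(ℝ, E) G).symm q),
    hT.comp hsymm.contMDiffOn fun q hq => hq, fun q hq hqc => ?_⟩
  · exact hU.preimage (((FiberBundle.continuous_proj E (TangentSpace 𝓘(ℝ, E) : G → Type _)).comp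
      continuous_fst).prodMk ((FiberBundle.continuous_proj E
        (TangentSpace 𝓘(ℝ, E) : G → Type _)).comp continuous_snd))
  -- `F` agrees with the multiplication only on composable pairs, so the two derivatives are
  -- compared along composable curves.
  · obtain ⟨γ, η, hγ, hη, e⟩ := exists_composable_curves (𝒢 := 𝒢) hqc
    have hγη := hγ.prodMk hη
    have hev : ∀ᶠ t in 𝓝 0, (γ t, η t) ∈ U :=
      hγη.continuousAt.eventually_mem (hU.mem_nhds (by
        rw [hγ.apply_zero, hη.apply_zero]; exact hq))
    refine (hγη.comp_within hev (hF.mdifferentiableOn (by simp) _ hq)).unique (hγ.mul hη e) ?_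
    filter_upwards [e, hev] with t h1 h2 using hFm _ h2 h1

theorem smooth_tsrc : ContMDiff 𝓘(ℝ, E).tangent 𝓘(ℝ, E').tangent ∞ 𝒢.tsrc :=
  𝒢.submersion_src.contMDiff.contMDiff_tangentMap (by simp)

theorem smooth_ttgt : ContMDiff 𝓘(ℝ, E).tangent 𝓘(ℝ, E').tangent ∞ 𝒢.ttgt :=
  𝒢.submersion_tgt.contMDiff.contMDiff_tangentMap (by simp)

theorem smooth_tinv : ContMDiff 𝓘(ℝ, E).tangent 𝓘(ℝ, E).tangent ∞ 𝒢.tinv :=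
  𝒢.smooth_inv.contMDiff_tangentMap (by simp)

theorem smooth_fibreZero : ContMDiff 𝓘(ℝ, E) 𝓘(ℝ, E).tangent ∞
    (fibreZero : G → TangentBundle 𝓘(ℝ, E) G) :=
  Bundle.contMDiff_zeroSection (n := ∞) ℝ (TangentSpace 𝓘(ℝ, E) : G → Type _)

variable {𝒢}
variable {EP HP P : Type*} [NormedAddCommGroup EP] [NormedSpace ℝ EP] [TopologicalSpace HP]
  {IP : ModelWithCorners ℝ EP HP} [TopologicalSpace P] [ChartedSpace HP P] {S : Set P}

theorem smoothOnSubset_tmul {f f' : P → TangentBundle 𝓘(ℝ, E) G}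
    (hf : SmoothOnSubset IP 𝓘(ℝ, E).tangent f S) (hf' : SmoothOnSubset IP 𝓘(ℝ, E).tangent f' S)
    (h : ∀ p ∈ S, 𝒢.tsrc (f p) = 𝒢.ttgt (f' p)) :
    SmoothOnSubset IP 𝓘(ℝ, E).tangent (fun p => 𝒢.tmul (f p) (f' p)) S :=
  𝒢.smooth_tmul.comp (hf.prodMk hf') h

theorem contMDiff_tmul {f f' : P → TangentBundle 𝓘(ℝ, E) G}
    (hf : ContMDiff IP 𝓘(ℝ, E).tangent ∞ f) (hf' : ContMDiff IP 𝓘(ℝ, E).tangent ∞ f')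
    (h : ∀ p, 𝒢.tsrc (f p) = 𝒢.ttgt (f' p)) :
    ContMDiff IP 𝓘(ℝ, E).tangent ∞ (fun p => 𝒢.tmul (f p) (f' p)) :=
  smoothOnSubset_univ.1 (smoothOnSubset_tmul (hf.smoothOnSubset _) (hf'.smoothOnSubset _)
    fun p _ => h p)

end LieGroupoid

section Fibrewise

variable {E N : Type*} [NormedAddCommGroup E] [NormedSpace ℝ E]
  [TopologicalSpace N] [ChartedSpace E N]

theorem fibreAdd_fibreNeg_eq_zero_iff {x : N} {ξ ζ : TangentBundle 𝓘(ℝ, E) N} (hξ : ξ.1 = x)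
    (hζ : ζ.1 = x) : fibreAdd (fibreNeg ξ) ζ = fibreZero x ↔ ξ = ζ := by
  obtain ⟨y, v⟩ := ξ
  obtain ⟨z, w⟩ := ζ
  obtain rfl : y = x := hξ
  obtain rfl : z = y := hζ
  rw [← mk_neg, ← mk_add, ← mk_zero, mk_inj, mk_inj, neg_add_eq_zero]

theorem mk_eq_fibreZero_iff {x y : N} {v : TangentSpace 𝓘(ℝ, E) y} (h : y = x) :
    (⟨y, v⟩ : TangentBundle 𝓘(ℝ, E) N) = fibreZero x ↔ v = 0 := by
  subst h
  exact mk_inj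

end Fibrewise

namespace LieGroupoid

noncomputable section

variable {E E' G M : Type*}
  [NormedAddCommGroup E] [NormedSpace ℝ E] [NormedAddCommGroup E'] [NormedSpace ℝ E']
  [TopologicalSpace G] [ChartedSpace E G] [IsManifold 𝓘(ℝ, E) ∞ G]
  [TopologicalSpace M] [ChartedSpace E' M] [IsManifold 𝓘(ℝ, E') ∞ M]
  {𝒢 : LieGroupoid E E' G M}

/-! ## Cancellation in the tangent groupoid -/

theorem tone_zero_tmul {ξ : TangentBundle 𝓘(ℝ, E) G} {x : M} (h : 𝒢.ttgt ξ = fibreZero x) :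
    𝒢.tmul (fibreZero (𝒢.one x)) ξ = ξ := by
  have := tone_tmul (𝒢 := 𝒢) ξ
  rwa [h, tone_fibreZero] at this

theorem tmul_tone_zero {ξ : TangentBundle 𝓘(ℝ, E) G} {x : M} (h : 𝒢.tsrc ξ = fibreZero x) :
    𝒢.tmul ξ (fibreZero (𝒢.one x)) = ξ := by
  have := tmul_tone (𝒢 := 𝒢) ξ
  rwa [h, tone_fibreZero] at this

theorem tmul_tmul_tinv {ξ ζ : TangentBundle 𝓘(ℝ, E) G} (h : 𝒢.tsrc ξ = 𝒢.ttgt ζ) :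
    𝒢.tmul (𝒢.tmul ξ ζ) (𝒢.tinv ζ) = ξ := by
  rw [tmul_assoc h (ttgt_tinv ζ).symm, tmul_tinv, ← h, tmul_tone]

theorem tmul_tinv_tmul {ξ ζ : TangentBundle 𝓘(ℝ, E) G} (h : 𝒢.tsrc ξ = 𝒢.tsrc ζ) :
    𝒢.tmul (𝒢.tmul ξ (𝒢.tinv ζ)) ζ = ξ := by
  rw [tmul_assoc (by rw [h, ttgt_tinv]) (tsrc_tinv ζ), tinv_tmul, ← h, tmul_tone]

theorem tinv_tmul_tmul {ξ ζ : TangentBundle 𝓘(ℝ, E) G} (h : 𝒢.tsrc ξ = 𝒢.ttgt ζ) :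
    𝒢.tmul (𝒢.tinv ξ) (𝒢.tmul ξ ζ) = ζ := by
  rw [← tmul_assoc (tsrc_tinv ξ) h, tinv_tmul, h, tone_tmul]

/-- The common factor `χ` cancels; this is the cancellation behind `δ² = 0`. -/
theorem tmul_tinv_tmul_tinv {ξ ζ χ : TangentBundle 𝓘(ℝ, E) G} (h : 𝒢.tsrc ξ = 𝒢.tsrc ζ)
    (k : 𝒢.tsrc ζ = 𝒢.tsrc χ) :
    𝒢.tmul (𝒢.tmul ξ (𝒢.tinv χ)) (𝒢.tinv (𝒢.tmul ζ (𝒢.tinv χ))) = 𝒢.tmul ξ (𝒢.tinv ζ) := by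
  have h1 : 𝒢.tsrc ζ = 𝒢.ttgt (𝒢.tinv χ) := by rw [k, ttgt_tinv]
  rw [tinv_tmul_rev h1, tinv_tinv, ← tmul_assoc, tmul_tinv_tmul (h.trans k)]
  · rw [tsrc_tmul (h.trans h1), tsrc_tinv]
  · rw [ttgt_tinv, k]

/-! ## Isotropy vectors -/

theorem mem_algebroidFibre_iff {x : M} {v : TangentSpace 𝓘(ℝ, E) (𝒢.one x)} :
    v ∈ 𝒢.algebroidFibre x ↔ 𝒢.tsrc ⟨𝒢.one x, v⟩ = fibreZero x :=
  (mk_eq_fibreZero_iff (𝒢.src_one x)).symm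

theorem mem_isotropyFibre_iff {x : M} {v : TangentSpace 𝓘(ℝ, E) (𝒢.one x)} :
    v ∈ 𝒢.isotropyFibre x ↔
      𝒢.tsrc ⟨𝒢.one x, v⟩ = fibreZero x ∧ 𝒢.ttgt ⟨𝒢.one x, v⟩ = fibreZero x :=
  and_congr mem_algebroidFibre_iff (mk_eq_fibreZero_iff (𝒢.tgt_one x)).symm

variable (𝒢) in
/-- A tangent vector at the unit of `x` that is tangent to the isotropy group. -/
structure IsIsotropic (x : M) (ξ : TangentBundle 𝓘(ℝ, E) G) : Prop where
  proj : ξ.1 = 𝒢.one x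
  tsrc : 𝒢.tsrc ξ = fibreZero x
  ttgt : 𝒢.ttgt ξ = fibreZero x

theorem isIsotropic_mk_iff {x : M} {v : TangentSpace 𝓘(ℝ, E) (𝒢.one x)} :
    𝒢.IsIsotropic x ⟨𝒢.one x, v⟩ ↔ v ∈ 𝒢.isotropyFibre x := by
  rw [mem_isotropyFibre_iff]
  exact ⟨fun h => ⟨h.tsrc, h.ttgt⟩, fun h => ⟨rfl, h.1, h.2⟩⟩

namespace IsIsotropic

variable {x : M} {ξ ζ : TangentBundle 𝓘(ℝ, E) G}

theorem fibreNeg (h : 𝒢.IsIsotropic x ξ) : 𝒢.IsIsotropic x (fibreNeg ξ) :=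
  ⟨h.proj, by rw [tsrc_fibreNeg, h.tsrc, fibreNeg_zero], by rw [ttgt_fibreNeg, h.ttgt, fibreNeg_zero]⟩

/-- Eckmann-Hilton: by the interchange law, `(ξ + 0)(0 + ζ) = ξ0 + 0ζ = ξ + ζ`, since the zero
vector at the unit is a unit for both factors. -/
theorem tmul_eq_fibreAdd (h : 𝒢.IsIsotropic x ξ) (k : 𝒢.IsIsotropic x ζ) :
    𝒢.tmul ξ ζ = fibreAdd ξ ζ := by
  have h1 := tmul_fibreAdd (𝒢 := 𝒢) (ξ := ξ) (ξ' := fibreZero (𝒢.one x))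
    (ζ := fibreZero (𝒢.one x)) (ζ' := ζ) h.proj k.proj.symm
  rwa [fibreAdd_zero, zero_fibreAdd k.proj, tmul_tone_zero h.tsrc, tone_zero_tmul k.ttgt] at h1

theorem tinv_eq_fibreNeg (h : 𝒢.IsIsotropic x ξ) : 𝒢.tinv ξ = _root_.fibreNeg ξ := by
  have h1 : 𝒢.tsrc (𝒢.tinv ξ) = 𝒢.ttgt ξ := tsrc_tinv ξ
  have h2 := tinv_tmul_tmul (𝒢 := 𝒢) (ξ := ξ) (ζ := _root_.fibreNeg ξ)
    (h.tsrc.trans h.fibreNeg.ttgt.symm)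
  rw [h.tmul_eq_fibreAdd h.fibreNeg, fibreAdd_neg, h.proj, tmul_tone_zero (h1.trans h.ttgt)] at h2
  exact h2

theorem tmul_zero_composable {g : G} (h : 𝒢.IsIsotropic (𝒢.src g) ξ) :
    𝒢.tsrc (fibreZero g) = 𝒢.ttgt ξ := by
  rw [tsrc_fibreZero, h.ttgt]

theorem zero_tmul_composable {g : G} (h : 𝒢.IsIsotropic (𝒢.tgt g) ξ) :
    𝒢.tsrc ξ = 𝒢.ttgt (fibreZero g) := by
  rw [ttgt_fibreZero, h.tsrc]

/-- The adjoint action preserves the isotropy. -/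
theorem conj {g : G} (h : 𝒢.IsIsotropic (𝒢.src g) ξ) :
    𝒢.IsIsotropic (𝒢.tgt g) (𝒢.tmul (𝒢.tmul (fibreZero g) ξ) (fibreZero (𝒢.inv g))) := by
  have h1 := h.tmul_zero_composable
  have h2 : 𝒢.tsrc (𝒢.tmul (fibreZero g) ξ) = 𝒢.ttgt (fibreZero (𝒢.inv g)) := by
    rw [tsrc_tmul h1, h.tsrc, ttgt_fibreZero, 𝒢.tgt_inv]
  refine ⟨?_, ?_, ?_⟩
  · rw [tmul_proj, tmul_proj, h.proj, fibreZero_proj, fibreZero_proj, 𝒢.mul_one, 𝒢.mul_inv]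
  · rw [tsrc_tmul h2, tsrc_fibreZero, 𝒢.src_inv]
  · rw [ttgt_tmul h2, ttgt_tmul h1, ttgt_fibreZero]

/-- Cancelling `0_{g⁻¹} 0_g` gives `r_g ∘ ad_g = l_g` on isotropy vectors, which exchanges left for
right translations. -/
theorem conj_tmul {g : G} (h : 𝒢.IsIsotropic (𝒢.src g) ξ) :
    𝒢.tmul (𝒢.tmul (𝒢.tmul (fibreZero g) ξ) (fibreZero (𝒢.inv g))) (fibreZero g) =
      𝒢.tmul (fibreZero g) ξ := by
  have h1 := tmul_tinv_tmul (𝒢 := 𝒢) (ξ := 𝒢.tmul (fibreZero g) ξ) (ζ := fibreZero g) (by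
    rw [tsrc_tmul h.tmul_zero_composable, h.tsrc, tsrc_fibreZero])
  rwa [tinv_fibreZero] at h1

end IsIsotropic

/-! ## Transport of vectors to the units -/

theorem mk_transportRight {g : G} {v : TangentSpace 𝓘(ℝ, E) (𝒢.one (𝒢.tgt g))}
    (h : v ∈ 𝒢.algebroidFibre (𝒢.tgt g)) :
    (⟨g, 𝒢.transportRight g v⟩ : TangentBundle 𝓘(ℝ, E) G) =
      𝒢.tmul ⟨𝒢.one (𝒢.tgt g), v⟩ (fibreZero g) := by
  rw [← mk_rightTr (mem_algebroidFibre_iff.1 h)]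
  exact mk_tangentCast _ _

theorem tsrc_transportRight {g : G} {v : TangentSpace 𝓘(ℝ, E) (𝒢.one (𝒢.tgt g))}
    (h : v ∈ 𝒢.algebroidFibre (𝒢.tgt g)) :
    𝒢.tsrc ⟨g, 𝒢.transportRight g v⟩ = fibreZero (𝒢.src g) := by
  rw [mk_transportRight h, tsrc_tmul, tsrc_fibreZero]
  rw [mem_algebroidFibre_iff.1 h, ttgt_fibreZero]

theorem ttgt_transportRight {g : G} {v : TangentSpace 𝓘(ℝ, E) (𝒢.one (𝒢.tgt g))}
    (h : v ∈ 𝒢.algebroidFibre (𝒢.tgt g)) :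
    𝒢.ttgt ⟨g, 𝒢.transportRight g v⟩ = 𝒢.ttgt ⟨𝒢.one (𝒢.tgt g), v⟩ := by
  rw [mk_transportRight h, ttgt_tmul]
  rw [mem_algebroidFibre_iff.1 h, ttgt_fibreZero]

variable (𝒢) in
/-- The inverse of `transportRight`, on vectors tangent to the source fibre. -/
def transportBack (g : G) :
    TangentSpace 𝓘(ℝ, E) g →L[ℝ] TangentSpace 𝓘(ℝ, E) (𝒢.one (𝒢.tgt g)) :=
  (tangentCast (𝒢.mul_inv g)).comp (𝒢.rightTr (𝒢.inv g) g)

theorem mk_transportBack {g : G} {w : TangentSpace 𝓘(ℝ, E) g}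
    (h : 𝒢.tsrc ⟨g, w⟩ = fibreZero (𝒢.src g)) :
    (⟨𝒢.one (𝒢.tgt g), 𝒢.transportBack g w⟩ : TangentBundle 𝓘(ℝ, E) G) =
      𝒢.tmul ⟨g, w⟩ (fibreZero (𝒢.inv g)) := by
  rw [← mk_rightTr (by rw [h, 𝒢.tgt_inv])]
  exact mk_tangentCast _ _

theorem transportBack_mem_algebroidFibre {g : G} {w : TangentSpace 𝓘(ℝ, E) g}
    (h : 𝒢.tsrc ⟨g, w⟩ = fibreZero (𝒢.src g)) :
    𝒢.transportBack g w ∈ 𝒢.algebroidFibre (𝒢.tgt g) := by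
  rw [mem_algebroidFibre_iff, mk_transportBack h, tsrc_tmul, tsrc_fibreZero, 𝒢.src_inv]
  rw [h, ttgt_fibreZero, 𝒢.tgt_inv]

theorem transportRight_transportBack {g : G} {w : TangentSpace 𝓘(ℝ, E) g}
    (h : 𝒢.tsrc ⟨g, w⟩ = fibreZero (𝒢.src g)) :
    𝒢.transportRight g (𝒢.transportBack g w) = w := by
  rw [← mk_inj, mk_transportRight (transportBack_mem_algebroidFibre h), mk_transportBack h,
    ← tinv_fibreZero]
  exact tmul_tinv_tmul (by rw [h, tsrc_fibreZero])

theorem transportBack_transportRight {g : G} {v : TangentSpace 𝓘(ℝ, E) (𝒢.one (𝒢.tgt g))}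
    (h : v ∈ 𝒢.algebroidFibre (𝒢.tgt g)) :
    𝒢.transportBack g (𝒢.transportRight g v) = v := by
  rw [← mk_inj, mk_transportBack (tsrc_transportRight h), mk_transportRight h, ← tinv_fibreZero]
  exact tmul_tmul_tinv (by rw [mem_algebroidFibre_iff.1 h, ttgt_fibreZero])

theorem transportBack_mem_isotropyFibre {g : G} {w : TangentSpace 𝓘(ℝ, E) g}
    (h : 𝒢.tsrc ⟨g, w⟩ = fibreZero (𝒢.src g)) (k : 𝒢.ttgt ⟨g, w⟩ = fibreZero (𝒢.tgt g)) :
    𝒢.transportBack g w ∈ 𝒢.isotropyFibre (𝒢.tgt g) := by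
  refine mem_isotropyFibre_iff.2
    ⟨mem_algebroidFibre_iff.1 (transportBack_mem_algebroidFibre h), ?_⟩
  rw [← ttgt_transportRight (transportBack_mem_algebroidFibre h), transportRight_transportBack h, k]

/-! ## The adjoint action -/

theorem mk_ad {g : G} {v : TangentSpace 𝓘(ℝ, E) (𝒢.one (𝒢.src g))}
    (h : v ∈ 𝒢.isotropyFibre (𝒢.src g)) :
    (⟨𝒢.one (𝒢.tgt g), 𝒢.ad g v⟩ : TangentBundle 𝓘(ℝ, E) G) =
      𝒢.tmul (𝒢.tmul (fibreZero g) ⟨𝒢.one (𝒢.src g), v⟩) (fibreZero (𝒢.inv g)) := by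
  have h' := isIsotropic_mk_iff.2 h
  rw [← mk_leftTr h'.ttgt]
  rw [← mk_rightTr (by
    rw [mk_leftTr h'.ttgt, tsrc_tmul h'.tmul_zero_composable, h'.tsrc, 𝒢.tgt_inv])]
  exact mk_tangentCast _ _

theorem mk_adAt {g h : G} (H : 𝒢.src g = 𝒢.tgt h) {v : TangentSpace 𝓘(ℝ, E) (𝒢.one (𝒢.tgt h))}
    (hv : v ∈ 𝒢.isotropyFibre (𝒢.tgt h)) :
    (⟨𝒢.one (𝒢.tgt g), 𝒢.adAt H v⟩ : TangentBundle 𝓘(ℝ, E) G) =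
      𝒢.tmul (𝒢.tmul (fibreZero g) ⟨𝒢.one (𝒢.tgt h), v⟩) (fibreZero (𝒢.inv g)) := by
  have h1 : 𝒢.IsIsotropic (𝒢.src g)
      ⟨𝒢.one (𝒢.src g), tangentCast (congrArg 𝒢.one H.symm) v⟩ := by
    rw [mk_tangentCast, H]
    exact isIsotropic_mk_iff.2 hv
  rw [← mk_tangentCast (congrArg 𝒢.one H.symm) v, ← mk_ad (isIsotropic_mk_iff.1 h1)]
  rfl

theorem ad_mem_isotropyFibre {g : G} {v : TangentSpace 𝓘(ℝ, E) (𝒢.one (𝒢.src g))}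
    (h : v ∈ 𝒢.isotropyFibre (𝒢.src g)) : 𝒢.ad g v ∈ 𝒢.isotropyFibre (𝒢.tgt g) := by
  rw [← isIsotropic_mk_iff, mk_ad h]
  exact (isIsotropic_mk_iff.2 h).conj

theorem adAt_mem_isotropyFibre {g h : G} (H : 𝒢.src g = 𝒢.tgt h)
    {v : TangentSpace 𝓘(ℝ, E) (𝒢.one (𝒢.tgt h))} (hv : v ∈ 𝒢.isotropyFibre (𝒢.tgt h)) :
    𝒢.adAt H v ∈ 𝒢.isotropyFibre (𝒢.tgt g) := by
  rw [← isIsotropic_mk_iff, mk_adAt H hv]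
  have h1 := isIsotropic_mk_iff.2 hv
  rw [← H] at h1
  exact IsIsotropic.conj (by rw [← H]; exact h1)

theorem tangentCast_mem_isotropyFibre {x y : M} (h : x = y)
    {v : TangentSpace 𝓘(ℝ, E) (𝒢.one x)} (hv : v ∈ 𝒢.isotropyFibre x) :
    tangentCast (congrArg 𝒢.one h) v ∈ 𝒢.isotropyFibre y := by
  subst h
  exact hv

/-- The division of right translated isotropy vectors. -/
theorem tmul_tmul_tinv_tmul {g h : G} (H : 𝒢.src g = 𝒢.tgt h) {ξ ζ : TangentBundle 𝓘(ℝ, E) G}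
    (hξ : 𝒢.IsIsotropic (𝒢.tgt g) ξ) (hζ : 𝒢.IsIsotropic (𝒢.tgt h) ζ) :
    𝒢.tmul (𝒢.tmul ξ (fibreZero (𝒢.mul g h))) (𝒢.tinv (𝒢.tmul ζ (fibreZero h))) =
      𝒢.tmul (fibreAdd ξ (fibreNeg (𝒢.tmul (𝒢.tmul (fibreZero g) ζ) (fibreZero (𝒢.inv g)))))
        (fibreZero g) := by
  have hζ' : 𝒢.IsIsotropic (𝒢.src g) ζ := H ▸ hζ
  have c1 : 𝒢.tsrc ξ = 𝒢.ttgt (fibreZero g) := hξ.zero_tmul_composable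
  have c2 : 𝒢.tsrc (fibreZero g) = 𝒢.ttgt (fibreZero h) := by simp [H]
  have c3 : 𝒢.tsrc (𝒢.tmul ξ (fibreZero g)) = 𝒢.ttgt (fibreZero h) := by rw [tsrc_tmul c1, c2]
  have c4 : 𝒢.tsrc (𝒢.tmul (𝒢.tmul ξ (fibreZero g)) (fibreZero h)) =
      𝒢.ttgt (𝒢.tinv (fibreZero h)) := by rw [tsrc_tmul c3, ttgt_tinv]
  have c5 : 𝒢.tsrc (𝒢.tinv (fibreZero h)) = 𝒢.ttgt (𝒢.tinv ζ) := by
    rw [tsrc_tinv, ttgt_tinv, hζ.zero_tmul_composable]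
  have c6 : 𝒢.tsrc (fibreZero g) = 𝒢.ttgt (fibreNeg ζ) := by
    rw [hζ'.fibreNeg.ttgt, tsrc_fibreZero]
  have e1 : 𝒢.tmul (fibreZero g) (fibreNeg ζ) = fibreNeg (𝒢.tmul (fibreZero g) ζ) := by
    rw [← tmul_fibreNeg, fibreNeg_zero]
  -- The computation is `(ξ 0_g 0_h)(0_h⁻¹ ζ⁻¹) = ξ 0_g (-ζ)`, after which `0_g (-ζ) = (-ad_g ζ)
  -- 0_g` and the product of the isotropy vectors `ξ` and `-ad_g ζ` is their sum.
  rw [← tmul_fibreZero, ← tmul_assoc c1 c2, tinv_tmul_rev hζ.zero_tmul_composable,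
    ← tmul_assoc c4 c5, tmul_tmul_tinv c3, hζ.tinv_eq_fibreNeg, tmul_assoc c1 c6, e1]
  have e2 := tmul_fibreNeg (𝒢 := 𝒢) (𝒢.tmul (𝒢.tmul (fibreZero g) ζ) (fibreZero (𝒢.inv g)))
    (fibreZero g)
  rw [fibreNeg_zero, hζ'.conj_tmul] at e2
  rw [← e2, ← tmul_assoc _ hζ'.conj.fibreNeg.zero_tmul_composable,
    hξ.tmul_eq_fibreAdd hζ'.conj.fibreNeg]
  rw [hξ.tsrc, hζ'.conj.fibreNeg.ttgt]

/-- The term `-dm̄` of the deformation differential thus becomes `ad_g q - p`, the first two terms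
of the isotropy differential. The remaining terms match under right translation by linearity. -/
theorem ddiv_transportRight {g h : G} (H : 𝒢.src g = 𝒢.tgt h)
    {p : TangentSpace 𝓘(ℝ, E) (𝒢.one (𝒢.tgt (𝒢.mul g h)))}
    {q : TangentSpace 𝓘(ℝ, E) (𝒢.one (𝒢.tgt h))} (hp : p ∈ 𝒢.isotropyFibre (𝒢.tgt (𝒢.mul g h)))
    (hq : q ∈ 𝒢.isotropyFibre (𝒢.tgt h)) :
    tangentCast (𝒢.div_mul_cancel H) (𝒢.ddiv (𝒢.mul g h) h
      (𝒢.transportRight (𝒢.mul g h) p, 𝒢.transportRight h q)) =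
    𝒢.transportRight g (tangentCast (congrArg 𝒢.one (𝒢.tgt_mul _ _ H)) p - 𝒢.adAt H q) := by
  have hp' := tangentCast_mem_isotropyFibre (𝒢.tgt_mul _ _ H) hp
  have hmem := Submodule.sub_mem _ hp' (adAt_mem_isotropyFibre H hq)
  rw [← mk_inj, mk_tangentCast, mk_ddiv, mk_transportRight hp.1, mk_transportRight hq.1,
    mk_transportRight hmem.1, mk_sub, mk_adAt H hq, mk_tangentCast]
  · refine tmul_tmul_tinv_tmul H ?_ (isIsotropic_mk_iff.2 hq)
    have := isIsotropic_mk_iff.2 hp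
    rwa [𝒢.tgt_mul _ _ H] at this ⊢
  · rw [tsrc_transportRight hp.1, tsrc_transportRight hq.1, 𝒢.src_mul _ _ H]

/-! ## The inclusion is a map of complexes -/

variable (𝒢) in
/-- The inclusion `r` in degree `3`: `(g₁, g₂, g₃) ↦ r_{g₁} (u (g₁, g₂, g₃))`. -/
def incl₃ (u : ∀ p : 𝒢.composable₃, TangentSpace 𝓘(ℝ, E) (𝒢.one (𝒢.tgt p.1.1)))
    (p : 𝒢.composable₃) : TangentSpace 𝓘(ℝ, E) p.1.1 :=
  𝒢.transportRight p.1.1 (u p)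

theorem defD₁_incl₁ {u : ∀ g : G, TangentSpace 𝓘(ℝ, E) (𝒢.one (𝒢.tgt g))}
    (hu : ∀ g, u g ∈ 𝒢.isotropyFibre (𝒢.tgt g)) :
    𝒢.defD₁ (𝒢.incl₁ u) = 𝒢.incl₂ (𝒢.isoD₁ u) := by
  funext p
  refine (congrArg (fun v => -v + 𝒢.transportRight p.1.1 (u p.1.1))
    (ddiv_transportRight p.2 (hu _) (hu p.1.2))).trans ?_
  refine Eq.trans ?_ (map_add (𝒢.transportRight p.1.1) _ _).symm
  rw [← map_neg, neg_sub]

theorem isoD₁_mem_isotropyFibre {u : ∀ g : G, TangentSpace 𝓘(ℝ, E) (𝒢.one (𝒢.tgt g))}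
    (hu : ∀ g, u g ∈ 𝒢.isotropyFibre (𝒢.tgt g)) (p : 𝒢.composable) :
    𝒢.isoD₁ u p ∈ 𝒢.isotropyFibre (𝒢.tgt p.1.1) :=
  Submodule.add_mem _ (Submodule.sub_mem _ (adAt_mem_isotropyFibre p.2 (hu _))
    (tangentCast_mem_isotropyFibre (𝒢.tgt_mul _ _ p.2) (hu _))) (hu _)

theorem defD₂_incl₂ {u : ∀ p : 𝒢.composable, TangentSpace 𝓘(ℝ, E) (𝒢.one (𝒢.tgt p.1.1))}
    (hu : ∀ p, u p ∈ 𝒢.isotropyFibre (𝒢.tgt p.1.1)) :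
    𝒢.defD₂ (𝒢.incl₂ u) = 𝒢.incl₃ (𝒢.isoD₂ u) := by
  funext p
  refine (congrArg (fun v => -v + 𝒢.transportRight p.1.1
      (𝒢.isoVal u (𝒢.composable_mul p.2.1 p.2.2)) - 𝒢.transportRight p.1.1 (𝒢.isoVal u p.2.1))
    (ddiv_transportRight p.2.1 (hu ⟨(_, p.1.2.2), 𝒢.mul_composable p.2.1 p.2.2⟩)
      (hu ⟨_, p.2.2⟩))).trans ?_
  refine Eq.trans ?_ (map_sub (𝒢.transportRight p.1.1) _ _).symm
  rw [map_add, ← map_neg, neg_sub]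
  rfl

theorem isoD₂_mem_isotropyFibre
    {u : ∀ p : 𝒢.composable, TangentSpace 𝓘(ℝ, E) (𝒢.one (𝒢.tgt p.1.1))}
    (hu : ∀ p, u p ∈ 𝒢.isotropyFibre (𝒢.tgt p.1.1)) (p : 𝒢.composable₃) :
    𝒢.isoD₂ u p ∈ 𝒢.isotropyFibre (𝒢.tgt p.1.1) :=
  Submodule.sub_mem _ (Submodule.add_mem _ (Submodule.sub_mem _
    (adAt_mem_isotropyFibre p.2.1 (hu ⟨_, p.2.2⟩))
    (tangentCast_mem_isotropyFibre (𝒢.tgt_mul _ _ p.2.1)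
      (hu ⟨(𝒢.mul p.1.1 p.1.2.1, p.1.2.2), 𝒢.mul_composable p.2.1 p.2.2⟩)))
    (hu ⟨(p.1.1, 𝒢.mul p.1.2.1 p.1.2.2), 𝒢.composable_mul p.2.1 p.2.2⟩))
    (hu ⟨(p.1.1, p.1.2.1), p.2.1⟩)

/-! ## Invariant fields -/

theorem mk_leftInvariant {α : ∀ x : M, TangentSpace 𝓘(ℝ, E) (𝒢.one x)}
    (hα : ∀ x, α x ∈ 𝒢.algebroidFibre x) (g : G) :
    (⟨g, 𝒢.leftInvariant α g⟩ : TangentBundle 𝓘(ℝ, E) G) =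
      𝒢.tmul (fibreZero g) (𝒢.tinv ⟨𝒢.one (𝒢.src g), α (𝒢.src g)⟩) := by
  have h : 𝒢.ttgt (𝒢.tinv ⟨𝒢.one (𝒢.src g), α (𝒢.src g)⟩) = fibreZero (𝒢.src g) := by
    rw [ttgt_tinv, mem_algebroidFibre_iff.1 (hα _)]
  refine (mk_tangentCast _ _).trans ?_
  exact mk_leftTr h

/-- On isotropy vectors `di` is minus the identity and `l_g = r_g ∘ ad_g`, so the left invariant
field is `-r_g ad_g α`. The inclusion therefore commutes with the degree zero differentials only up
to sign, which affects neither kernels nor images. -/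
theorem defD₀_eq_neg_incl₁ {α : ∀ x : M, TangentSpace 𝓘(ℝ, E) (𝒢.one x)}
    (hα : ∀ x, α x ∈ 𝒢.isotropyFibre x) : 𝒢.defD₀ α = - 𝒢.incl₁ (𝒢.isoD₀ α) := by
  have h1 : ∀ g, 𝒢.leftInvariant α g = - 𝒢.transportRight g (𝒢.ad g (α (𝒢.src g))) := by
    intro g
    have h2 := isIsotropic_mk_iff.2 (hα (𝒢.src g))
    rw [← mk_inj, mk_leftInvariant (fun x => (hα x).1), mk_neg,
      mk_transportRight (ad_mem_isotropyFibre (hα _)).1, mk_ad (hα _), h2.conj_tmul,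
      h2.tinv_eq_fibreNeg, ← tmul_fibreNeg, fibreNeg_zero]
  ext g
  simp only [defD₀, incl₁, isoD₀, LinearMap.coe_mk, AddHom.coe_mk, Pi.neg_apply]
  rw [h1, map_sub, rightInvariant]
  abel

end

end LieGroupoid

theorem exists_smoothOnSubset_of_mem_smoothAlong {E : Type*} [NormedAddCommGroup E]
    [NormedSpace ℝ E] {N : Type*} [TopologicalSpace N] [ChartedSpace E N] [IsManifold 𝓘(ℝ, E) ∞ N]
    {EP : Type*} [NormedAddCommGroup EP] [NormedSpace ℝ EP]
    {HP : Type*} [TopologicalSpace HP] {IP : ModelWithCorners ℝ EP HP}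
    {P : Type*} [TopologicalSpace P] [ChartedSpace HP P]
    {b : P → N} {hb : ContMDiff IP 𝓘(ℝ, E) ∞ b} {S : Set P}
    {c : ∀ p : S, TangentSpace 𝓘(ℝ, E) (b p)} (hc : c ∈ smoothAlong IP hb S) :
    ∃ Φ : P → TangentBundle 𝓘(ℝ, E) N,
      SmoothOnSubset IP 𝓘(ℝ, E).tangent Φ S ∧ ∀ p : S, Φ p = ⟨b p, c p⟩ := by
  classical
  let Φ : P → TangentBundle 𝓘(ℝ, E) N :=
    -- Values off `S` are irrelevant to smoothness on `S`; zero is a filler that gives a globally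
    -- defined map.
    fun p => if h : p ∈ S then ⟨b p, c ⟨p, h⟩⟩ else fibreZero (b p)
  have h : ∀ p : S, Φ p = ⟨b p, c p⟩ := fun p => dif_pos p.2
  exact ⟨Φ, smoothOnSubset_of_mem_smoothAlong hc h, h⟩

namespace LieGroupoid

noncomputable section

variable {E E' G M : Type*}
  [NormedAddCommGroup E] [NormedSpace ℝ E] [NormedAddCommGroup E'] [NormedSpace ℝ E']
  [TopologicalSpace G] [ChartedSpace E G] [IsManifold 𝓘(ℝ, E) ∞ G]
  [TopologicalSpace M] [ChartedSpace E' M] [IsManifold 𝓘(ℝ, E') ∞ M]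
  {𝒢 : LieGroupoid E E' G M}

/-! ## Projectable fields -/

section Projectable

variable {X : ∀ g : G, TangentSpace 𝓘(ℝ, E) g} {V : ∀ x : M, TangentSpace 𝓘(ℝ, E') x}

theorem srcProjects_iff : 𝒢.SrcProjects X V ↔
    ∀ g, 𝒢.tsrc ⟨g, X g⟩ = ⟨𝒢.src g, V (𝒢.src g)⟩ :=
  forall_congr' fun _ => mk_inj.symm

theorem tgtProjects_iff : 𝒢.TgtProjects X V ↔
    ∀ g, 𝒢.ttgt ⟨g, X g⟩ = ⟨𝒢.tgt g, V (𝒢.tgt g)⟩ :=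
  forall_congr' fun _ => mk_inj.symm

theorem srcProjects_zero_iff : 𝒢.SrcProjects X 0 ↔
    ∀ g, 𝒢.tsrc ⟨g, X g⟩ = fibreZero (𝒢.src g) := srcProjects_iff

theorem tgtProjects_zero_iff : 𝒢.TgtProjects X 0 ↔
    ∀ g, 𝒢.ttgt ⟨g, X g⟩ = fibreZero (𝒢.tgt g) := tgtProjects_iff

theorem SrcProjects.tsrc_mul (hX : 𝒢.SrcProjects X V) {g h : G} (H : 𝒢.src g = 𝒢.tgt h) :
    𝒢.tsrc ⟨𝒢.mul g h, X (𝒢.mul g h)⟩ = 𝒢.tsrc ⟨h, X h⟩ := by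
  rw [srcProjects_iff.1 hX, srcProjects_iff.1 hX, 𝒢.src_mul _ _ H]

/-- Restricting `ds X` to the units recovers `V`, so its smoothness need not be part of
projectability. -/
theorem SrcProjects.mem_vectorFields (hV : 𝒢.SrcProjects X V) (hX : X ∈ vectorFields E G) :
    V ∈ vectorFields E' M := by
  have h1 : ContMDiff 𝓘(ℝ, E') 𝓘(ℝ, E').tangent ∞
      (fun x => 𝒢.tsrc ⟨𝒢.one x, X (𝒢.one x)⟩) :=
    𝒢.smooth_tsrc.comp (ContMDiff.comp (show ContMDiff 𝓘(ℝ, E) 𝓘(ℝ, E).tangent ∞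
      (fun g => (⟨g, X g⟩ : TangentBundle 𝓘(ℝ, E) G)) from hX) 𝒢.smooth_one)
  have h2 : (fun x => 𝒢.tsrc ⟨𝒢.one x, X (𝒢.one x)⟩) = fun x => ⟨x, V x⟩ := by
    funext x
    rw [srcProjects_iff.1 hV, 𝒢.src_one]
  rw [h2] at h1
  exact h1

theorem SrcProjects.sub {Y : ∀ g : G, TangentSpace 𝓘(ℝ, E) g}
    {W : ∀ x : M, TangentSpace 𝓘(ℝ, E') x} (hX : 𝒢.SrcProjects X V) (hY : 𝒢.SrcProjects Y W) :
    𝒢.SrcProjects (X - Y) (V - W) := fun g => by simp [hX g, hY g]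

theorem TgtProjects.sub {Y : ∀ g : G, TangentSpace 𝓘(ℝ, E) g}
    {W : ∀ x : M, TangentSpace 𝓘(ℝ, E') x} (hX : 𝒢.TgtProjects X V) (hY : 𝒢.TgtProjects Y W) :
    𝒢.TgtProjects (X - Y) (V - W) := fun g => by simp [hX g, hY g]

theorem SrcProjects.unique {W : ∀ x : M, TangentSpace 𝓘(ℝ, E') x} (hV : 𝒢.SrcProjects X V)
    (hW : 𝒢.SrcProjects X W) : V = W := by
  funext x
  have h := (srcProjects_iff.1 hV (𝒢.one x)).symm.trans (srcProjects_iff.1 hW (𝒢.one x))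
  rw [𝒢.src_one] at h
  exact mk_inj.1 h

/-! ## The differential in degree one -/

theorem mk_defD₁ (hX : 𝒢.SrcProjects X V) (p : 𝒢.composable) :
    (⟨p.1.1, 𝒢.defD₁ X p⟩ : TangentBundle 𝓘(ℝ, E) G) =
      fibreAdd (fibreNeg (𝒢.tmul ⟨𝒢.mul p.1.1 p.1.2, X (𝒢.mul p.1.1 p.1.2)⟩
        (𝒢.tinv ⟨p.1.2, X p.1.2⟩))) ⟨p.1.1, X p.1.1⟩ := by
  rw [← mk_ddiv (hX.tsrc_mul p.2), ← mk_tangentCast (𝒢.div_mul_cancel p.2)]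
  rfl

theorem tmul_tinv_composable (hX : 𝒢.SrcProjects X V) {g h : G} (H : 𝒢.src g = 𝒢.tgt h) :
    𝒢.tsrc ⟨𝒢.mul g h, X (𝒢.mul g h)⟩ = 𝒢.ttgt (𝒢.tinv ⟨h, X h⟩) := by
  rw [ttgt_tinv, hX.tsrc_mul H]

/-- Inversion exchanges `ds` and `dt`, so `ds` of `X(gh) X(h)⁻¹` is `dt X(h)`. The result depends on
`h` alone, and it measures the failure of `X` to be `t`-projectable to `V`. -/
theorem tsrc_defD₁ (hX : 𝒢.SrcProjects X V) (p : 𝒢.composable) :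
    𝒢.tsrc ⟨p.1.1, 𝒢.defD₁ X p⟩ =
      fibreAdd (fibreNeg (𝒢.ttgt ⟨p.1.2, X p.1.2⟩)) ⟨𝒢.tgt p.1.2, V (𝒢.tgt p.1.2)⟩ := by
  have h2 : 𝒢.src p.1.1 = 𝒢.tgt p.1.2 := p.2
  rw [mk_defD₁ hX, tsrc_fibreAdd, tsrc_fibreNeg, tsrc_tmul (tmul_tinv_composable hX p.2),
    tsrc_tinv, srcProjects_iff.1 hX p.1.1, h2]
  exact 𝒢.div_mul_cancel p.2

theorem ttgt_defD₁ (hX : 𝒢.SrcProjects X V) (p : 𝒢.composable) :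
    𝒢.ttgt ⟨p.1.1, 𝒢.defD₁ X p⟩ =
      fibreAdd (fibreNeg (𝒢.ttgt ⟨𝒢.mul p.1.1 p.1.2, X (𝒢.mul p.1.1 p.1.2)⟩))
        (𝒢.ttgt ⟨p.1.1, X p.1.1⟩) := by
  rw [mk_defD₁ hX, ttgt_fibreAdd, ttgt_fibreNeg, ttgt_tmul (tmul_tinv_composable hX p.2)]
  exact 𝒢.div_mul_cancel p.2

theorem tsrc_defD₁_eq_zero_iff (hX : 𝒢.SrcProjects X V) :
    (∀ p : 𝒢.composable, 𝒢.tsrc ⟨p.1.1, 𝒢.defD₁ X p⟩ = fibreZero (𝒢.src p.1.1)) ↔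
      𝒢.TgtProjects X V := by
  rw [tgtProjects_iff]
  constructor
  · intro h g
    -- Every arrow is the second entry of a composable pair; the unit at its target serves as the
    -- first.
    have h1 := h ⟨(𝒢.one (𝒢.tgt g), g), 𝒢.src_one _⟩
    rw [tsrc_defD₁ hX, 𝒢.src_one] at h1
    exact (fibreAdd_fibreNeg_eq_zero_iff (ξ := 𝒢.ttgt ⟨g, X g⟩) (ζ := ⟨_, V (𝒢.tgt g)⟩)
      rfl rfl).1 h1
  · intro h p
    have h2 : 𝒢.src p.1.1 = 𝒢.tgt p.1.2 := p.2
    rw [tsrc_defD₁ hX, h2]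
    exact (fibreAdd_fibreNeg_eq_zero_iff (ξ := 𝒢.ttgt ⟨p.1.2, X p.1.2⟩)
      (ζ := ⟨_, V (𝒢.tgt p.1.2)⟩) rfl rfl).2 (h _)

theorem ttgt_defD₁_eq_zero (hX : 𝒢.SrcProjects X V) (hX' : 𝒢.TgtProjects X V)
    (p : 𝒢.composable) : 𝒢.ttgt ⟨p.1.1, 𝒢.defD₁ X p⟩ = fibreZero (𝒢.tgt p.1.1) := by
  have h1 := 𝒢.tgt_mul _ _ p.2
  rw [ttgt_defD₁ hX]
  refine (fibreAdd_fibreNeg_eq_zero_iff h1 rfl).2 ?_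
  rw [tgtProjects_iff.1 hX', tgtProjects_iff.1 hX', h1]

/-- In the tangent groupoid, `X(gh) X(h)⁻¹ = X(g)` and `X(gh) = X(g) X(h)` are equivalent by
multiplying with `X(h)` or its inverse. Projectability on both sides makes `X(g)` and `X(h)`
composable. -/
theorem defD₁_eq_zero_iff (hX : 𝒢.SrcProjects X V) (hX' : 𝒢.TgtProjects X V) :
    𝒢.defD₁ X = 0 ↔ ∀ g h, 𝒢.src g = 𝒢.tgt h → X (𝒢.mul g h) = 𝒢.dmul g h (X g, X h) := by
  have hc : ∀ g h, 𝒢.src g = 𝒢.tgt h → 𝒢.tsrc ⟨g, X g⟩ = 𝒢.ttgt ⟨h, X h⟩ := by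
    intro g h H
    rw [srcProjects_iff.1 hX, tgtProjects_iff.1 hX', H]
  have key : ∀ p : 𝒢.composable, 𝒢.defD₁ X p = 0 ↔
      X (𝒢.mul p.1.1 p.1.2) = 𝒢.dmul p.1.1 p.1.2 (X p.1.1, X p.1.2) := by
    intro p
    rw [← mk_eq_fibreZero_iff (N := G) rfl, mk_defD₁ hX,
      fibreAdd_fibreNeg_eq_zero_iff (𝒢.div_mul_cancel p.2) rfl, ← mk_inj (N := G)]
    constructor
    · intro h
      rw [← tmul_tinv_tmul (hX.tsrc_mul p.2), h]
      rfl
    · intro h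
      rw [h]
      exact tmul_tmul_tinv (hc _ _ p.2)
  constructor
  · intro h g k H
    exact (key ⟨(g, k), H⟩).1 (by rw [h]; rfl)
  · intro h
    funext p
    exact (key p).2 (h _ _ p.2)

theorem defD₁_mem_smoothAlong (hX : 𝒢.SrcProjects X V) (hs : X ∈ vectorFields E G) :
    𝒢.defD₁ X ∈ smoothAlong (𝓘(ℝ, E).prod 𝓘(ℝ, E)) (b := Prod.fst) contMDiff_fst 𝒢.composable := by
  have hX' : ContMDiff 𝓘(ℝ, E) 𝓘(ℝ, E).tangent ∞
      (fun g => (⟨g, X g⟩ : TangentBundle 𝓘(ℝ, E) G)) := hs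
  have h1 : (fun p : 𝒢.composable => X p.1.1) ∈
      smoothAlong (𝓘(ℝ, E).prod 𝓘(ℝ, E)) (b := Prod.fst) contMDiff_fst 𝒢.composable :=
    mem_smoothAlong_of_smoothOnSubset
      (Φ := fun q : G × G => (⟨q.1, X q.1⟩ : TangentBundle 𝓘(ℝ, E) G))
      ((hX'.comp contMDiff_fst).smoothOnSubset _) fun p => rfl
  have h2 : (fun p : 𝒢.composable => (tangentCast (𝒢.div_mul_cancel p.2)
      (𝒢.ddiv (𝒢.mul p.1.1 p.1.2) p.1.2 (X (𝒢.mul p.1.1 p.1.2), X p.1.2)) :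
        TangentSpace 𝓘(ℝ, E) p.1.1)) ∈
      smoothAlong (𝓘(ℝ, E).prod 𝓘(ℝ, E)) (b := Prod.fst) contMDiff_fst 𝒢.composable := by
    refine mem_smoothAlong_of_smoothOnSubset
      (Φ := fun q : G × G => 𝒢.tmul ⟨𝒢.mul q.1 q.2, X (𝒢.mul q.1 q.2)⟩ (𝒢.tinv ⟨q.2, X q.2⟩))
      (smoothOnSubset_tmul ?_ ?_ fun p hp => tmul_tinv_composable hX hp) fun p => ?_
    · exact (hX'.smoothOnSubset Set.univ).comp 𝒢.smooth_mul fun _ _ => trivial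
    · exact (𝒢.smooth_tinv.comp (hX'.comp contMDiff_snd)).smoothOnSubset _
    · exact (mk_ddiv (hX.tsrc_mul p.2)).symm.trans (mk_tangentCast _ _).symm
  exact Submodule.add_mem _ (Submodule.neg_mem _ h2) h1

theorem defD₁_mem_defC₂ (hX : X ∈ 𝒢.defC₁) : 𝒢.defD₁ X ∈ 𝒢.defC₂ := by
  obtain ⟨hs, V, hV⟩ := hX
  refine ⟨defD₁_mem_smoothAlong hV hs,
    fun h => -(𝒢.dtgt h (X h)) + V (𝒢.tgt h), fun p => ?_⟩
  exact mk_inj.1 ((mk_tangentCast _ _).trans (tsrc_defD₁ hV p))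

theorem mk_defD₂ {c : ∀ p : 𝒢.composable, TangentSpace 𝓘(ℝ, E) p.1.1} (p : 𝒢.composable₃)
    (h : 𝒢.tsrc ⟨𝒢.mul p.1.1 p.1.2.1, 𝒢.defVal c (𝒢.mul_composable p.2.1 p.2.2)⟩ =
      𝒢.tsrc ⟨p.1.2.1, 𝒢.defVal c p.2.2⟩) :
    (⟨p.1.1, 𝒢.defD₂ c p⟩ : TangentBundle 𝓘(ℝ, E) G) =
      fibreAdd (fibreAdd (fibreNeg (𝒢.tmul
        ⟨𝒢.mul p.1.1 p.1.2.1, 𝒢.defVal c (𝒢.mul_composable p.2.1 p.2.2)⟩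
        (𝒢.tinv ⟨p.1.2.1, 𝒢.defVal c p.2.2⟩)))
        ⟨p.1.1, 𝒢.defVal c (𝒢.composable_mul p.2.1 p.2.2)⟩)
        (fibreNeg ⟨p.1.1, 𝒢.defVal c p.2.1⟩) := by
  rw [← mk_ddiv h, ← mk_tangentCast (𝒢.div_mul_cancel p.2.1), ← mk_neg, ← mk_neg, ← mk_add,
    ← mk_add, ← sub_eq_add_neg]
  rfl

theorem mk_defVal_defD₁ (hX : 𝒢.SrcProjects X V) {g h : G} (H : 𝒢.src g = 𝒢.tgt h) :
    (⟨g, 𝒢.defVal (𝒢.defD₁ X) H⟩ : TangentBundle 𝓘(ℝ, E) G) =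
      fibreAdd (fibreNeg (𝒢.tmul ⟨𝒢.mul g h, X (𝒢.mul g h)⟩ (𝒢.tinv ⟨h, X h⟩))) ⟨g, X g⟩ :=
  mk_defD₁ hX ⟨(g, h), H⟩

theorem tsrc_defVal_defD₁ (hX : 𝒢.SrcProjects X V) {g h : G} (H : 𝒢.src g = 𝒢.tgt h) :
    𝒢.tsrc ⟨g, 𝒢.defVal (𝒢.defD₁ X) H⟩ =
      fibreAdd (fibreNeg (𝒢.ttgt ⟨h, X h⟩)) ⟨𝒢.tgt h, V (𝒢.tgt h)⟩ :=
  tsrc_defD₁ hX ⟨(g, h), H⟩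

/-- Put `D(g, h) = X(gh) X(h)⁻¹`, so `δX(g, h) = X(g) - D(g, h)`. Division is linear and `D(gh, k)
D(h, k)⁻¹ = D(g, hk)`, hence the `dm̄` term is `D(g, h) - D(g, hk)` and everything cancels. Only
`s`-projectability enters. -/
theorem defD₂_defD₁ (hX : 𝒢.SrcProjects X V) : 𝒢.defD₂ (𝒢.defD₁ X) = 0 := by
  funext p
  refine (mk_eq_fibreZero_iff (N := G) rfl).1 ((mk_defD₂ p ?_).trans ?_)
  · rw [tsrc_defVal_defD₁ hX, tsrc_defVal_defD₁ hX]
  obtain ⟨⟨g, h, k⟩, H, H'⟩ := p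
  change 𝒢.src g = 𝒢.tgt h at H
  change 𝒢.src h = 𝒢.tgt k at H'
  rw [mk_defVal_defD₁ hX, mk_defVal_defD₁ hX, mk_defVal_defD₁ hX, mk_defVal_defD₁ hX]
  simp only
  rw [𝒢.mul_assoc g h k H H']
  have b1 : 𝒢.mul (𝒢.mul g (𝒢.mul h k)) (𝒢.inv k) = 𝒢.mul g h := by
    rw [← 𝒢.mul_assoc g h k H H']
    exact 𝒢.div_mul_cancel (𝒢.mul_composable H H')
  have b2 : 𝒢.mul (𝒢.mul h k) (𝒢.inv k) = h := 𝒢.div_mul_cancel H'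
  have c1 := hX.tsrc_mul (𝒢.composable_mul H H')
  have c2 := hX.tsrc_mul H'
  rw [tinv_fibreAdd b2, tmul_fibreAdd b1 (by simp [b2]), tinv_fibreNeg, tmul_fibreNeg,
    tmul_tinv_tmul_tinv c1 c2]
  -- Both quotients have base point only provably equal to `g`; naming them as vectors at `g` itself
  -- reduces the claim to an identity in one abelian group.
  obtain ⟨a, ha⟩ : ∃ a : TangentSpace 𝓘(ℝ, E) g,
      𝒢.tmul ⟨𝒢.mul g (𝒢.mul h k), X (𝒢.mul g (𝒢.mul h k))⟩
        (𝒢.tinv ⟨𝒢.mul h k, X (𝒢.mul h k)⟩) = ⟨g, a⟩ :=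
    ⟨_, (mk_tangentCast (𝒢.div_mul_cancel (𝒢.composable_mul H H')) _).symm⟩
  obtain ⟨b, hb⟩ : ∃ b : TangentSpace 𝓘(ℝ, E) g,
      𝒢.tmul ⟨𝒢.mul g h, X (𝒢.mul g h)⟩ (𝒢.tinv ⟨h, X h⟩) = ⟨g, b⟩ :=
    ⟨_, (mk_tangentCast (𝒢.div_mul_cancel H) _).symm⟩
  rw [ha, hb]
  simp only [← mk_neg, ← mk_add]
  refine (mk_eq_fibreZero_iff rfl).2 ?_
  abel

/-! ## Cocycles in degree one are multiplicative fields -/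

theorem tgtProjects_of_defD₁_eq_zero (hX : 𝒢.SrcProjects X V) (h : 𝒢.defD₁ X = 0) :
    𝒢.TgtProjects X V := by
  refine (tsrc_defD₁_eq_zero_iff hX).1 fun p => ?_
  rw [h]
  exact tsrc_fibreZero _

/-- Since `1_x 1_x = 1_x`, the vector `X(1_x)` is idempotent in the tangent groupoid, and
idempotents of a groupoid are units. -/
theorem one_of_multiplicative (hX : 𝒢.SrcProjects X V)
    (h : ∀ g h, 𝒢.src g = 𝒢.tgt h → X (𝒢.mul g h) = 𝒢.dmul g h (X g, X h))
    (hX' : 𝒢.TgtProjects X V) (x : M) :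
    mfderiv 𝓘(ℝ, E') 𝓘(ℝ, E) 𝒢.one x (V x) = X (𝒢.one x) := by
  have H : 𝒢.src (𝒢.one x) = 𝒢.tgt (𝒢.one x) := by rw [𝒢.src_one, 𝒢.tgt_one]
  have hc : 𝒢.tsrc ⟨𝒢.one x, X (𝒢.one x)⟩ = 𝒢.ttgt ⟨𝒢.one x, X (𝒢.one x)⟩ := by
    rw [srcProjects_iff.1 hX, tgtProjects_iff.1 hX', H]
  have h1 : 𝒢.mul (𝒢.one x) (𝒢.one x) = 𝒢.one x := by
    have := 𝒢.one_mul (𝒢.one x)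
    rwa [𝒢.tgt_one] at this
  have h2 : 𝒢.tmul ⟨𝒢.one x, X (𝒢.one x)⟩ ⟨𝒢.one x, X (𝒢.one x)⟩ = ⟨𝒢.one x, X (𝒢.one x)⟩ := by
    have : 𝒢.tmul ⟨𝒢.one x, X (𝒢.one x)⟩ ⟨𝒢.one x, X (𝒢.one x)⟩ =
      ⟨𝒢.mul (𝒢.one x) (𝒢.one x), X (𝒢.mul (𝒢.one x) (𝒢.one x))⟩ := (mk_inj.2 (h _ _ H)).symm
    rwa [h1] at this
  have h3 := tinv_tmul_tmul hc
  rw [h2, tinv_tmul, srcProjects_iff.1 hX, 𝒢.src_one] at h3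
  exact mk_inj.1 h3

theorem defZ₁_eq_multiplicative : 𝒢.defZ₁ = 𝒢.multiplicative := by
  ext X
  constructor
  · rintro ⟨⟨hs, V, hV⟩, h⟩
    have h' : 𝒢.defD₁ X = 0 := h
    have hV' := tgtProjects_of_defD₁_eq_zero hV h'
    have hm := (defD₁_eq_zero_iff hV hV').1 h'
    exact ⟨hs, V, hV.mem_vectorFields hs, hV, hV', one_of_multiplicative hV hm hV', hm⟩
  · rintro ⟨hs, V, -, hV, hV', -, hm⟩
    exact ⟨⟨hs, V, hV⟩, (defD₁_eq_zero_iff hV hV').2 hm⟩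

end Projectable

/-! ## Inner fields -/

section Inner

variable {α : ∀ x : M, TangentSpace 𝓘(ℝ, E) (𝒢.one x)}

theorem mem_algebroidFibre_of_mem_sectionsA (hα : α ∈ 𝒢.sectionsA) (x : M) :
    α x ∈ 𝒢.algebroidFibre x := hα.2 x trivial

theorem mk_anchor (α : ∀ x : M, TangentSpace 𝓘(ℝ, E) (𝒢.one x)) (x : M) :
    (⟨x, 𝒢.anchor α x⟩ : TangentBundle 𝓘(ℝ, E') M) = 𝒢.ttgt ⟨𝒢.one x, α x⟩ :=
  mk_tangentCast _ _

theorem anchor_mem_vectorFields (hα : α ∈ 𝒢.sectionsA) : 𝒢.anchor α ∈ vectorFields E' M := by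
  have h : ContMDiff 𝓘(ℝ, E') 𝓘(ℝ, E').tangent ∞ (fun x => 𝒢.ttgt ⟨𝒢.one x, α x⟩) :=
    𝒢.smooth_ttgt.comp hα.1
  rw [← funext (mk_anchor α)] at h
  exact h

theorem mk_rightInvariant (hα : ∀ x, α x ∈ 𝒢.algebroidFibre x) (g : G) :
    (⟨g, 𝒢.rightInvariant α g⟩ : TangentBundle 𝓘(ℝ, E) G) =
      𝒢.tmul ⟨𝒢.one (𝒢.tgt g), α (𝒢.tgt g)⟩ (fibreZero g) :=
  mk_transportRight (hα _)

theorem rightInvariant_composable (hα : ∀ x, α x ∈ 𝒢.algebroidFibre x) (g : G) :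
    𝒢.tsrc ⟨𝒢.one (𝒢.tgt g), α (𝒢.tgt g)⟩ = 𝒢.ttgt (fibreZero g) := by
  rw [mem_algebroidFibre_iff.1 (hα _), ttgt_fibreZero]

theorem leftInvariant_composable (hα : ∀ x, α x ∈ 𝒢.algebroidFibre x) (g : G) :
    𝒢.tsrc (fibreZero g) = 𝒢.ttgt (𝒢.tinv ⟨𝒢.one (𝒢.src g), α (𝒢.src g)⟩) := by
  rw [tsrc_fibreZero, ttgt_tinv, mem_algebroidFibre_iff.1 (hα _)]

theorem rightInvariant_mem_vectorFields (hα : α ∈ 𝒢.sectionsA) :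
    𝒢.rightInvariant α ∈ vectorFields E G := by
  have hα' := mem_algebroidFibre_of_mem_sectionsA hα
  have h1 : ContMDiff 𝓘(ℝ, E) 𝓘(ℝ, E).tangent ∞
      (fun g => (⟨𝒢.one (𝒢.tgt g), α (𝒢.tgt g)⟩ : TangentBundle 𝓘(ℝ, E) G)) :=
    ContMDiff.comp (g := fun x => (⟨𝒢.one x, α x⟩ : TangentBundle 𝓘(ℝ, E) G)) hα.1
      𝒢.submersion_tgt.contMDiff
  have h2 := contMDiff_tmul h1 smooth_fibreZero (rightInvariant_composable hα')
  rw [← funext (mk_rightInvariant hα')] at h2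
  exact h2

theorem leftInvariant_mem_vectorFields (hα : α ∈ 𝒢.sectionsA) :
    𝒢.leftInvariant α ∈ vectorFields E G := by
  have hα' := mem_algebroidFibre_of_mem_sectionsA hα
  have h1 : ContMDiff 𝓘(ℝ, E) 𝓘(ℝ, E).tangent ∞
      (fun g => (⟨𝒢.one (𝒢.src g), α (𝒢.src g)⟩ : TangentBundle 𝓘(ℝ, E) G)) :=
    ContMDiff.comp (g := fun x => (⟨𝒢.one x, α x⟩ : TangentBundle 𝓘(ℝ, E) G)) hα.1
      𝒢.submersion_src.contMDiff
  have h2 := contMDiff_tmul smooth_fibreZero (𝒢.smooth_tinv.comp h1) (leftInvariant_composable hα')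
  have h3 := funext (mk_leftInvariant hα')
  simp only [Function.comp_def] at h2
  rw [← h3] at h2
  exact h2

theorem mk_defD₀ (hα : ∀ x, α x ∈ 𝒢.algebroidFibre x) (g : G) :
    (⟨g, 𝒢.defD₀ α g⟩ : TangentBundle 𝓘(ℝ, E) G) =
      fibreAdd (𝒢.tmul ⟨𝒢.one (𝒢.tgt g), α (𝒢.tgt g)⟩ (fibreZero g))
        (𝒢.tmul (fibreZero g) (𝒢.tinv ⟨𝒢.one (𝒢.src g), α (𝒢.src g)⟩)) := by
  rw [← mk_rightInvariant hα, ← mk_leftInvariant hα]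
  rfl

theorem one_mul_proj (g : G) : 𝒢.mul (𝒢.one (𝒢.tgt g)) g = 𝒢.mul g (𝒢.inv (𝒢.one (𝒢.src g))) := by
  rw [𝒢.inv_one, 𝒢.one_mul, 𝒢.mul_one]

/-- The right invariant part is killed by `ds`; the left invariant part contributes `ds(α⁻¹) = dt
α`, which is the anchor. -/
theorem defD₀_srcProjects (hα : ∀ x, α x ∈ 𝒢.algebroidFibre x) :
    𝒢.SrcProjects (𝒢.defD₀ α) (𝒢.anchor α) := by
  rw [srcProjects_iff]
  intro g
  rw [mk_defD₀ hα, tsrc_fibreAdd (one_mul_proj g), tsrc_tmul (rightInvariant_composable hα g),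
    tsrc_tmul (leftInvariant_composable hα g), tsrc_tinv, tsrc_fibreZero, mk_anchor,
    zero_fibreAdd (𝒢.tgt_one _)]

theorem defD₀_tgtProjects (hα : ∀ x, α x ∈ 𝒢.algebroidFibre x) :
    𝒢.TgtProjects (𝒢.defD₀ α) (𝒢.anchor α) := by
  rw [tgtProjects_iff]
  intro g
  rw [mk_defD₀ hα, ttgt_fibreAdd (one_mul_proj g), ttgt_tmul (rightInvariant_composable hα g),
    ttgt_tmul (leftInvariant_composable hα g), ttgt_fibreZero, mk_anchor, fibreAdd_zero]

/-- With `δα(g) = α 0_g + 0_g α⁻¹`, the interchange law splits the product into three: the outer two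
are the invariant fields at `gh`, and the mixed one is `(0_g α⁻¹)(α 0_h) = 0`. -/
theorem defD₀_mul (hα : ∀ x, α x ∈ 𝒢.algebroidFibre x) {g h : G} (H : 𝒢.src g = 𝒢.tgt h) :
    𝒢.defD₀ α (𝒢.mul g h) = 𝒢.dmul g h (𝒢.defD₀ α g, 𝒢.defD₀ α h) := by
  have hg := rightInvariant_composable hα g
  have hh := rightInvariant_composable hα h
  have kg := leftInvariant_composable hα g
  have kh := leftInvariant_composable hα h
  have hgh : 𝒢.tsrc (fibreZero g) = 𝒢.ttgt (fibreZero h) := by simp [H]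
  have split : (𝒢.defD₀ α g, 𝒢.defD₀ α h) =
      ((𝒢.rightInvariant α g, 0) : TangentSpace 𝓘(ℝ, E) g × TangentSpace 𝓘(ℝ, E) h) +
      (𝒢.leftInvariant α g, 𝒢.rightInvariant α h) + (0, 𝒢.leftInvariant α h) := by
    rw [Prod.mk_add_mk, Prod.mk_add_mk, add_zero, zero_add]
    rfl
  have e1 : 𝒢.dmul g h (𝒢.rightInvariant α g, 0) = 𝒢.rightInvariant α (𝒢.mul g h) := by
    rw [← mk_inj, mk_rightInvariant hα, 𝒢.tgt_mul _ _ H, ← tmul_fibreZero, ← tmul_assoc hg hgh,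
      ← mk_rightInvariant hα]
    rfl
  have e2 : 𝒢.dmul g h (0, 𝒢.leftInvariant α h) = 𝒢.leftInvariant α (𝒢.mul g h) := by
    rw [← mk_inj, mk_leftInvariant hα, 𝒢.src_mul _ _ H, ← tmul_fibreZero, tmul_assoc hgh kh,
      ← mk_leftInvariant hα]
    rfl
  have e3 : 𝒢.dmul g h (𝒢.leftInvariant α g, 𝒢.rightInvariant α h) = 0 := by
    have h1 : 𝒢.tmul ⟨g, 𝒢.leftInvariant α g⟩ ⟨h, 𝒢.rightInvariant α h⟩ =
        fibreZero (𝒢.mul g h) := by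
      rw [mk_leftInvariant hα, mk_rightInvariant hα, H]
      rw [H] at kg
      rw [tmul_assoc kg, tinv_tmul_tmul hh, tmul_fibreZero]
      rw [tsrc_tinv, ttgt_tmul hh]
    exact (mk_eq_fibreZero_iff rfl).1 h1
  rw [split, map_add, map_add, e1, e2, e3, add_zero]
  rfl

theorem defD₀_mem_vectorFields (hα : α ∈ 𝒢.sectionsA) : 𝒢.defD₀ α ∈ vectorFields E G :=
  Submodule.add_mem _ (rightInvariant_mem_vectorFields hα) (leftInvariant_mem_vectorFields hα)

theorem defB₁_le_defZ₁ : 𝒢.defB₁ ≤ 𝒢.defZ₁ := by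
  rintro _ ⟨α, hα, rfl⟩
  have hα' := mem_algebroidFibre_of_mem_sectionsA hα
  have h1 := defD₀_srcProjects hα'
  exact ⟨⟨defD₀_mem_vectorFields hα, _, h1⟩,
    (defD₁_eq_zero_iff h1 (defD₀_tgtProjects hα')).2 fun _ _ => defD₀_mul hα'⟩

theorem innerMultiplicative_eq_defB₁ : 𝒢.innerMultiplicative = 𝒢.defB₁ := by
  ext X
  exact ⟨fun ⟨α, hα, h⟩ => ⟨α, hα, h.symm⟩, fun ⟨α, hα, h⟩ => ⟨α, hα, h.symm⟩⟩

theorem defB₂_le_defZ₂ : 𝒢.defB₂ ≤ 𝒢.defZ₂ := by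
  rintro _ ⟨X, hX, rfl⟩
  exact ⟨defD₁_mem_defC₂ hX, defD₂_defD₁ hX.2.choose_spec⟩

theorem imAnchor_le_vectorFields : 𝒢.imAnchor ≤ vectorFields E' M := by
  rintro _ ⟨α, hα, rfl⟩
  exact anchor_mem_vectorFields hα

end Inner

end

end LieGroupoid

/-- A linear map that vanishes on the kernel of a surjective linear map factors through it. -/
theorem LinearMap.exists_factor_of_surjective {k A B C : Type*} [Field k] [AddCommGroup A]
    [Module k A] [AddCommGroup B] [Module k B] [AddCommGroup C] [Module k C] {f : A →ₗ[k] B}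
    (hf : Function.Surjective f) {g : A →ₗ[k] C} (h : ∀ a, f a = 0 → g a = 0) :
    ∃ F : B →ₗ[k] C, ∀ a, F (f a) = g a := by
  obtain ⟨s, hs⟩ := f.exists_rightInverse_of_surjective (LinearMap.range_eq_top.2 hf)
  refine ⟨g.comp s, fun a => ?_⟩
  have h1 : f (s (f a) - a) = 0 := by
    rw [map_sub, sub_eq_zero]
    exact LinearMap.congr_fun hs (f a)
  have h2 := h _ h1
  rw [map_sub, sub_eq_zero] at h2
  exact h2

namespace LieGroupoid

noncomputable section

variable {E E' G M : Type*}
  [NormedAddCommGroup E] [NormedSpace ℝ E] [NormedAddCommGroup E'] [NormedSpace ℝ E']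
  [TopologicalSpace G] [ChartedSpace E G] [IsManifold 𝓘(ℝ, E) ∞ G]
  [TopologicalSpace M] [ChartedSpace E' M] [IsManifold 𝓘(ℝ, E') ∞ M]
  {𝒢 : LieGroupoid E E' G M}

/-! ## The image of the inclusion -/

theorem incl₁_srcProjects {u : ∀ g : G, TangentSpace 𝓘(ℝ, E) (𝒢.one (𝒢.tgt g))}
    (hu : ∀ g, u g ∈ 𝒢.isotropyFibre (𝒢.tgt g)) : 𝒢.SrcProjects (𝒢.incl₁ u) 0 :=
  srcProjects_zero_iff.2 fun g => tsrc_transportRight (hu g).1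

theorem incl₁_tgtProjects {u : ∀ g : G, TangentSpace 𝓘(ℝ, E) (𝒢.one (𝒢.tgt g))}
    (hu : ∀ g, u g ∈ 𝒢.isotropyFibre (𝒢.tgt g)) : 𝒢.TgtProjects (𝒢.incl₁ u) 0 :=
  tgtProjects_zero_iff.2 fun g =>
    (ttgt_transportRight (hu g).1).trans (mem_isotropyFibre_iff.1 (hu g)).2

theorem incl₁_mem_vectorFields {u : ∀ g : G, TangentSpace 𝓘(ℝ, E) (𝒢.one (𝒢.tgt g))}
    (hu : u ∈ 𝒢.isoC₁) : 𝒢.incl₁ u ∈ vectorFields E G := by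
  have h1 : ∀ g, u g ∈ 𝒢.algebroidFibre (𝒢.tgt g) := fun g => (hu.2 g trivial).1
  have h2 := contMDiff_tmul (𝒢 := 𝒢) hu.1 smooth_fibreZero fun g => by
    rw [mem_algebroidFibre_iff.1 (h1 g), ttgt_fibreZero]
  rw [← funext fun g => mk_transportRight (h1 g)] at h2
  exact h2

theorem incl₁_injective {u v : ∀ g : G, TangentSpace 𝓘(ℝ, E) (𝒢.one (𝒢.tgt g))}
    (hu : ∀ g, u g ∈ 𝒢.isotropyFibre (𝒢.tgt g)) (hv : ∀ g, v g ∈ 𝒢.isotropyFibre (𝒢.tgt g))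
    (h : 𝒢.incl₁ u = 𝒢.incl₁ v) : u = v := by
  funext g
  rw [← transportBack_transportRight (hu g).1, ← transportBack_transportRight (hv g).1]
  exact congrArg (𝒢.transportBack g) (congrFun h g)

/-- Right translation by `g⁻¹` carries vectors killed by `ds` and `dt` into the isotropy, and it is
smooth as a product with a zero vector. -/
theorem exists_incl₁_eq {X : ∀ g : G, TangentSpace 𝓘(ℝ, E) g} (hX : X ∈ vectorFields E G)
    (hs : 𝒢.SrcProjects X 0) (ht : 𝒢.TgtProjects X 0) : ∃ u ∈ 𝒢.isoC₁, 𝒢.incl₁ u = X := by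
  rw [srcProjects_zero_iff] at hs
  rw [tgtProjects_zero_iff] at ht
  refine ⟨fun g => 𝒢.transportBack g (X g),
    ⟨?_, fun g _ => transportBack_mem_isotropyFibre (hs g) (ht g)⟩,
    funext fun g => transportRight_transportBack (hs g)⟩
  have h2 := contMDiff_tmul (𝒢 := 𝒢) (IP := 𝓘(ℝ, E))
    (f := fun g => (⟨g, X g⟩ : TangentBundle 𝓘(ℝ, E) G)) (f' := fun g => fibreZero (𝒢.inv g)) hX
    (smooth_fibreZero.comp 𝒢.smooth_inv)
    fun g => by rw [hs g, ttgt_fibreZero, 𝒢.tgt_inv]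
  rw [← funext fun g => mk_transportBack (hs g)] at h2
  exact h2

theorem incl₂_mem_defC₂ {u : ∀ p : 𝒢.composable, TangentSpace 𝓘(ℝ, E) (𝒢.one (𝒢.tgt p.1.1))}
    (hu : u ∈ 𝒢.isoC₂) : 𝒢.incl₂ u ∈ 𝒢.defC₂ := by
  have h1 : ∀ p : 𝒢.composable, u p ∈ 𝒢.algebroidFibre (𝒢.tgt p.1.1) :=
    fun p => (hu.2 p trivial).1
  refine ⟨?_, 0, fun p => ?_⟩
  · obtain ⟨Φ, hΦ, hΦu⟩ := exists_smoothOnSubset_of_mem_smoothAlong hu.1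
    refine mem_smoothAlong_of_smoothOnSubset (Φ := fun q => 𝒢.tmul (Φ q) (fibreZero q.1))
      (smoothOnSubset_tmul hΦ ((smooth_fibreZero.comp contMDiff_fst).smoothOnSubset _)
        fun p hp => ?_) fun p => ?_
    · rw [hΦu ⟨p, hp⟩, mem_algebroidFibre_iff.1 (h1 ⟨p, hp⟩), ttgt_fibreZero]
    · rw [hΦu p]
      exact (mk_transportRight (h1 p)).symm
  · refine mk_inj.1 ((mk_tangentCast _ _).trans ((tsrc_transportRight (h1 p)).trans ?_))
    have h2 : 𝒢.src p.1.1 = 𝒢.tgt p.1.2 := p.2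
    rw [h2]
    rfl

theorem incl₂_injective
    {u v : ∀ p : 𝒢.composable, TangentSpace 𝓘(ℝ, E) (𝒢.one (𝒢.tgt p.1.1))}
    (hu : ∀ p, u p ∈ 𝒢.isotropyFibre (𝒢.tgt p.1.1))
    (hv : ∀ p, v p ∈ 𝒢.isotropyFibre (𝒢.tgt p.1.1)) (h : 𝒢.incl₂ u = 𝒢.incl₂ v) : u = v := by
  funext p
  rw [← transportBack_transportRight (hu p).1, ← transportBack_transportRight (hv p).1]
  exact congrArg (𝒢.transportBack p.1.1) (congrFun h p)

variable (𝒢) in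
/-- The left inverse of `incl₂`. -/
def retract₂ : (∀ p : 𝒢.composable, TangentSpace 𝓘(ℝ, E) p.1.1) →ₗ[ℝ]
    (∀ p : 𝒢.composable, TangentSpace 𝓘(ℝ, E) (𝒢.one (𝒢.tgt p.1.1))) where
  toFun c p := 𝒢.transportBack p.1.1 (c p)
  map_add' c d := by ext p; simp
  map_smul' a c := by ext p; simp

theorem incl₂_retract₂ {c : ∀ p : 𝒢.composable, TangentSpace 𝓘(ℝ, E) p.1.1}
    (hs : ∀ p : 𝒢.composable, 𝒢.tsrc ⟨p.1.1, c p⟩ = fibreZero (𝒢.src p.1.1)) :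
    𝒢.incl₂ (𝒢.retract₂ c) = c :=
  funext fun p => transportRight_transportBack (hs p)

theorem retract₂_mem_isoC₂ {c : ∀ p : 𝒢.composable, TangentSpace 𝓘(ℝ, E) p.1.1}
    (hc : c ∈ smoothAlong (𝓘(ℝ, E).prod 𝓘(ℝ, E)) (b := Prod.fst) contMDiff_fst 𝒢.composable)
    (hs : ∀ p : 𝒢.composable, 𝒢.tsrc ⟨p.1.1, c p⟩ = fibreZero (𝒢.src p.1.1))
    (ht : ∀ p : 𝒢.composable, 𝒢.ttgt ⟨p.1.1, c p⟩ = fibreZero (𝒢.tgt p.1.1)) :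
    𝒢.retract₂ c ∈ 𝒢.isoC₂ := by
  refine ⟨?_, fun p _ => transportBack_mem_isotropyFibre (hs p) (ht p)⟩
  obtain ⟨Φ, hΦ, hΦc⟩ := exists_smoothOnSubset_of_mem_smoothAlong hc
  refine mem_smoothAlong_of_smoothOnSubset (Φ := fun q => 𝒢.tmul (Φ q) (fibreZero (𝒢.inv q.1)))
    (smoothOnSubset_tmul hΦ
      ((smooth_fibreZero.comp (𝒢.smooth_inv.comp contMDiff_fst)).smoothOnSubset _)
      fun p hp => ?_) fun p => ?_
  · rw [hΦc ⟨p, hp⟩, hs ⟨p, hp⟩, ttgt_fibreZero, 𝒢.tgt_inv]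
  · rw [hΦc p]
    exact (mk_transportBack (hs p)).symm

theorem incl₁_mem_defC₁ {u : ∀ g : G, TangentSpace 𝓘(ℝ, E) (𝒢.one (𝒢.tgt g))}
    (hu : u ∈ 𝒢.isoC₁) : 𝒢.incl₁ u ∈ 𝒢.defC₁ :=
  ⟨incl₁_mem_vectorFields hu, 0, incl₁_srcProjects fun g => hu.2 g trivial⟩

/-- A chain in degree two with a differential that vanishes after inclusion is a cocycle. -/
theorem mem_isoZ₂_of_incl₂ {u : ∀ p : 𝒢.composable, TangentSpace 𝓘(ℝ, E) (𝒢.one (𝒢.tgt p.1.1))}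
    (hu : u ∈ 𝒢.isoC₂) : u ∈ 𝒢.isoZ₂ ↔ 𝒢.defD₂ (𝒢.incl₂ u) = 0 := by
  have hu' : ∀ p, u p ∈ 𝒢.isotropyFibre (𝒢.tgt p.1.1) := fun p => hu.2 p trivial
  rw [defD₂_incl₂ hu']
  constructor
  · rintro ⟨-, h⟩
    have h' : 𝒢.isoD₂ u = 0 := h
    rw [h']
    exact funext fun p => map_zero (𝒢.transportRight p.1.1)
  · intro h
    refine ⟨hu, funext fun p => ?_⟩
    have h1 := transportBack_transportRight (isoD₂_mem_isotropyFibre hu' p).1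
    have h2 : 𝒢.transportRight p.1.1 (𝒢.isoD₂ u p) = 0 := congrFun h p
    rw [h2, map_zero] at h1
    exact h1.symm

theorem mem_isoZ₁_iff {u : ∀ g : G, TangentSpace 𝓘(ℝ, E) (𝒢.one (𝒢.tgt g))}
    (hu : u ∈ 𝒢.isoC₁) : u ∈ 𝒢.isoZ₁ ↔ 𝒢.incl₁ u ∈ 𝒢.defZ₁ := by
  have hu' : ∀ g, u g ∈ 𝒢.isotropyFibre (𝒢.tgt g) := fun g => hu.2 g trivial
  have h0 := defD₁_incl₁ hu'
  constructor
  · rintro ⟨-, h⟩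
    have h' : 𝒢.isoD₁ u = 0 := h
    rw [h', map_zero] at h0
    exact ⟨incl₁_mem_defC₁ hu, h0⟩
  · rintro ⟨-, h⟩
    have h' : 𝒢.defD₁ (𝒢.incl₁ u) = 0 := h
    refine ⟨hu, incl₂_injective (v := 0) (isoD₁_mem_isotropyFibre hu')
      (fun p => Submodule.zero_mem _) ?_⟩
    rw [← h0, h', map_zero]

/-! ## Coboundaries of the isotropy complex -/

theorem mem_isotropyFibre_of_mem_sectionsIso {α : ∀ x : M, TangentSpace 𝓘(ℝ, E) (𝒢.one x)}
    (hα : α ∈ 𝒢.sectionsIso) (x : M) : α x ∈ 𝒢.isotropyFibre x := by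
  have h : 𝒢.anchor α = 0 := hα.2
  rw [mem_isotropyFibre_iff, ← mem_algebroidFibre_iff, ← mk_anchor, h]
  exact ⟨mem_algebroidFibre_of_mem_sectionsA hα.1 x, rfl⟩

theorem isoD₀_mem_isotropyFibre {α : ∀ x : M, TangentSpace 𝓘(ℝ, E) (𝒢.one x)}
    (hα : ∀ x, α x ∈ 𝒢.isotropyFibre x) (g : G) : 𝒢.isoD₀ α g ∈ 𝒢.isotropyFibre (𝒢.tgt g) :=
  Submodule.sub_mem _ (ad_mem_isotropyFibre (hα _)) (hα _)

/-- Smoothness of `g ↦ ad_g α - α` is obtained indirectly: its right translate is `-δα`, a smooth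
cocycle killed by `ds` and `dt`, which comes from a smooth isotropy cochain; injectivity identifies
the two. -/
theorem isoB₁_le_isoZ₁ : 𝒢.isoB₁ ≤ 𝒢.isoZ₁ := by
  rintro _ ⟨α, hα, rfl⟩
  have hα' := mem_isotropyFibre_of_mem_sectionsIso hα
  have hu := isoD₀_mem_isotropyFibre hα'
  have h1 : 𝒢.incl₁ (𝒢.isoD₀ α) = - 𝒢.defD₀ α := by rw [defD₀_eq_neg_incl₁ hα', neg_neg]
  have h2 : 𝒢.incl₁ (𝒢.isoD₀ α) ∈ 𝒢.defZ₁ := by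
    rw [h1]
    exact Submodule.neg_mem _ (defB₁_le_defZ₁ (Submodule.mem_map_of_mem hα.1))
  obtain ⟨v, hv, hvu⟩ := exists_incl₁_eq h2.1.1 (incl₁_srcProjects hu) (incl₁_tgtProjects hu)
  have h3 : v = 𝒢.isoD₀ α := incl₁_injective (fun g => hv.2 g trivial) hu hvu
  rw [h3] at hv
  exact (mem_isoZ₁_iff hv).2 h2

/-- Again smoothness is read off after inclusion: `r(δw) = δ(r w)`, and translating back to the
units preserves smoothness. -/
theorem isoB₂_le_isoZ₂ : 𝒢.isoB₂ ≤ 𝒢.isoZ₂ := by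
  rintro _ ⟨w, hw, rfl⟩
  have hw' : ∀ g, w g ∈ 𝒢.isotropyFibre (𝒢.tgt g) := fun g => hw.2 g trivial
  have h1 := isoD₁_mem_isotropyFibre hw'
  have h2 := defD₁_incl₁ hw'
  have hs := incl₁_srcProjects hw'
  have ht := incl₁_tgtProjects hw'
  have h3 : 𝒢.retract₂ (𝒢.defD₁ (𝒢.incl₁ w)) ∈ 𝒢.isoC₂ :=
    retract₂_mem_isoC₂ (defD₁_mem_smoothAlong hs (incl₁_mem_vectorFields hw))
      ((tsrc_defD₁_eq_zero_iff hs).2 ht) (ttgt_defD₁_eq_zero hs ht)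
  have h4 : 𝒢.retract₂ (𝒢.defD₁ (𝒢.incl₁ w)) = 𝒢.isoD₁ w := by
    rw [h2]
    exact funext fun p => transportBack_transportRight (h1 p).1
  rw [h4] at h3
  refine (mem_isoZ₂_of_incl₂ h3).2 ?_
  rw [← h2, defD₂_defD₁ hs]

/-! ## Degree zero -/

theorem isoZ₀_eq_invariantSectionsIso : 𝒢.isoZ₀ = 𝒢.invariantSectionsIso := by
  ext α
  refine and_congr Iff.rfl ⟨fun h g => ?_, fun h => funext fun g => ?_⟩
  · exact sub_eq_zero.1 (congrFun (show 𝒢.isoD₀ α = 0 from h) g)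
  · exact sub_eq_zero.2 (h g)

/-- The base field of `δα` is `ρ(α)` and base fields are unique. -/
theorem mem_sectionsIso_of_defD₀ {α : ∀ x : M, TangentSpace 𝓘(ℝ, E) (𝒢.one x)}
    (hα : α ∈ 𝒢.sectionsA) (h : 𝒢.SrcProjects (𝒢.defD₀ α) 0) : α ∈ 𝒢.sectionsIso :=
  ⟨hα, (defD₀_srcProjects (mem_algebroidFibre_of_mem_sectionsA hα)).unique h⟩

theorem defZ₀_eq_isoZ₀ : 𝒢.defZ₀ = 𝒢.isoZ₀ := by
  ext α
  constructor
  · rintro ⟨hα, h⟩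
    have h' : 𝒢.defD₀ α = 0 := h
    have hi : α ∈ 𝒢.sectionsIso := mem_sectionsIso_of_defD₀ hα (by
      rw [h', srcProjects_zero_iff]
      exact fun g => tsrc_fibreZero g)
    have hi' := mem_isotropyFibre_of_mem_sectionsIso hi
    refine ⟨hi, incl₁_injective (v := 0) (isoD₀_mem_isotropyFibre hi')
      (fun g => Submodule.zero_mem _) ?_⟩
    rw [map_zero, ← neg_eq_zero, ← defD₀_eq_neg_incl₁ hi', h']
  · rintro ⟨hi, h⟩
    have h' : 𝒢.isoD₀ α = 0 := h
    refine ⟨hi.1, ?_⟩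
    show 𝒢.defD₀ α = 0
    rw [defD₀_eq_neg_incl₁ (mem_isotropyFibre_of_mem_sectionsIso hi), h',
      map_zero, neg_zero]

/-! ## Lifts of vector fields on the base -/

variable (𝒢) in
/-- The restriction to the units of `ds X`; if `X` is `s`-projectable, this is its base field. -/
def baseField : (∀ g : G, TangentSpace 𝓘(ℝ, E) g) →ₗ[ℝ] (∀ x : M, TangentSpace 𝓘(ℝ, E') x) where
  toFun X x := tangentCast (𝒢.src_one x) (𝒢.dsrc (𝒢.one x) (X (𝒢.one x)))
  map_add' X Y := by ext x; simp
  map_smul' a X := by ext x; simp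

theorem SrcProjects.baseField_eq {X : ∀ g : G, TangentSpace 𝓘(ℝ, E) g}
    {V : ∀ x : M, TangentSpace 𝓘(ℝ, E') x} (h : 𝒢.SrcProjects X V) : 𝒢.baseField X = V := by
  funext x
  refine mk_inj.1 ((mk_tangentCast _ _).trans ((srcProjects_iff.1 h (𝒢.one x)).trans ?_))
  rw [𝒢.src_one]

variable (𝒢) in
/-- The fields that are `(s, t)`-lifts of their base field. -/
def lifts : Submodule ℝ (∀ g : G, TangentSpace 𝓘(ℝ, E) g) where
  carrier := {X | 𝒢.IsLift X (𝒢.baseField X)}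
  zero_mem' := by
    refine ⟨Submodule.zero_mem _, fun g => ?_, fun g => ?_⟩ <;> simp
  add_mem' := by
    rintro X Y ⟨hX, h1, h2⟩ ⟨hY, k1, k2⟩
    refine ⟨Submodule.add_mem _ hX hY, fun g => ?_, fun g => ?_⟩
    · simp [h1 g, k1 g]
    · simp [h2 g, k2 g]
  smul_mem' := by
    rintro a X ⟨hX, h1, h2⟩
    refine ⟨Submodule.smul_mem _ a hX, fun g => ?_, fun g => ?_⟩
    · simp [h1 g]
    · simp [h2 g]

theorem IsLift.mem_lifts {X : ∀ g : G, TangentSpace 𝓘(ℝ, E) g}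
    {V : ∀ x : M, TangentSpace 𝓘(ℝ, E') x} (h : 𝒢.IsLift X V) : X ∈ 𝒢.lifts := by
  have h1 := h.2.1.baseField_eq
  subst h1
  exact h

theorem defZ₁_le_lifts : 𝒢.defZ₁ ≤ 𝒢.lifts := by
  rintro X ⟨⟨hX, V, hV⟩, h⟩
  exact IsLift.mem_lifts ⟨hX, hV, tgtProjects_of_defD₁_eq_zero hV h⟩

variable (𝒢) in
/-- The class in `Γ(ν)^inv` of the base field of a lift. -/
def liftsToNormal : 𝒢.lifts →ₗ[ℝ] 𝒢.invariantNormal where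
  toFun X := 𝒢.invariantClass
    ⟨⟨𝒢.baseField X, X.2.2.1.mem_vectorFields X.2.1⟩, X, X.2⟩
  map_add' X Y := by
    refine Subtype.ext (congrArg 𝒢.normalClass (Subtype.ext ?_))
    exact map_add 𝒢.baseField _ _
  map_smul' a X := by
    refine Subtype.ext (congrArg 𝒢.normalClass (Subtype.ext ?_))
    exact map_smul 𝒢.baseField _ _

theorem liftsToNormal_eq {X : ∀ g : G, TangentSpace 𝓘(ℝ, E) g} {V : 𝒢.liftable}
    (h : 𝒢.IsLift X V) : 𝒢.liftsToNormal ⟨X, h.mem_lifts⟩ = 𝒢.invariantClass V :=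
  congrArg 𝒢.invariantClass (Subtype.ext (Subtype.ext h.2.1.baseField_eq))

/-- This presents `Γ(ν)^inv` as a quotient of the space of lifts, through which `K` will be
factored. -/
theorem liftsToNormal_surjective : Function.Surjective 𝒢.liftsToNormal := by
  rintro ⟨_, V, ⟨X, hX⟩, rfl⟩
  exact ⟨⟨X, hX.mem_lifts⟩, liftsToNormal_eq (V := ⟨V, X, hX⟩) hX⟩

theorem liftsToNormal_eq_zero_iff (X : 𝒢.lifts) :
    𝒢.liftsToNormal X = 0 ↔ 𝒢.baseField X ∈ 𝒢.imAnchor := by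
  rw [← Submodule.coe_eq_zero]
  exact Submodule.Quotient.mk_eq_zero _

/-- A lift of a field in the image of the anchor is inner up to an isotropy valued cochain. -/
theorem exists_eq_add_of_baseField_mem {X : ∀ g : G, TangentSpace 𝓘(ℝ, E) g} (hX : X ∈ 𝒢.lifts)
    (h : 𝒢.baseField X ∈ 𝒢.imAnchor) :
    ∃ α ∈ 𝒢.sectionsA, ∃ w ∈ 𝒢.isoC₁, X = 𝒢.incl₁ w + 𝒢.defD₀ α := by
  obtain ⟨α, hα, hαV⟩ := h
  have hα' := mem_algebroidFibre_of_mem_sectionsA hα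
  obtain ⟨hs, h1, h2⟩ := hX
  -- `X` and `δα` lift the same field, so their difference projects to zero under both `s` and `t`.
  have k1 := h1.sub (defD₀_srcProjects hα')
  have k2 := h2.sub (defD₀_tgtProjects hα')
  rw [hαV, sub_self] at k1 k2
  obtain ⟨w, hw, hwX⟩ := exists_incl₁_eq
    (Submodule.sub_mem _ hs (defD₀_mem_vectorFields hα)) k1 k2
  exact ⟨α, hα, w, hw, by rw [hwX, sub_add_cancel]⟩

theorem incl₂_retract₂_defD₁ {X : ∀ g : G, TangentSpace 𝓘(ℝ, E) g} (hX : X ∈ 𝒢.lifts) :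
    𝒢.incl₂ (𝒢.retract₂ (𝒢.defD₁ X)) = 𝒢.defD₁ X :=
  incl₂_retract₂ ((tsrc_defD₁_eq_zero_iff hX.2.1).2 hX.2.2)

/-- For a lift, `δX` is killed by `ds` and `dt`, hence is the right translate of an isotropy
cochain, which is closed because `δδX = 0`. -/
theorem retract₂_defD₁_mem_isoZ₂ {X : ∀ g : G, TangentSpace 𝓘(ℝ, E) g} (hX : X ∈ 𝒢.lifts) :
    𝒢.retract₂ (𝒢.defD₁ X) ∈ 𝒢.isoZ₂ := by
  have h1 := (tsrc_defD₁_eq_zero_iff hX.2.1).2 hX.2.2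
  refine (mem_isoZ₂_of_incl₂ (retract₂_mem_isoC₂ (defD₁_mem_smoothAlong hX.2.1 hX.1) h1
    (ttgt_defD₁_eq_zero hX.2.1 hX.2.2))).2 ?_
  rw [incl₂_retract₂_defD₁ hX, defD₂_defD₁ hX.2.1]

variable (𝒢) in
/-- The isotropy valued cocycle `u` with `δ X = c_u`, for a lift `X`. -/
def curvature : 𝒢.lifts →ₗ[ℝ] 𝒢.isoZ₂ :=
  ((𝒢.retract₂.comp 𝒢.defD₁).comp 𝒢.lifts.subtype).codRestrict 𝒢.isoZ₂
    fun X => retract₂_defD₁_mem_isoZ₂ X.2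

theorem incl₂_curvature (X : 𝒢.lifts) :
    𝒢.incl₂ (𝒢.curvature X) = 𝒢.defD₁ X := incl₂_retract₂_defD₁ X.2

theorem isoZ₂_ext {u v : 𝒢.isoZ₂}
    (h : 𝒢.incl₂ (u : ∀ p : 𝒢.composable, TangentSpace 𝓘(ℝ, E) (𝒢.one (𝒢.tgt p.1.1))) =
      𝒢.incl₂ v) : u = v :=
  Subtype.ext (incl₂_injective (fun p => u.2.1.2 p trivial) (fun p => v.2.1.2 p trivial) h)

theorem isoClass₂_eq_zero_iff (u : 𝒢.isoZ₂) : 𝒢.isoClass₂ u = 0 ↔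
    ∃ w ∈ 𝒢.isoC₁, 𝒢.defD₁ (𝒢.incl₁ w) = 𝒢.incl₂ u := by
  refine (Submodule.Quotient.mk_eq_zero _).trans ?_
  constructor
  · rintro ⟨w, hw, hwu⟩
    exact ⟨w, hw, (defD₁_incl₁ fun g => hw.2 g trivial).trans (congrArg 𝒢.incl₂ hwu)⟩
  · rintro ⟨w, hw, hwu⟩
    have hw' : ∀ g, w g ∈ 𝒢.isotropyFibre (𝒢.tgt g) := fun g => hw.2 g trivial
    rw [defD₁_incl₁ hw'] at hwu
    exact ⟨w, hw, incl₂_injective (isoD₁_mem_isotropyFibre hw') (fun p => u.2.1.2 p trivial) hwu⟩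

/-- If `r(u) = δα`, then `ρ(α) = 0`, because `r(u)` has base field zero. A primitive of an isotropy
cocycle is thus itself isotropic; this is the injectivity of `r` in degree one. -/
theorem isoClass₁_eq_zero_iff (u : 𝒢.isoZ₁) : 𝒢.isoClass₁ u = 0 ↔
    𝒢.incl₁ u ∈ 𝒢.defB₁ := by
  refine (Submodule.Quotient.mk_eq_zero _).trans ?_
  have hu : ∀ g, (u : ∀ g : G, TangentSpace 𝓘(ℝ, E) (𝒢.one (𝒢.tgt g))) g ∈
    𝒢.isotropyFibre (𝒢.tgt g) := fun g => u.2.1.2 g trivial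
  constructor
  · rintro ⟨α, hα, h⟩
    -- The sign compensates `δα = -r(δα)` in degree zero.
    refine ⟨-α, Submodule.neg_mem _ hα.1, ?_⟩
    rw [map_neg, defD₀_eq_neg_incl₁ (mem_isotropyFibre_of_mem_sectionsIso hα), neg_neg]
    exact congrArg 𝒢.incl₁ h
  · rintro ⟨α, hα, h⟩
    have hi : α ∈ 𝒢.sectionsIso := mem_sectionsIso_of_defD₀ hα (by
      rw [h]
      exact incl₁_srcProjects hu)
    have hi' := mem_isotropyFibre_of_mem_sectionsIso (Submodule.neg_mem _ hi)
    refine ⟨-α, Submodule.neg_mem _ hi, incl₁_injective (isoD₀_mem_isotropyFibre hi') hu ?_⟩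
    rw [← neg_neg (𝒢.incl₁ (𝒢.isoD₀ (-α))), ← defD₀_eq_neg_incl₁ hi', map_neg, neg_neg]
    exact h

theorem defClass₁_eq_zero_iff (X : 𝒢.defZ₁) : 𝒢.defClass₁ X = 0 ↔
    (X : ∀ g : G, TangentSpace 𝓘(ℝ, E) g) ∈ 𝒢.defB₁ :=
  Submodule.Quotient.mk_eq_zero _

theorem defClass₂_eq_zero_iff (c : 𝒢.defZ₂) : 𝒢.defClass₂ c = 0 ↔
    (c : ∀ p : 𝒢.composable, TangentSpace 𝓘(ℝ, E) p.1.1) ∈ 𝒢.defB₂ :=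
  Submodule.Quotient.mk_eq_zero _

/-! ## The maps of the exact sequence -/

variable (𝒢)

theorem incl₁_mem_defZ₁ {u} (hu : u ∈ 𝒢.isoZ₁) : 𝒢.incl₁ u ∈ 𝒢.defZ₁ := (mem_isoZ₁_iff hu.1).1 hu

theorem incl₂_mem_defZ₂ {u} (hu : u ∈ 𝒢.isoZ₂) : 𝒢.incl₂ u ∈ 𝒢.defZ₂ :=
  ⟨incl₂_mem_defC₂ hu.1, (mem_isoZ₂_of_incl₂ hu.1).1 hu⟩

theorem exists_isoH₁_map : ∃ r : 𝒢.IsoH₁ →ₗ[ℝ] 𝒢.DefH₁, ∀ u : 𝒢.isoZ₁,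
    r (𝒢.isoClass₁ u) = 𝒢.defClass₁ ⟨𝒢.incl₁ u, 𝒢.incl₁_mem_defZ₁ u.2⟩ := by
  refine LinearMap.exists_factor_of_surjective (f := Submodule.mkQ _)
    (g := (Submodule.mkQ _).comp (𝒢.incl₁.restrict fun _ => 𝒢.incl₁_mem_defZ₁))
    (Submodule.mkQ_surjective _) fun u hu => ?_
  exact (defClass₁_eq_zero_iff _).2 ((isoClass₁_eq_zero_iff u).1 hu)

theorem exists_isoH₂_map : ∃ r : 𝒢.IsoH₂ →ₗ[ℝ] 𝒢.DefH₂, ∀ u : 𝒢.isoZ₂,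
    r (𝒢.isoClass₂ u) = 𝒢.defClass₂ ⟨𝒢.incl₂ u, 𝒢.incl₂_mem_defZ₂ u.2⟩ := by
  refine LinearMap.exists_factor_of_surjective (f := Submodule.mkQ _)
    (g := (Submodule.mkQ _).comp (𝒢.incl₂.restrict fun _ => 𝒢.incl₂_mem_defZ₂))
    (Submodule.mkQ_surjective _) fun u hu => ?_
  obtain ⟨w, hw, hwu⟩ := (isoClass₂_eq_zero_iff u).1 hu
  exact (defClass₂_eq_zero_iff _).2 ⟨_, incl₁_mem_defC₁ hw, hwu⟩

theorem exists_defH₁_map : ∃ π : 𝒢.DefH₁ →ₗ[ℝ] 𝒢.invariantNormal, ∀ X : 𝒢.defZ₁,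
    π (𝒢.defClass₁ X) = 𝒢.liftsToNormal ⟨X, defZ₁_le_lifts X.2⟩ := by
  refine LinearMap.exists_factor_of_surjective (f := Submodule.mkQ _)
    (g := 𝒢.liftsToNormal.comp (Submodule.inclusion defZ₁_le_lifts))
    (Submodule.mkQ_surjective _) fun X hX => ?_
  obtain ⟨α, hα, h⟩ := (defClass₁_eq_zero_iff X).1 hX
  refine (liftsToNormal_eq_zero_iff _).2 ⟨α, hα, ?_⟩
  rw [← (defD₀_srcProjects (mem_algebroidFibre_of_mem_sectionsA hα)).baseField_eq, h]
  rfl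

/-- A lift of a field in the image of the anchor is `r(w) + δα`, and its differential is `δ(r w)`,
the inclusion of an isotropy coboundary. So neither the lift nor the representative of the class
matters. -/
theorem exists_curvature_map : ∃ K : 𝒢.invariantNormal →ₗ[ℝ] 𝒢.IsoH₂, ∀ X : 𝒢.lifts,
    K (𝒢.liftsToNormal X) = 𝒢.isoClass₂ (𝒢.curvature X) := by
  refine LinearMap.exists_factor_of_surjective liftsToNormal_surjective
    (g := (Submodule.mkQ _).comp 𝒢.curvature) fun X hX => ?_
  obtain ⟨α, hα, w, hw, h⟩ :=
    exists_eq_add_of_baseField_mem X.2 ((liftsToNormal_eq_zero_iff X).1 hX)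
  refine (isoClass₂_eq_zero_iff _).2 ⟨w, hw, ?_⟩
  have h1 : 𝒢.defD₁ (𝒢.defD₀ α) = 0 := (defB₁_le_defZ₁ (Submodule.mem_map_of_mem hα)).2
  rw [incl₂_curvature, h, map_add, h1, add_zero]

variable {𝒢}

/-! ## Exactness -/

theorem injective_of_isoH₁_map {r : 𝒢.IsoH₁ →ₗ[ℝ] 𝒢.DefH₁} (hr : ∀ u : 𝒢.isoZ₁,
    r (𝒢.isoClass₁ u) = 𝒢.defClass₁ ⟨𝒢.incl₁ u, 𝒢.incl₁_mem_defZ₁ u.2⟩) :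
    Function.Injective r := by
  refine (injective_iff_map_eq_zero r).2 fun a ha => ?_
  obtain ⟨u, rfl⟩ := Submodule.Quotient.mk_surjective _ a
  rw [hr, defClass₁_eq_zero_iff] at ha
  exact (isoClass₁_eq_zero_iff u).2 ha

theorem exact_at_defH₁ {r : 𝒢.IsoH₁ →ₗ[ℝ] 𝒢.DefH₁} (hr : ∀ u : 𝒢.isoZ₁,
      r (𝒢.isoClass₁ u) = 𝒢.defClass₁ ⟨𝒢.incl₁ u, 𝒢.incl₁_mem_defZ₁ u.2⟩)
    {π : 𝒢.DefH₁ →ₗ[ℝ] 𝒢.invariantNormal} (hπ : ∀ X : 𝒢.defZ₁,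
      π (𝒢.defClass₁ X) = 𝒢.liftsToNormal ⟨X, defZ₁_le_lifts X.2⟩) : Function.Exact r π := by
  intro a
  constructor
  · obtain ⟨X, rfl⟩ := Submodule.Quotient.mk_surjective _ a
    intro ha
    rw [hπ, liftsToNormal_eq_zero_iff] at ha
    obtain ⟨α, hα, w, hw, h⟩ := exists_eq_add_of_baseField_mem (defZ₁_le_lifts X.2) ha
    have hB : 𝒢.defD₀ α ∈ 𝒢.defB₁ := Submodule.mem_map_of_mem hα
    have hw' : w ∈ 𝒢.isoZ₁ := by
      -- The isotropy part `r(w) = X - δα` is a difference of cocycles.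
      rw [mem_isoZ₁_iff hw, ← add_sub_cancel_right (𝒢.incl₁ w) (𝒢.defD₀ α), ← h]
      exact Submodule.sub_mem _ X.2 (defB₁_le_defZ₁ hB)
    refine ⟨𝒢.isoClass₁ ⟨w, hw'⟩, ?_⟩
    rw [hr]
    refine ((Submodule.Quotient.eq _).2 ?_).symm
    show (X : ∀ g : G, TangentSpace 𝓘(ℝ, E) g) - 𝒢.incl₁ w ∈ 𝒢.defB₁
    rw [h, add_sub_cancel_left]
    exact hB
  · rintro ⟨b, rfl⟩
    obtain ⟨u, rfl⟩ := Submodule.Quotient.mk_surjective _ b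
    rw [hr, hπ, liftsToNormal_eq_zero_iff]
    show 𝒢.baseField (𝒢.incl₁ u) ∈ 𝒢.imAnchor
    rw [(incl₁_srcProjects fun g => u.2.1.2 g trivial).baseField_eq]
    exact Submodule.zero_mem _

/-- If `δX = δ(r w)`, then `X - r(w)` is a cocycle, with the same base field as `X` since `r(w)`
projects to zero. -/
theorem exact_at_normal {π : 𝒢.DefH₁ →ₗ[ℝ] 𝒢.invariantNormal} (hπ : ∀ X : 𝒢.defZ₁,
      π (𝒢.defClass₁ X) = 𝒢.liftsToNormal ⟨X, defZ₁_le_lifts X.2⟩)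
    {K : 𝒢.invariantNormal →ₗ[ℝ] 𝒢.IsoH₂} (hK : ∀ X : 𝒢.lifts,
      K (𝒢.liftsToNormal X) = 𝒢.isoClass₂ (𝒢.curvature X)) : Function.Exact π K := by
  intro a
  constructor
  · obtain ⟨X, rfl⟩ := liftsToNormal_surjective a
    intro ha
    rw [hK, isoClass₂_eq_zero_iff, incl₂_curvature] at ha
    obtain ⟨w, hw, h⟩ := ha
    have hw' : ∀ g, w g ∈ 𝒢.isotropyFibre (𝒢.tgt g) := fun g => hw.2 g trivial
    have hs := X.2.2.1.sub (incl₁_srcProjects hw')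
    have hZ : (X : ∀ g : G, TangentSpace 𝓘(ℝ, E) g) - 𝒢.incl₁ w ∈ 𝒢.defZ₁ := by
      refine ⟨⟨Submodule.sub_mem _ X.2.1 (incl₁_mem_vectorFields hw), _, hs⟩, ?_⟩
      show 𝒢.defD₁ ((X : ∀ g : G, TangentSpace 𝓘(ℝ, E) g) - 𝒢.incl₁ w) = 0
      rw [map_sub, h, sub_self]
    refine ⟨𝒢.defClass₁ ⟨_, hZ⟩, ?_⟩
    rw [hπ]
    refine congrArg 𝒢.invariantClass (Subtype.ext (Subtype.ext ?_))
    show 𝒢.baseField (X - 𝒢.incl₁ w) = 𝒢.baseField X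
    rw [hs.baseField_eq, sub_zero]
  · rintro ⟨b, rfl⟩
    obtain ⟨X, rfl⟩ := Submodule.Quotient.mk_surjective _ b
    rw [hπ, hK, isoClass₂_eq_zero_iff]
    refine ⟨0, Submodule.zero_mem _, ?_⟩
    have h : 𝒢.defD₁ X = 0 := X.2.2
    rw [incl₂_curvature, map_zero, map_zero]
    exact h.symm

/-- If `δX = r(u)` for an `s`-projectable `X`, then `ds δX = 0`, which forces `X` to be
`t`-projectable to the same field. Hence `X` is a lift and `u` its curvature. -/
theorem exact_at_isoH₂ {K : 𝒢.invariantNormal →ₗ[ℝ] 𝒢.IsoH₂} (hK : ∀ X : 𝒢.lifts,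
      K (𝒢.liftsToNormal X) = 𝒢.isoClass₂ (𝒢.curvature X))
    {r : 𝒢.IsoH₂ →ₗ[ℝ] 𝒢.DefH₂} (hr : ∀ u : 𝒢.isoZ₂,
      r (𝒢.isoClass₂ u) = 𝒢.defClass₂ ⟨𝒢.incl₂ u, 𝒢.incl₂_mem_defZ₂ u.2⟩) :
    Function.Exact K r := by
  intro a
  constructor
  · obtain ⟨u, rfl⟩ := Submodule.Quotient.mk_surjective _ a
    intro ha
    rw [hr, defClass₂_eq_zero_iff] at ha
    obtain ⟨X, ⟨hs, V, hV⟩, h⟩ := ha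
    have h' : 𝒢.defD₁ X = 𝒢.incl₂ u := h
    have ht : 𝒢.TgtProjects X V := by
      refine (tsrc_defD₁_eq_zero_iff hV).1 fun p => ?_
      rw [h']
      exact tsrc_transportRight (u.2.1.2 p trivial).1
    have hl : X ∈ 𝒢.lifts := IsLift.mem_lifts ⟨hs, hV, ht⟩
    refine ⟨𝒢.liftsToNormal ⟨X, hl⟩, ?_⟩
    rw [hK]
    exact congrArg 𝒢.isoClass₂ (isoZ₂_ext ((incl₂_curvature ⟨X, hl⟩).trans h'))
  · rintro ⟨b, rfl⟩
    obtain ⟨X, rfl⟩ := liftsToNormal_surjective b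
    rw [hK, hr, defClass₂_eq_zero_iff]
    exact ⟨X, ⟨X.2.1, _, X.2.2.1⟩, (incl₂_curvature X).symm⟩

end

end LieGroupoid

/-! ### Assembly of the exact sequence and the low degree identifications -/

theorem mainTheorem9 {E E' G M : Type*}
    [NormedAddCommGroup E] [NormedSpace ℝ E] [FiniteDimensional ℝ E]
    [NormedAddCommGroup E'] [NormedSpace ℝ E'] [FiniteDimensional ℝ E']
    [TopologicalSpace G] [ChartedSpace E G] [IsManifold 𝓘(ℝ, E) ∞ G]
    [TopologicalSpace M] [ChartedSpace E' M] [IsManifold 𝓘(ℝ, E') ∞ M]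
    (𝒢 : LieGroupoid E E' G M) :
    -- coboundaries are cocycles, and `Im ρ` consists of smooth vector fields
    (𝒢.isoB₁ ≤ 𝒢.isoZ₁ ∧ 𝒢.isoB₂ ≤ 𝒢.isoZ₂ ∧ 𝒢.defB₁ ≤ 𝒢.defZ₁ ∧ 𝒢.defB₂ ≤ 𝒢.defZ₂ ∧
      𝒢.imAnchor ≤ vectorFields E' M) ∧
    -- the exact sequence
    (∃ (r₁ : 𝒢.IsoH₁ →ₗ[ℝ] 𝒢.DefH₁) (π : 𝒢.DefH₁ →ₗ[ℝ] 𝒢.invariantNormal)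
        (K : 𝒢.invariantNormal →ₗ[ℝ] 𝒢.IsoH₂) (r₂ : 𝒢.IsoH₂ →ₗ[ℝ] 𝒢.DefH₂),
      -- the maps `r` are induced by the inclusion of complexes
      (∀ u : 𝒢.isoZ₁, ∃ h : 𝒢.incl₁ u ∈ 𝒢.defZ₁,
        r₁ (𝒢.isoClass₁ u) = 𝒢.defClass₁ ⟨𝒢.incl₁ u, h⟩) ∧
      (∀ u : 𝒢.isoZ₂, ∃ h : 𝒢.incl₂ u ∈ 𝒢.defZ₂,
        r₂ (𝒢.isoClass₂ u) = 𝒢.defClass₂ ⟨𝒢.incl₂ u, h⟩) ∧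
      -- `π` maps the class of `X` to that of its base field
      (∀ X : 𝒢.defZ₁, ∃ V : 𝒢.liftable, 𝒢.IsLift X V ∧
        π (𝒢.defClass₁ X) = 𝒢.invariantClass V) ∧
      -- `K` maps the class of `V` to that of `δ X`, for any `(s, t)`-lift `X` of `V`
      (∀ (V : 𝒢.liftable) (X : ∀ g : G, TangentSpace 𝓘(ℝ, E) g), 𝒢.IsLift X V →
        ∃ u : 𝒢.isoZ₂, 𝒢.incl₂ u = 𝒢.defD₁ X ∧ K (𝒢.invariantClass V) = 𝒢.isoClass₂ u) ∧
      Function.Injective r₁ ∧ Function.Exact r₁ π ∧ Function.Exact π K ∧ Function.Exact K r₂) ∧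
    -- degree zero
    (𝒢.defZ₀ = 𝒢.invariantSectionsIso ∧ 𝒢.isoZ₀ = 𝒢.invariantSectionsIso) ∧
    -- degree one and multiplicative vector fields
    (𝒢.innerMultiplicative ≤ 𝒢.multiplicative ∧
      ∃ e : 𝒢.DefH₁ ≃ₗ[ℝ]
          (𝒢.multiplicative ⧸ 𝒢.innerMultiplicative.submoduleOf 𝒢.multiplicative),
        ∀ X : 𝒢.defZ₁, ∃ h : (X : ∀ g : G, TangentSpace 𝓘(ℝ, E) g) ∈ 𝒢.multiplicative,
          e (𝒢.defClass₁ X) = Submodule.Quotient.mk ⟨X, h⟩) := by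
  obtain ⟨r₁, hr₁⟩ := 𝒢.exists_isoH₁_map
  obtain ⟨r₂, hr₂⟩ := 𝒢.exists_isoH₂_map
  obtain ⟨π, hπ⟩ := 𝒢.exists_defH₁_map
  obtain ⟨K, hK⟩ := 𝒢.exists_curvature_map
  refine ⟨⟨LieGroupoid.isoB₁_le_isoZ₁, LieGroupoid.isoB₂_le_isoZ₂, LieGroupoid.defB₁_le_defZ₁,
    LieGroupoid.defB₂_le_defZ₂, LieGroupoid.imAnchor_le_vectorFields⟩,
    ⟨r₁, π, K, r₂, fun u => ⟨_, hr₁ u⟩, fun u => ⟨_, hr₂ u⟩, fun X => ?_, fun V X hX => ?_,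
      LieGroupoid.injective_of_isoH₁_map hr₁, LieGroupoid.exact_at_defH₁ hr₁ hπ,
      LieGroupoid.exact_at_normal hπ hK, LieGroupoid.exact_at_isoH₂ hK hr₂⟩,
    ⟨LieGroupoid.defZ₀_eq_isoZ₀.trans LieGroupoid.isoZ₀_eq_invariantSectionsIso,
      LieGroupoid.isoZ₀_eq_invariantSectionsIso⟩, ?_⟩
  · have hX := LieGroupoid.defZ₁_le_lifts X.2
    exact ⟨⟨⟨𝒢.baseField X, hX.2.1.mem_vectorFields hX.1⟩, X, hX⟩, hX, hπ X⟩
  · refine ⟨𝒢.curvature ⟨X, hX.mem_lifts⟩, LieGroupoid.incl₂_curvature ⟨X, hX.mem_lifts⟩, ?_⟩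
    rw [← LieGroupoid.liftsToNormal_eq hX, hK]
  · rw [LieGroupoid.innerMultiplicative_eq_defB₁, ← LieGroupoid.defZ₁_eq_multiplicative]
    -- After the rewriting both quotients are literally the same, so the identity is the required
    -- isomorphism.
    exact ⟨LieGroupoid.defB₁_le_defZ₁, LinearEquiv.refl ℝ _, fun X => ⟨X.2, rfl⟩⟩
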